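/- **Setting.** Let $V$ be a Banach $\mathbb O$-bimodule (unital; $[p,q,x]=[q,x,p]=[x,p,q]=-[q,p,x]$ and $\|px\|=\|xp\|=|p|\,\|x\|$ for $p,q\in\mathbb O$, $x\in V$), with real part $\operatorname{Re}V=\{m: [p,q,m]=0,\ pm=mp\ \ \forall p,q\in\mathbb O\}$, so that $V=\bigoplus_{i=0}^7(\operatorname{Re}V)e_i$, and with real part projection $\operatorname{Re}x=\frac5{12}x-\frac1{12}\sum_{i=1}^7e_ixe_i$. For a bounded real-linear operator $A$ on $V$ put $B_p(A,x)=A(x)p-A(xp)$. $A$ is *right para-linear* if $\operatorname{Re}B_p(A,x)=0$ for all $p,x$. Put $$(p\odot A)(x)=pA(x)+B_p(A,x),\qquad (A\odot p)(x)=A(px)-B_p(A,x),$$ $[A,p,q]=(A\odot p)\odot q-A\odot(pq)$ and $[p,q,A]=(pq)\odot A-p\odot(q\odot A)$. If $A$ is invertible as a bounded real-linear operator, put $A^{\circledcirc-}\big(\sum_i x_ie_i\big)=\sum_i A^{-1}(x_i)e_i$ for $x_i\in\operatorname{Re}V$, and $A^{-\circledcirc}(x)=\sum_i \operatorname{Re}\big(A^{-1}(x\overline{e_i})\big)e_i$.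 Let $R_s(v)=vs$. The bounded operator $T$ is *power-associative* if $T^n$ is right para-linear for all $n\ge0$. Let $\mathbb S$ be the set of imaginary units of $\mathbb O$ and $\mathbb C_J=\mathbb R+\mathbb RJ$ for $J\in\mathbb S$. Let $\rho^*_J(T)$ (resp. $\rho_{*J}(T)$) be the set of $s\in\mathbb C_J$ for which $S=(R_s-T)^{-1}$ exists as a bounded real-linear operator and $S^n(v\lambda)=S^n(v)\lambda$ for all $n\ge1$, $v\in\operatorname{Re}V$, $\lambda\in\mathbb C_J$ (resp. $\operatorname{Re}S^n(v\lambda)=\operatorname{Re}(S^n(v)\lambda)$ for all $n\ge1$, $v\in V$, $\lambda\in\mathbb C_J$). Put $\sigma^*(T)=\mathbb O\setminus\bigcup_J\rho^*_J(T)$ and $\sigma_*(T)=\mathbb O\setminus\bigcup_J\rho_{*J}(T)$. A *$T$-left-admissible* (resp. *$T$-right-admissible*) domain is a bounded axially symmetric domain $U\subseteq\mathbb O$ that contains $\sigma^*(T)$ (resp. $\sigma_*(T)$) and meets $\mathbb R$, such that for all $J\in\mathbb S$ the set $U\cap\mathbb C_J$ is a domain in $\mathbb C_J$ whose boundary is a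 union of finitely many continuously differentiable Jordan curves. Boundary integrals are taken with positive orientation, and $ds_J=-ds\,J$. Let $W$ be axially symmetric and slice-open (each $W\cap\mathbb C_J$ is open in $\mathbb C_J$). A left (resp. right) slice function on $W$ is one of the form $f(x+yJ)=F_1(x+iy)+JF_2(x+iy)$ (resp. $F_1+F_2J$) for a stem function $F=F_1+\imath F_2$ (that is, $F(\bar z)=\overline{F(z)}$); it is *slice preserving* if $F_1,F_2$ are real-valued. The slice products $\bullet^L,\bullet^R$ come from the product of stem functions in $\mathbb O\otimes_{\mathbb R}\mathbb C$. A function $f$ that is $C^1$ on each slice $W\cap\mathbb C_J$ is left (resp. right) *slice regular* if $\partial_xf+J\,\partial_yf=0$ (resp. $\partial_xf+(\partial_yf)J=0$) on $W\cap\mathbb C_J$ for all $J\in\mathbb S$. It is in the $\mathbb C_J$-slice if $f=f_0+J\bullet^Lf_1$ (resp. $f=f_0+J\bullet^Rf_1$) with $f_0,f_1$ slice preserving and slice regular on $W$. A *standard basis* is $\{b_0=1,b_1,\dots,b_7\}$ with $b_i=\tau(e_i)$ for an automorphism $\tau$ of the algebra $\mathbb O$. **The calculi.** Let $T$ be power-associative.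 For slice preserving slice regular $g$ on $W$ put $$g^*(T)_J=\frac1{2\pi}\int_{\partial(U\cap\mathbb C_J)}(R_s-T)^{\circledcirc-}\odot(ds_J\,g(s)),\qquad g_*(T)_J=\frac1{2\pi}\int_{\partial(U\cap\mathbb C_J)}(g(s)\,ds_J)\odot(R_s-T)^{-\circledcirc},$$ where $U$ is some $T$-left-admissible (resp. $T$-right-admissible) domain with $\overline U\subseteq W$. They are extended by $f^*(T)_J=\sum_{i=0}^7 f_{(i)}^*(T)_J\odot e_i$ for $f=\sum_i f_{(i)}\bullet^Le_i$, and by $f_*(T)_J=\sum_{i=0}^7 e_i\odot (f_{(i)})_*(T)_J$ for $f=\sum_i e_i\bullet^Rf_{(i)}$, with $f_{(i)}$ slice preserving. **Theorem.** Let $T$ be power-associative, $J\in\mathbb S$, $W$ as above, and $\{b_i\}$ any standard basis (for instance $b_i=e_i$). (1) Let $f$ be left slice regular on $W$ and let $U$ be any $T$-left-admissible domain with $\overline U\subseteq W$. If $f=\sum_{i=0}^7f_{(i)}\bullet^Lb_i$ on $W$ with slice preserving $f_{(i)}$, then $f^*(T)_J$ is right para-linear, all integrals below exist, and $$f^*(T)_J=\frac1{2\pi}\int_{\partial(U\cap\mathbb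 C_J)}(R_s-T)^{\circledcirc-}\odot(ds_J\,f(s))+\frac1{2\pi}\sum_{i=1}^7\int_{\partial(U\cap\mathbb C_J)}\big[(R_s-T)^{\circledcirc-},\,ds_J\,f_{(i)}(s),\,b_i\big].$$ If $f$ is in the $\mathbb C_J$-slice, then $$f^*(T)_J=\frac1{2\pi}\int_{\partial(U\cap\mathbb C_J)}(R_s-T)^{\circledcirc-}\odot(ds_J\,f(s)),$$ and for every $v\in\operatorname{Re}V$ $$f^*(T)_J(v)=\frac1{2\pi}\int_{\partial(U\cap\mathbb C_J)}(R_s-T)^{-1}(v)\,(ds_J\,f(s)).$$ (2) Let $f$ be right slice regular on $W$ and let $U$ be any $T$-right-admissible domain with $\overline U\subseteq W$. If $f=\sum_{i=0}^7b_i\bullet^Rf_{(i)}$ on $W$ with slice preserving $f_{(i)}$, then $f_*(T)_J$ is right para-linear, all integrals below exist, and $$f_*(T)_J=\frac1{2\pi}\int_{\partial(U\cap\mathbb C_J)}(f(s)\,ds_J)\odot(R_s-T)^{-\circledcirc}-\frac1{2\pi}\sum_{i=1}^7\int_{\partial(U\cap\mathbb C_J)}\big[b_i,\,f_{(i)}(s)\,ds_J,\,(R_s-T)^{-\circledcirc}\big].$$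 If $f$ is in the $\mathbb C_J$-slice, then $$f_*(T)_J=\frac1{2\pi}\int_{\partial(U\cap\mathbb C_J)}(f(s)\,ds_J)\odot(R_s-T)^{-\circledcirc},$$ and for every $v\in V$ $$\operatorname{Re}f_*(T)_J(v)=\operatorname{Re}\frac1{2\pi}\int_{\partial(U\cap\mathbb C_J)}(R_s-T)^{-1}(v)\,(f(s)\,ds_J).$$ -/

import Mathlib

open scoped Real ComplexConjugate
open Set

noncomputable section

namespace OctonionCalculus

/-! ### Octonions -/

/-- The octonions, as the Euclidean space `ℝ⁸` with orthonormal basis `e 0 = 1, e 1, …, e 7`. -/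
abbrev 𝕆 : Type := EuclideanSpace ℝ (Fin 8)

/-- The basis octonions. -/
def e (i : Fin 8) : 𝕆 := EuclideanSpace.single i 1

instance : One 𝕆 := ⟨e 0⟩

/-- The product with `e i * e j = ε_{ijk} e k - δ_{ij}` for `i, j ≥ 1`, where `ε_{ijk} = 1` on the
oriented triples `(123), (145), (176), (246), (257), (347), (365)`. -/
instance : Mul 𝕆 := ⟨fun x y => !₂[
  x 0 * y 0 - x 1 * y 1 - x 2 * y 2 - x 3 * y 3 - x 4 * y 4 - x 5 * y 5 - x 6 * y 6 - x 7 * y 7,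
  x 0 * y 1 + x 1 * y 0 + (x 2 * y 3 - x 3 * y 2) + (x 4 * y 5 - x 5 * y 4)
    + (x 7 * y 6 - x 6 * y 7),
  x 0 * y 2 + x 2 * y 0 + (x 3 * y 1 - x 1 * y 3) + (x 4 * y 6 - x 6 * y 4)
    + (x 5 * y 7 - x 7 * y 5),
  x 0 * y 3 + x 3 * y 0 + (x 1 * y 2 - x 2 * y 1) + (x 4 * y 7 - x 7 * y 4)
    + (x 6 * y 5 - x 5 * y 6),
  x 0 * y 4 + x 4 * y 0 + (x 5 * y 1 - x 1 * y 5) + (x 6 * y 2 - x 2 * y 6)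
    + (x 7 * y 3 - x 3 * y 7),
  x 0 * y 5 + x 5 * y 0 + (x 1 * y 4 - x 4 * y 1) + (x 7 * y 2 - x 2 * y 7)
    + (x 3 * y 6 - x 6 * y 3),
  x 0 * y 6 + x 6 * y 0 + (x 1 * y 7 - x 7 * y 1) + (x 2 * y 4 - x 4 * y 2)
    + (x 5 * y 3 - x 3 * y 5),
  x 0 * y 7 + x 7 * y 0 + (x 6 * y 1 - x 1 * y 6) + (x 2 * y 5 - x 5 * y 2)
    + (x 3 * y 4 - x 4 * y 3)]⟩

/-- Octonionic conjugation. -/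
def oconj (x : 𝕆) : 𝕆 := !₂[x 0, -x 1, -x 2, -x 3, -x 4, -x 5, -x 6, -x 7]

/-- The sphere of imaginary units. -/
def imagUnits : Set 𝕆 := {J | J * J = -1}

/-- The real-linear map `ℂ → 𝕆`, `x + y i ↦ x + y J`, with range the slice `ℂ_J`. -/
def slice (J : 𝕆) (z : ℂ) : 𝕆 := z.re • (1 : 𝕆) + z.im • J

/-- The slice `ℂ_J = ℝ + ℝ J`. -/
def sliceC (J : 𝕆) : Set 𝕆 := range (slice J)

/-- The bases `{1, J₁, …, J₇}` obtained from `{1, e₁, …, e₇}` by an automorphism of `𝕆`. -/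
def IsStandardBasis (b : Fin 8 → 𝕆) : Prop :=
  ∃ τ : 𝕆 ≃ₗ[ℝ] 𝕆, (∀ x y, τ (x * y) = τ x * τ y) ∧ ∀ i, b i = τ (e i)

/-! ### Octonionic bimodules -/

/-- An `𝕆`-bimodule; `lsmul p x` is `p x` and `rsmul p x` is `x p`. -/
class OctonionBimodule (M : Type*) [AddCommGroup M] [Module ℝ M] where
  lsmul : 𝕆 →ₗ[ℝ] M →ₗ[ℝ] M
  rsmul : 𝕆 →ₗ[ℝ] M →ₗ[ℝ] M
  one_lsmul : ∀ x, lsmul 1 x = x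
  one_rsmul : ∀ x, rsmul 1 x = x
  /-- `[p, q, x] = [q, x, p]` -/
  assoc_left_mid : ∀ p q x,
    lsmul (p * q) x - lsmul p (lsmul q x) = rsmul p (lsmul q x) - lsmul q (rsmul p x)
  /-- `[q, x, p] = [x, p, q]` -/
  assoc_mid_right : ∀ p q x,
    rsmul p (lsmul q x) - lsmul q (rsmul p x) = rsmul q (rsmul p x) - rsmul (p * q) x
  /-- `[x, p, q] = -[q, p, x]` -/
  assoc_right_left : ∀ p q x,
    rsmul q (rsmul p x) - rsmul (p * q) x = -(lsmul (q * p) x - lsmul q (lsmul p x))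

/-- A normed `𝕆`-bimodule; together with `CompleteSpace V` a Banach `𝕆`-bimodule. -/
class NormedOctonionBimodule (V : Type*) [NormedAddCommGroup V] [NormedSpace ℝ V] extends
    OctonionBimodule V where
  norm_lsmul : ∀ p x, ‖lsmul p x‖ = ‖p‖ * ‖x‖
  norm_rsmul : ∀ p x, ‖rsmul p x‖ = ‖p‖ * ‖x‖

section Operators

variable {V : Type*} [NormedAddCommGroup V] [NormedSpace ℝ V] [NormedOctonionBimodule V]

/-- Left multiplication `x ↦ p x` as a bounded real-linear operator. -/
def lmul (p : 𝕆) : V →L[ℝ] V :=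
  (OctonionBimodule.lsmul p).mkContinuous ‖p‖ fun x => (NormedOctonionBimodule.norm_lsmul p x).le

/-- Right multiplication `R_p : x ↦ x p` as a bounded real-linear operator. -/
def rmul (p : 𝕆) : V →L[ℝ] V :=
  (OctonionBimodule.rsmul p).mkContinuous ‖p‖ fun x => (NormedOctonionBimodule.norm_rsmul p x).le

variable (V) in
/-- The real part `Re V`: associative elements commuting with all octonions. -/
def realElements : Set V :=
  {m | (∀ p q : 𝕆, lmul (p * q) m - lmul p (lmul q m) = 0) ∧ ∀ p : 𝕆, lmul p m = rmul p m}

variable (V) in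
/-- The real part operator, the projection of `V = ⨁ e_i Re V` onto `Re V`, given by
`Re x = (5/12) x - (1/12) ∑_{i=1}^7 e_i x e_i`. -/
def reOp : V →L[ℝ] V :=
  (5 / 12 : ℝ) • ContinuousLinearMap.id ℝ V
    - (1 / 12 : ℝ) • ∑ i : Fin 7, (rmul (e i.succ)).comp (lmul (e i.succ))

/-- The second right associator `B_p(f, x) = f(x) p - f(x p)`. -/
def secondAssoc (p : 𝕆) (f : V →L[ℝ] V) : V →L[ℝ] V := (rmul p).comp f - f.comp (rmul p)

/-- Right para-linearity: `Re B_p(f, x) = 0`. -/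
def IsParaLinear (f : V →L[ℝ] V) : Prop := ∀ (p : 𝕆) (x : V), reOp V (secondAssoc p f x) = 0

/-- `(p ⊙ f)(x) = p f(x) + B_p(f, x)`. -/
def odotL (p : 𝕆) (f : V →L[ℝ] V) : V →L[ℝ] V := (lmul p).comp f + secondAssoc p f

/-- `(f ⊙ p)(x) = f(p x) - B_p(f, x)`. -/
def odotR (f : V →L[ℝ] V) (p : 𝕆) : V →L[ℝ] V := f.comp (lmul p) - secondAssoc p f

/-- The right associator `[f, p, q] = (f ⊙ p) ⊙ q - f ⊙ (p q)`. -/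
def opAssocR (f : V →L[ℝ] V) (p q : 𝕆) : V →L[ℝ] V := odotR (odotR f p) q - odotR f (p * q)

/-- The left associator `[p, q, f] = (p q) ⊙ f - p ⊙ (q ⊙ f)`. -/
def opAssocL (p q : 𝕆) (f : V →L[ℝ] V) : V →L[ℝ] V := odotL (p * q) f - odotL p (odotL q f)

/-- `ext (f|_{Re V})`: sends `x = ∑ x_i e_i`, where `x_i = Re (x ē_i)`, to `∑ f(x_i) e_i`. -/
def extOp (f : V →L[ℝ] V) : V →L[ℝ] V :=
  ∑ i : Fin 8, (rmul (e i)).comp (f.comp ((reOp V).comp (rmul (oconj (e i)))))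

/-- `lif (Re ∘ f)`: sends `x` to `∑ Re (f (x ē_i)) e_i`. -/
def lifOp (f : V →L[ℝ] V) : V →L[ℝ] V :=
  ∑ i : Fin 8, (rmul (e i)).comp ((reOp V).comp (f.comp (rmul (oconj (e i)))))

/-- Power-associative (right para-linear) operators. -/
def IsPowerAssociative (T : V →L[ℝ] V) : Prop := ∀ n : ℕ, IsParaLinear (T ^ n)

/-- `(R_s - T)⁻¹` in the algebra of bounded real-linear operators (used only where it exists). -/
def resolventInv (T : V →L[ℝ] V) (s : 𝕆) : V →L[ℝ] V := Ring.inverse (rmul s - T)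

/-- The left resolvent operator `(R_s - T)^{⊚-}`. -/
def leftResolvent (T : V →L[ℝ] V) (s : 𝕆) : V →L[ℝ] V := extOp (resolventInv T s)

/-- The right resolvent operator `(R_s - T)^{-⊚}`. -/
def rightResolvent (T : V →L[ℝ] V) (s : 𝕆) : V →L[ℝ] V := lifOp (resolventInv T s)

/-! ### Spectra -/

/-- `ℂ_J`-extendable power associative operators. -/
def IsExtendable (J : 𝕆) (S : V →L[ℝ] V) : Prop :=
  ∀ n : ℕ, 1 ≤ n → ∀ v ∈ realElements V, ∀ s ∈ sliceC J, (S ^ n) (rmul s v) = rmul s ((S ^ n) v)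

/-- `ℂ_J`-liftable power associative operators. -/
def IsLiftable (J : 𝕆) (S : V →L[ℝ] V) : Prop :=
  ∀ n : ℕ, 1 ≤ n → ∀ v : V, ∀ s ∈ sliceC J,
    reOp V ((S ^ n) (rmul s v)) = reOp V (rmul s ((S ^ n) v))

/-- The pull-back slice-resolvent set `ρ*_J(T)`. -/
def pullbackSliceResolvent (T : V →L[ℝ] V) (J : 𝕆) : Set 𝕆 :=
  {s | s ∈ sliceC J ∧ IsUnit (rmul s - T) ∧ IsExtendable J (resolventInv T s)}

/-- The pull-back spectrum `σ*(T)`. -/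
def pullbackSpectrum (T : V →L[ℝ] V) : Set 𝕆 :=
  (⋃ J ∈ imagUnits, pullbackSliceResolvent T J)ᶜ

/-- The push-forward slice-resolvent set `ρ_{*J}(T)`. -/
def pushforwardSliceResolvent (T : V →L[ℝ] V) (J : 𝕆) : Set 𝕆 :=
  {s | s ∈ sliceC J ∧ IsUnit (rmul s - T) ∧ IsLiftable J (resolventInv T s)}

/-- The push-forward spectrum `σ_*(T)`. -/
def pushforwardSpectrum (T : V →L[ℝ] V) : Set 𝕆 :=
  (⋃ J ∈ imagUnits, pushforwardSliceResolvent T J)ᶜ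

end Operators

/-! ### Slice functions -/

/-- `Ω_D`, the set of all `x + y J` with `x + y i ∈ D` and `J` an imaginary unit. -/
def circularization (D : Set ℂ) : Set 𝕆 := {q | ∃ z ∈ D, ∃ J ∈ imagUnits, q = slice J z}

/-- Axially symmetric sets: `W = Ω_D` with `D` invariant under conjugation. -/
def IsAxiallySymmetric (W : Set 𝕆) : Prop := ∃ D : Set ℂ, (∀ z ∈ D, conj z ∈ D) ∧
  W = circularization D

/-- Slice-open sets: every `W ∩ ℂ_J` is open in `ℂ_J`. -/
def IsSliceOpen (W : Set 𝕆) : Prop := ∀ J ∈ imagUnits, IsOpen (slice J ⁻¹' W)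

/-- The product of the complexification of `𝕆`, with `x + ı y` written as the pair `(x, y)`. -/
def cmul (a b : 𝕆 × 𝕆) : 𝕆 × 𝕆 := (a.1 * b.1 - a.2 * b.2, a.1 * b.2 + a.2 * b.1)

/-- `F = F₁ + ı F₂` is a stem function on `D`: `F(z̄)` is the complex conjugate of `F(z)`. -/
def IsStemOn (D : Set ℂ) (F : ℂ → 𝕆 × 𝕆) : Prop :=
  ∀ z ∈ D, (F (conj z)).1 = (F z).1 ∧ (F (conj z)).2 = -(F z).2

/-- On the axially symmetric set `W`, `f` is the left slice function induced by the stem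
function `F`: `f(x + y J) = F₁(x + y i) + J F₂(x + y i)`. -/
def IsLeftInduced (W : Set 𝕆) (F : ℂ → 𝕆 × 𝕆) (f : 𝕆 → 𝕆) : Prop :=
  ∃ D : Set ℂ, (∀ z ∈ D, conj z ∈ D) ∧ W = circularization D ∧ IsStemOn D F ∧
    ∀ z ∈ D, ∀ J ∈ imagUnits, f (slice J z) = (F z).1 + J * (F z).2

/-- On the axially symmetric set `W`, `f` is the right slice function induced by the stem
function `F`: `f(x + y J) = F₁(x + y i) + F₂(x + y i) J`. -/
def IsRightInduced (W : Set 𝕆) (F : ℂ → 𝕆 × 𝕆) (f : 𝕆 → 𝕆) : Prop :=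
  ∃ D : Set ℂ, (∀ z ∈ D, conj z ∈ D) ∧ W = circularization D ∧ IsStemOn D F ∧
    ∀ z ∈ D, ∀ J ∈ imagUnits, f (slice J z) = (F z).1 + (F z).2 * J

/-- Slice preserving functions on `W`: induced by a stem function with real-valued components
(for which left and right induced functions agree). -/
def IsSlicePreserving (W : Set 𝕆) (f : 𝕆 → 𝕆) : Prop :=
  ∃ a b : ℂ → ℝ, IsLeftInduced W (fun z => (a z • (1 : 𝕆), b z • (1 : 𝕆))) f

/-- `h = f •ᴸ g` on `W`. -/
def IsLeftSliceProduct (W : Set 𝕆) (f g h : 𝕆 → 𝕆) : Prop :=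
  ∃ F G : ℂ → 𝕆 × 𝕆, IsLeftInduced W F f ∧ IsLeftInduced W G g ∧
    IsLeftInduced W (fun z => cmul (F z) (G z)) h

/-- `h = f •ᴿ g` on `W`. -/
def IsRightSliceProduct (W : Set 𝕆) (f g h : 𝕆 → 𝕆) : Prop :=
  ∃ F G : ℂ → 𝕆 × 𝕆, IsRightInduced W F f ∧ IsRightInduced W G g ∧
    IsRightInduced W (fun z => cmul (F z) (G z)) h

/-- Left slice regular functions: `(∂/∂x + L_J ∂/∂y) f = 0` on every slice. -/
def IsLeftSliceRegular (W : Set 𝕆) (f : 𝕆 → 𝕆) : Prop :=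
  IsSliceOpen W ∧ ∀ J ∈ imagUnits, ContDiffOn ℝ 1 (fun z => f (slice J z)) (slice J ⁻¹' W) ∧
    ∀ z ∈ slice J ⁻¹' W,
      fderiv ℝ (fun z => f (slice J z)) z 1 + J * fderiv ℝ (fun z => f (slice J z)) z Complex.I = 0

/-- Right slice regular functions: `(∂/∂x + R_J ∂/∂y) f = 0` on every slice. -/
def IsRightSliceRegular (W : Set 𝕆) (f : 𝕆 → 𝕆) : Prop :=
  IsSliceOpen W ∧ ∀ J ∈ imagUnits, ContDiffOn ℝ 1 (fun z => f (slice J z)) (slice J ⁻¹' W) ∧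
    ∀ z ∈ slice J ⁻¹' W,
      fderiv ℝ (fun z => f (slice J z)) z 1 + fderiv ℝ (fun z => f (slice J z)) z Complex.I * J = 0

/-- `f = ∑ f_(i) •ᴸ b_i` on `W` with all `f_(i)` slice preserving. -/
def IsLeftExpansion (W : Set 𝕆) (b : Fin 8 → 𝕆) (fc : Fin 8 → 𝕆 → 𝕆) (f : 𝕆 → 𝕆) : Prop :=
  (∀ i, IsSlicePreserving W (fc i)) ∧ ∃ h : Fin 8 → 𝕆 → 𝕆,
    (∀ i, IsLeftSliceProduct W (fc i) (fun _ => b i) (h i)) ∧ ∀ q ∈ W, f q = ∑ i, h i q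

/-- `f = ∑ b_i •ᴿ f_(i)` on `W` with all `f_(i)` slice preserving. -/
def IsRightExpansion (W : Set 𝕆) (b : Fin 8 → 𝕆) (fc : Fin 8 → 𝕆 → 𝕆) (f : 𝕆 → 𝕆) : Prop :=
  (∀ i, IsSlicePreserving W (fc i)) ∧ ∃ h : Fin 8 → 𝕆 → 𝕆,
    (∀ i, IsRightSliceProduct W (fun _ => b i) (fc i) (h i)) ∧ ∀ q ∈ W, f q = ∑ i, h i q

/-- The `ℂ_J`-slice of the bimodule of left slice regular functions on `W`: functions
`f₀ + J •ᴸ f₁` with `f₀`, `f₁` slice preserving and slice regular. -/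
def IsInLeftSlice (W : Set 𝕆) (J : 𝕆) (f : 𝕆 → 𝕆) : Prop :=
  ∃ f₀ f₁ h : 𝕆 → 𝕆, IsSlicePreserving W f₀ ∧ IsLeftSliceRegular W f₀ ∧
    IsSlicePreserving W f₁ ∧ IsLeftSliceRegular W f₁ ∧
    IsLeftSliceProduct W (fun _ => J) f₁ h ∧ ∀ q ∈ W, f q = f₀ q + h q

/-- The `ℂ_J`-slice of the bimodule of right slice regular functions on `W`: functions
`f₀ + J •ᴿ f₁` with `f₀`, `f₁` slice preserving and slice regular. -/
def IsInRightSlice (W : Set 𝕆) (J : 𝕆) (f : 𝕆 → 𝕆) : Prop :=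
  ∃ f₀ f₁ h : 𝕆 → 𝕆, IsSlicePreserving W f₀ ∧ IsRightSliceRegular W f₀ ∧
    IsSlicePreserving W f₁ ∧ IsRightSliceRegular W f₁ ∧
    IsRightSliceProduct W (fun _ => J) f₁ h ∧ ∀ q ∈ W, f q = f₀ q + h q

/-! ### Admissible domains and boundary integrals -/

/-- A positively oriented parametrization of the boundary of a plane domain `D` by finitely many
continuously differentiable Jordan curves. Two different curves may touch in finitely many points.
The orientation is expressed by the winding number of the whole cycle, which is `1` about the
points of `D` and `0` about the points off the closure of `D`. -/
structure OrientedBoundary (D : Set ℂ) where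
  n : ℕ
  γ : Fin n → ℝ → ℂ
  contDiffOn : ∀ k, ContDiffOn ℝ 1 (γ k) (Icc 0 1)
  closed : ∀ k, γ k 0 = γ k 1
  injOn : ∀ k, InjOn (γ k) (Ico 0 1)
  iUnion_image : ⋃ k, γ k '' Icc 0 1 = frontier D
  finite_inter : ∀ k l, k ≠ l → (γ k '' Icc 0 1 ∩ γ l '' Icc 0 1).Finite
  winding_mem : ∀ w ∈ D,
    ∑ k, ∫ t in (0 : ℝ)..1, deriv (γ k) t / (γ k t - w) = 2 * π * Complex.I
  winding_notMem : ∀ w ∉ closure D, ∑ k, ∫ t in (0 : ℝ)..1, deriv (γ k) t / (γ k t - w) = 0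

namespace OrientedBoundary

variable {D : Set ℂ} {E : Type*} [NormedAddCommGroup E] [NormedSpace ℝ E]

/-- The pull-back to `[0,1]` of `g(s, ds_J)` along the `k`-th curve, carried to `ℂ_J`, where
`ds_J = - ds J`, that is, `ds_J = -(s'(t) J) dt`. -/
def integrand (Γ : OrientedBoundary D) (J : 𝕆) (g : 𝕆 → 𝕆 → E) (k : Fin Γ.n) (t : ℝ) : E :=
  g (slice J (Γ.γ k t)) (-(slice J (deriv (Γ.γ k) t) * J))

/-- `∫_{∂D_J} g(s, ds_J)`. -/
def integral (Γ : OrientedBoundary D) (J : 𝕆) (g : 𝕆 → 𝕆 → E) : E :=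
  ∑ k, ∫ t in (0 : ℝ)..1, Γ.integrand J g k t

/-- All curve integrals in `Γ.integral J g` exist. -/
def Integrable (Γ : OrientedBoundary D) (J : 𝕆) (g : 𝕆 → 𝕆 → E) : Prop :=
  ∀ k, IntervalIntegrable (Γ.integrand J g k) MeasureTheory.volume 0 1

end OrientedBoundary

/-- Bounded axially symmetric s-domains whose slices are bounded by finitely many `C¹` Jordan
curves. -/
structure IsAdmissibleDomain (U : Set 𝕆) : Prop where
  axial : IsAxiallySymmetric U
  bounded : Bornology.IsBounded U
  isOpen : IsOpen U
  isConnected : IsConnected U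
  meets_real : ∃ r : ℝ, r • (1 : 𝕆) ∈ U
  slice_isOpen : ∀ J ∈ imagUnits, IsOpen (slice J ⁻¹' U)
  slice_isConnected : ∀ J ∈ imagUnits, IsConnected (slice J ⁻¹' U)
  slice_boundary : ∀ J ∈ imagUnits, Nonempty (OrientedBoundary (slice J ⁻¹' U))

section Calculus

variable {V : Type*} [NormedAddCommGroup V] [NormedSpace ℝ V] [NormedOctonionBimodule V]

/-- `T`-left-admissible domains. -/
def IsLeftAdmissible (T : V →L[ℝ] V) (U : Set 𝕆) : Prop :=
  IsAdmissibleDomain U ∧ pullbackSpectrum T ⊆ U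

/-- `T`-right-admissible domains. -/
def IsRightAdmissible (T : V →L[ℝ] V) (U : Set 𝕆) : Prop :=
  IsAdmissibleDomain U ∧ pushforwardSpectrum T ⊆ U

/-- `s, ds ↦ (R_s - T)^{⊚-} ⊙ (ds f(s))`. -/
def leftForm (T : V →L[ℝ] V) (f : 𝕆 → 𝕆) (s ds : 𝕆) : V →L[ℝ] V :=
  odotR (leftResolvent T s) (ds * f s)

/-- `s, ds ↦ (f(s) ds) ⊙ (R_s - T)^{-⊚}`. -/
def rightForm (T : V →L[ℝ] V) (f : 𝕆 → 𝕆) (s ds : 𝕆) : V →L[ℝ] V :=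
  odotL (f s * ds) (rightResolvent T s)

open Classical in
/-- The left calculus at `J` on slice preserving functions regular on `W`:
`(1/2π) ∫_{∂(U ∩ ℂ_J)} (R_s - T)^{⊚-} ⊙ (ds_J f(s))` for some `T`-left-admissible `U` whose closure
lies in `W`. -/
def leftCalculus₀ (T : V →L[ℝ] V) (W : Set 𝕆) (f : 𝕆 → 𝕆) (J : 𝕆) : V →L[ℝ] V :=
  if h : ∃ U : Set 𝕆, IsLeftAdmissible T U ∧ closure U ⊆ W ∧
      Nonempty (OrientedBoundary (slice J ⁻¹' U)) then
    (2 * π)⁻¹ • (Classical.choice h.choose_spec.2.2).integral J (leftForm T f)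
  else 0

open Classical in
/-- The right calculus at `J` on slice preserving functions regular on `W`:
`(1/2π) ∫_{∂(U ∩ ℂ_J)} (f(s) ds_J) ⊙ (R_s - T)^{-⊚}` for some `T`-right-admissible `U` whose closure
lies in `W`. -/
def rightCalculus₀ (T : V →L[ℝ] V) (W : Set 𝕆) (f : 𝕆 → 𝕆) (J : 𝕆) : V →L[ℝ] V :=
  if h : ∃ U : Set 𝕆, IsRightAdmissible T U ∧ closure U ⊆ W ∧
      Nonempty (OrientedBoundary (slice J ⁻¹' U)) then
    (2 * π)⁻¹ • (Classical.choice h.choose_spec.2.2).integral J (rightForm T f)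
  else 0

open Classical in
/-- The left slice regular functional calculus `f*(T)_J`, the right extension of
`leftCalculus₀`: if `f = ∑ f_(i) •ᴸ e_i` on `W`, then `f*(T)_J = ∑ f_(i)*(T)_J ⊙ e_i`. -/
def leftCalculus (T : V →L[ℝ] V) (W : Set 𝕆) (f : 𝕆 → 𝕆) (J : 𝕆) : V →L[ℝ] V :=
  if h : ∃ fc, IsLeftExpansion W e fc f then
    ∑ i, odotR (leftCalculus₀ T W (h.choose i) J) (e i)
  else 0

open Classical in
/-- The right slice regular functional calculus `f_*(T)_J`, the left extension of
`rightCalculus₀`: if `f = ∑ e_i •ᴿ f_(i)` on `W`, then `f_*(T)_J = ∑ e_i ⊙ f_(i)_*(T)_J`. -/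
def rightCalculus (T : V →L[ℝ] V) (W : Set 𝕆) (f : 𝕆 → 𝕆) (J : 𝕆) : V →L[ℝ] V :=
  if h : ∃ fc, IsRightExpansion W e fc f then
    ∑ i, odotL (e i) (rightCalculus₀ T W (h.choose i) J)
  else 0

end Calculus

end OctonionCalculus

end

open OctonionCalculus

universe u

namespace OctonionCalculus

/-! ### Octonion arithmetic -/

section Octonions

/-! Write `S = (R_s - T)⁻¹`. The algebraic key is that an operator `A` is right para-linear exactly
when `A(v p) = A(v) p` for all `v ∈ Re V`. Such an `A` is determined by its restriction to `Re V`,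
and equally by `Re ∘ A` (`IsParaLinear.ext_real`, `IsParaLinear.ext_reOp`). In these terms `(A ⊙
p)(v) = A(v) p` and `(p ⊙ A)(v) = p A(v)` for real `v`, and `Re (p ⊙ A)(x) = Re A(x p)`. The left
resolvent is the para-linear operator that agrees with `S` on `Re V`; the right resolvent is the one
whose real part is `Re ∘ S`. All this rests on `x = ∑ Re (x ē_i) e_i` and on `Re x` being a real
element. Both are derived from the bimodule axioms, as identities between left and right
multiplication operators organised by the Fano plane.

The calculus is defined through some admissible domain, so the analytic core is independence of the
domain. Right multiplication by `J` makes `V` a complex space, and a real functional `φ` is the real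
part of the complex-linear `Φ(x) = φ(x) - i φ(x J)`. For a slice preserving `g` given by `c` on
`ℂ_J`, the left integral applied to a real `v` and then to `φ` is `Re (-i ∮ Φ(S v) c dz)`.
Extendability makes `Φ(S v)` holomorphic, and Cauchy's theorem applies. On the right, `φ ∘ Re`
replaces `φ` and liftability replaces extendability.

Cauchy's theorem is proved directly for cycles given by winding numbers: the Cauchy–Pompeiu formula
turns a cycle integral of a compactly supported `C¹` function into the area integral of `∂̄g`
against the winding number (`OrientedBoundary.sum_integral_eq`). The resolvent must also belong to
the correct slice: a non-real point of `ℂ_J` off `U` lies in a resolvent set that can only be the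
one of `±J`, and a real point off `U` is a limit of non-real points off `U`, because a boundary of
Jordan curves cannot be a slit in the real axis (`OrientedBoundary.exists_im_ne_zero_notMem`).

The formulas then follow by algebra under the integral sign. The coefficients `f_(i)` are determined
by `f` on each slice and inherit holomorphy (`IsLeftExpansion.apply_slice`). Since `ds` and
`f_(i)(s)` lie in the same slice, `(ds f_(i)) b_i = ds (f_(i) b_i)`, and so the integrals of `(R ⊙
(ds f_(i))) ⊙ b_i` differ from that of `R ⊙ (ds f)` exactly by the associators. For `f` in the
`ℂ_J`-slice all factors lie in `ℂ_J` and the associators vanish. -/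

theorem mul_apply_zero (x y : 𝕆) : (x * y) 0 = x 0 * y 0 - x 1 * y 1 - x 2 * y 2 - x 3 * y 3
    - x 4 * y 4 - x 5 * y 5 - x 6 * y 6 - x 7 * y 7 := rfl

theorem mul_apply_one (x y : 𝕆) : (x * y) 1 = x 0 * y 1 + x 1 * y 0 + (x 2 * y 3 - x 3 * y 2)
    + (x 4 * y 5 - x 5 * y 4) + (x 7 * y 6 - x 6 * y 7) := rfl

theorem mul_apply_two (x y : 𝕆) : (x * y) 2 = x 0 * y 2 + x 2 * y 0 + (x 3 * y 1 - x 1 * y 3)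
    + (x 4 * y 6 - x 6 * y 4) + (x 5 * y 7 - x 7 * y 5) := rfl

theorem mul_apply_three (x y : 𝕆) : (x * y) 3 = x 0 * y 3 + x 3 * y 0 + (x 1 * y 2 - x 2 * y 1)
    + (x 4 * y 7 - x 7 * y 4) + (x 6 * y 5 - x 5 * y 6) := rfl

theorem mul_apply_four (x y : 𝕆) : (x * y) 4 = x 0 * y 4 + x 4 * y 0 + (x 5 * y 1 - x 1 * y 5)
    + (x 6 * y 2 - x 2 * y 6) + (x 7 * y 3 - x 3 * y 7) := rfl

theorem mul_apply_five (x y : 𝕆) : (x * y) 5 = x 0 * y 5 + x 5 * y 0 + (x 1 * y 4 - x 4 * y 1)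
    + (x 7 * y 2 - x 2 * y 7) + (x 3 * y 6 - x 6 * y 3) := rfl

theorem mul_apply_six (x y : 𝕆) : (x * y) 6 = x 0 * y 6 + x 6 * y 0 + (x 1 * y 7 - x 7 * y 1)
    + (x 2 * y 4 - x 4 * y 2) + (x 5 * y 3 - x 3 * y 5) := rfl

theorem mul_apply_seven (x y : 𝕆) : (x * y) 7 = x 0 * y 7 + x 7 * y 0 + (x 6 * y 1 - x 1 * y 6)
    + (x 2 * y 5 - x 5 * y 2) + (x 3 * y 4 - x 4 * y 3) := rfl

theorem e_apply (i j : Fin 8) : e i j = if j = i then 1 else 0 := by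
  simp [e]

theorem one_def : (1 : 𝕆) = e 0 := rfl

theorem oconj_apply (x : 𝕆) (i : Fin 8) : oconj x i = if i = 0 then x i else - x i := by
  fin_cases i <;> simp [oconj]

/-- Two octonions with the same eight coordinates agree. -/
theorem ext8 {x y : 𝕆} (h0 : x 0 = y 0) (h1 : x 1 = y 1) (h2 : x 2 = y 2) (h3 : x 3 = y 3)
    (h4 : x 4 = y 4) (h5 : x 5 = y 5) (h6 : x 6 = y 6) (h7 : x 7 = y 7) : x = y := by
  ext i
  fin_cases i
  exacts [h0, h1, h2, h3, h4, h5, h6, h7]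

theorem omul_add (x y z : 𝕆) : x * (y + z) = x * y + x * z := by
  apply ext8 <;> simp only [PiLp.add_apply, mul_apply_zero, mul_apply_one, mul_apply_two,
    mul_apply_three, mul_apply_four, mul_apply_five, mul_apply_six, mul_apply_seven] <;> ring

theorem oadd_mul (x y z : 𝕆) : (x + y) * z = x * z + y * z := by
  apply ext8 <;> simp only [PiLp.add_apply, mul_apply_zero, mul_apply_one, mul_apply_two,
    mul_apply_three, mul_apply_four, mul_apply_five, mul_apply_six, mul_apply_seven] <;> ring

theorem osmul_mul (a : ℝ) (x y : 𝕆) : (a • x) * y = a • (x * y) := by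
  apply ext8 <;> simp only [PiLp.smul_apply, smul_eq_mul, mul_apply_zero, mul_apply_one,
    mul_apply_two, mul_apply_three, mul_apply_four, mul_apply_five, mul_apply_six,
    mul_apply_seven] <;> ring

theorem omul_smul (a : ℝ) (x y : 𝕆) : x * (a • y) = a • (x * y) := by
  apply ext8 <;> simp only [PiLp.smul_apply, smul_eq_mul, mul_apply_zero, mul_apply_one,
    mul_apply_two, mul_apply_three, mul_apply_four, mul_apply_five, mul_apply_six,
    mul_apply_seven] <;> ring

/-- The octonion product as a bilinear map. -/
def omulL : 𝕆 →ₗ[ℝ] 𝕆 →ₗ[ℝ] 𝕆 := LinearMap.mk₂ ℝ (fun x y => x * y) oadd_mul osmul_mul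
  omul_add omul_smul

@[simp] theorem omulL_apply (x y : 𝕆) : omulL x y = x * y := rfl

theorem oone_mul (x : 𝕆) : 1 * x = x := by
  apply ext8 <;> simp [one_def, e_apply, mul_apply_zero, mul_apply_one, mul_apply_two,
    mul_apply_three, mul_apply_four, mul_apply_five, mul_apply_six, mul_apply_seven]

theorem omul_one (x : 𝕆) : x * 1 = x := by
  apply ext8 <;> simp [one_def, e_apply, mul_apply_zero, mul_apply_one, mul_apply_two,
    mul_apply_three, mul_apply_four, mul_apply_five, mul_apply_six, mul_apply_seven]

theorem mul_mul_self (x y : 𝕆) : (x * y) * y = x * (y * y) := by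
  apply ext8 <;> simp only [mul_apply_zero, mul_apply_one, mul_apply_two,
    mul_apply_three, mul_apply_four, mul_apply_five, mul_apply_six, mul_apply_seven] <;> ring

theorem self_mul_mul (x y : 𝕆) : x * (x * y) = (x * x) * y := by
  apply ext8 <;> simp only [mul_apply_zero, mul_apply_one, mul_apply_two,
    mul_apply_three, mul_apply_four, mul_apply_five, mul_apply_six, mul_apply_seven] <;> ring

theorem mul_comm_apply_zero (x y : 𝕆) : (x * y) 0 = (y * x) 0 := by
  simp only [mul_apply_zero]; ring

theorem mul_assoc_apply_zero (x y z : 𝕆) : ((x * y) * z) 0 = (x * (y * z)) 0 := by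
  simp only [mul_apply_zero, mul_apply_one, mul_apply_two, mul_apply_three, mul_apply_four,
    mul_apply_five, mul_apply_six, mul_apply_seven]; ring

theorem mul_oconj_apply_zero (x : 𝕆) (i : Fin 8) : (x * oconj (e i)) 0 = x i := by
  fin_cases i <;> simp only [mul_apply_zero, oconj_apply, e_apply] <;> simp

theorem oconj_e_zero : oconj (e 0) = 1 := by
  apply ext8 <;> simp [oconj_apply, one_def, e_apply]

theorem oconj_e_succ (i : Fin 7) : oconj (e i.succ) = -e i.succ := by
  ext j
  rw [oconj_apply, PiLp.neg_apply]
  split_ifs with h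
  · subst h; simp only [e_apply, (Fin.succ_ne_zero i).symm, if_false, neg_zero]
  · rfl

theorem sum_smul_e (x : 𝕆) : ∑ i, x i • e i = x := by
  simpa [e] using (EuclideanSpace.basisFun (Fin 8) ℝ).sum_repr x

/-- For `i ≥ 1` the real part of `e i * p` is `-p i` and the conjugate of `e i` is `-e i`, so the
signs cancel. -/
theorem sum_mul_apply_zero_smul (p : 𝕆) : ∑ i, (e i * p) 0 • oconj (e i) = p := by
  have h : ∀ i, (e i * p) 0 • oconj (e i) = p i • e i := by
    intro i
    refine Fin.cases ?_ (fun i => ?_) i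
    · rw [oconj_e_zero, one_def, ← one_def, oone_mul, one_def]
    · have : (e i.succ * p) 0 = - p i.succ := by
        fin_cases i <;> simp [mul_apply_zero, e_apply]
      rw [oconj_e_succ, this, neg_smul_neg]
  rw [Finset.sum_congr rfl fun i _ => h i, sum_smul_e]

/-- The real part formula on `𝕆` itself. -/
theorem real_part_formula (x : 𝕆) :
    (5 / 12 : ℝ) • x - (1 / 12 : ℝ) • ∑ i : Fin 7, (e i.succ * x) * e i.succ = x 0 • 1 := by
  -- The map `x ↦ e_i x e_i` negates `1` and `e_i` and fixes the other units. Summed over `i` this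
  -- gives `7 (x - 2 x₀) - 2 (x - x₀) = 5 x - 12 x₀`, the source of the constants `5/12` and `1/12`.
  have h : ∀ i : Fin 7, (e i.succ * x) * e i.succ = x i.succ • (-(2 : ℝ) • e i.succ) + (x - (2 * x 0) • 1) := by
    intro i
    fin_cases i <;> apply ext8 <;> simp only [mul_apply_zero, mul_apply_one, mul_apply_two,
      mul_apply_three, mul_apply_four, mul_apply_five, mul_apply_six, mul_apply_seven, e_apply,
      one_def, PiLp.add_apply, PiLp.sub_apply, PiLp.smul_apply, smul_eq_mul] <;>
      simp [Fin.ext_iff] <;> ring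
  have h' : ∑ i : Fin 7, x i.succ • e i.succ = x - x 0 • 1 := by
    have := sum_smul_e x
    rw [Fin.sum_univ_succ, ← one_def, add_comm] at this
    exact eq_sub_of_add_eq this
  have h'' : ∑ i : Fin 7, x i.succ • (-(2 : ℝ) • e i.succ) = (-(2 : ℝ)) • (x - x 0 • 1) := by
    rw [← h', Finset.smul_sum]
    exact Finset.sum_congr rfl fun i _ => smul_comm _ _ _
  rw [Finset.sum_congr rfl fun i _ => h i, Finset.sum_add_distrib, h'']
  simp only [Finset.sum_const, Finset.card_univ, Fintype.card_fin]
  module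

end Octonions

/-! ### The multiplication operators of a bimodule -/

/-- The multiplication table of an oriented line of the Fano plane. -/
structure IsLine (p q s : 𝕆) : Prop where
  pq : p * q = s
  qs : q * s = p
  sp : s * p = q
  qp : q * p = -s
  sq : s * q = -p
  ps : p * s = -q
  pp : p * p = -1
  qq : q * q = -1
  ss : s * s = -1

namespace IsLine

theorem rotate {p q s : 𝕆} (h : IsLine p q s) : IsLine q s p :=
  ⟨h.qs, h.sp, h.pq, h.sq, h.ps, h.qp, h.qq, h.ss, h.pp⟩

set_option maxHeartbeats 4000000 in
theorem of_e {i j k : Fin 8} (h : (i, j, k) ∈ ([(1, 2, 3), (1, 4, 5), (1, 7, 6), (2, 4, 6), (2, 5, 7),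
    (3, 4, 7), (3, 6, 5)] : List (Fin 8 × Fin 8 × Fin 8))) : IsLine (e i) (e j) (e k) := by
  simp only [List.mem_cons, List.not_mem_nil, or_false, Prod.mk.injEq] at h
  rcases h with ⟨rfl, rfl, rfl⟩ | ⟨rfl, rfl, rfl⟩ | ⟨rfl, rfl, rfl⟩ | ⟨rfl, rfl, rfl⟩ |
    ⟨rfl, rfl, rfl⟩ | ⟨rfl, rfl, rfl⟩ | ⟨rfl, rfl, rfl⟩ <;> constructor <;> apply ext8 <;>
    simp only [mul_apply_zero, mul_apply_one, mul_apply_two, mul_apply_three, mul_apply_four,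
      mul_apply_five, mul_apply_six, mul_apply_seven, e_apply, one_def, PiLp.neg_apply] <;>
    simp

end IsLine

/-- Six lines of the Fano plane: the three through `n`, and three that miss `n`. -/
structure IsConfiguration (n i m j l a c : 𝕆) : Prop where
  nim : IsLine n i m
  nla : IsLine n l a
  njc : IsLine n j c
  mjl : IsLine m j l
  ija : IsLine i j a
  lic : IsLine l i c

/-- The labels are chosen so that all six lines carry consistent orientations; an operator identity
proved once for abstract labels then serves for every `n`. The second part regroups a sum over the
seven units along the three lines through `n`. -/
theorem exists_configuration (n : Fin 7) : ∃ i m j l a c : Fin 7,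
    IsConfiguration (e n.succ) (e i.succ) (e m.succ) (e j.succ) (e l.succ) (e a.succ) (e c.succ) ∧
    ∀ {E : Type u} [AddCommMonoid E] (F : Fin 7 → E),
      ∑ k, F k = F n + (F i + F m) + (F l + F a) + (F j + F c) := by
  have h123 : IsLine (e 1) (e 2) (e 3) := .of_e (by simp)
  have h145 : IsLine (e 1) (e 4) (e 5) := .of_e (by simp)
  have h176 : IsLine (e 1) (e 7) (e 6) := .of_e (by simp)
  have h246 : IsLine (e 2) (e 4) (e 6) := .of_e (by simp)
  have h257 : IsLine (e 2) (e 5) (e 7) := .of_e (by simp)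
  have h347 : IsLine (e 3) (e 4) (e 7) := .of_e (by simp)
  have h365 : IsLine (e 3) (e 6) (e 5) := .of_e (by simp)
  fin_cases n
  · exact ⟨1, 2, 3, 6, 5, 4, ⟨h123, h176, h145,
      h347, h246, h257.rotate.rotate⟩, fun F => by rw [Fin.sum_univ_seven]; simp; abel⟩
  · exact ⟨2, 0, 3, 4, 6, 5, ⟨h123.rotate, h257, h246,
      h145, h347, h365.rotate.rotate⟩, fun F => by rw [Fin.sum_univ_seven]; simp; abel⟩
  · exact ⟨0, 1, 3, 5, 4, 6, ⟨h123.rotate.rotate, h365, h347,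
      h246, h145, h176.rotate.rotate⟩, fun F => by rw [Fin.sum_univ_seven]; simp; abel⟩
  · exact ⟨4, 0, 6, 5, 1, 2, ⟨h145.rotate, h246.rotate, h347.rotate,
      h176, h257.rotate, h365.rotate⟩, fun F => by rw [Fin.sum_univ_seven]; simp; abel⟩
  · exact ⟨0, 3, 6, 2, 5, 1, ⟨h145.rotate.rotate, h365.rotate.rotate, h257.rotate,
      h347.rotate, h176, h123.rotate.rotate⟩, fun F => by rw [Fin.sum_univ_seven]; simp; abel⟩
  · exact ⟨0, 6, 1, 4, 2, 3, ⟨h176.rotate.rotate, h365.rotate, h246.rotate.rotate,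
      h257.rotate.rotate, h123, h145.rotate.rotate⟩, fun F => by rw [Fin.sum_univ_seven]; simp; abel⟩
  · exact ⟨1, 4, 2, 5, 0, 3, ⟨h257.rotate.rotate, h176.rotate, h347.rotate.rotate,
      h365.rotate.rotate, h123.rotate, h246.rotate.rotate⟩, fun F => by rw [Fin.sum_univ_seven]; simp; abel⟩

section Operators

variable {V : Type*} [NormedAddCommGroup V] [NormedSpace ℝ V] [NormedOctonionBimodule V]

theorem lmul_apply (p : 𝕆) (x : V) : lmul p x = OctonionBimodule.lsmul p x := rfl

theorem rmul_apply (p : 𝕆) (x : V) : rmul p x = OctonionBimodule.rsmul p x := rfl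

theorem lmul_neg (p : 𝕆) : (lmul (-p) : V →L[ℝ] V) = -lmul p := by ext x; simp [lmul_apply]

theorem rmul_neg (p : 𝕆) : (rmul (-p) : V →L[ℝ] V) = -rmul p := by ext x; simp [rmul_apply]

theorem lmul_one : (lmul 1 : V →L[ℝ] V) = 1 := by
  ext x; exact OctonionBimodule.one_lsmul x

theorem rmul_one : (rmul 1 : V →L[ℝ] V) = 1 := by
  ext x; exact OctonionBimodule.one_rsmul x

/-- The axiom `[p, q, x] = [q, x, p]` read as a rule for moving left multiplications past right
ones. -/
theorem rmul_mul_lmul (p q : 𝕆) : (rmul p * lmul q : V →L[ℝ] V) =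
    lmul q * rmul p + lmul (p * q) - lmul p * lmul q := by
  ext x
  have := OctonionBimodule.assoc_left_mid p q x
  simp only [mul_apply_eq_comp, add_apply, 
    sub_apply, lmul_apply, rmul_apply]
  linear_combination (norm := module) -this

theorem rmul_mul_rmul (p q : 𝕆) : (rmul q * rmul p : V →L[ℝ] V) =
    rmul (p * q) + lmul (p * q) - lmul p * lmul q := by
  ext x
  have h1 := OctonionBimodule.assoc_left_mid p q x
  have h2 := OctonionBimodule.assoc_mid_right p q x
  simp only [mul_apply_eq_comp, add_apply, 
    sub_apply, lmul_apply, rmul_apply]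
  linear_combination (norm := module) -h1 - h2

theorem lmul_mul_lmul_add (p q : 𝕆) : (lmul p * lmul q + lmul q * lmul p : V →L[ℝ] V) =
    lmul (p * q) + lmul (q * p) := by
  ext x
  have h1 := OctonionBimodule.assoc_left_mid p q x
  have h2 := OctonionBimodule.assoc_mid_right p q x
  have h3 := OctonionBimodule.assoc_right_left p q x
  simp only [mul_apply_eq_comp, add_apply, lmul_apply]
  linear_combination (norm := module) -h1 - h2 - h3

theorem rmul_mul_rmul_add (p q : 𝕆) : (rmul p * rmul q + rmul q * rmul p : V →L[ℝ] V) =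
    rmul (p * q) + rmul (q * p) := by
  rw [rmul_mul_rmul, rmul_mul_rmul]
  linear_combination (norm := noncomm_ring) -lmul_mul_lmul_add (V := V) p q

theorem lmul_mul_self {p : 𝕆} (h : p * p = -1) : (lmul p * lmul p : V →L[ℝ] V) = -1 := by
  have := lmul_mul_lmul_add (V := V) p p
  rw [h, lmul_neg, lmul_one, ← two_smul ℝ, ← two_smul ℝ (-1 : V →L[ℝ] V)] at this
  exact smul_right_injective _ two_ne_zero this

theorem rmul_mul_self {p : 𝕆} (h : p * p = -1) : (rmul p * rmul p : V →L[ℝ] V) = -1 := by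
  have := rmul_mul_rmul (V := V) p p
  rw [h, lmul_neg, rmul_neg, lmul_one, rmul_one, lmul_mul_self h] at this
  rw [this]; abel

theorem rmul_mul_lmul_self {p : 𝕆} (h : p * p = -1) :
    (rmul p * lmul p : V →L[ℝ] V) = lmul p * rmul p := by
  have := rmul_mul_lmul (V := V) p p
  rw [h, lmul_neg, lmul_one, lmul_mul_self h] at this
  rw [this]; abel

namespace IsLine

variable {p q s : 𝕆} (h : IsLine p q s)
include h

theorem rmul_lmul : (rmul p * lmul q : V →L[ℝ] V) =
    lmul q * rmul p + lmul s - lmul p * lmul q := by rw [rmul_mul_lmul, h.pq]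

theorem rmul_lmul' : (rmul p * lmul s : V →L[ℝ] V) =
    lmul s * rmul p - lmul q - lmul p * lmul s := by rw [rmul_mul_lmul, h.ps, lmul_neg]; abel

theorem rmul_rmul : (rmul q * rmul p : V →L[ℝ] V) =
    rmul s + lmul s - lmul p * lmul q := by rw [rmul_mul_rmul, h.pq]

theorem rmul_rmul' : (rmul p * rmul q : V →L[ℝ] V) =
    -rmul s - lmul s - lmul q * lmul p := by
  rw [rmul_mul_rmul, h.qp, lmul_neg, rmul_neg]; abel

theorem lmul_comm : (lmul q * lmul p : V →L[ℝ] V) = -(lmul p * lmul q) := by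
  have := lmul_mul_lmul_add (V := V) p q
  rw [h.pq, h.qp, lmul_neg, add_neg_cancel] at this
  exact (neg_eq_of_add_eq_zero_right this).symm

theorem rmul_comm : (rmul q * rmul p : V →L[ℝ] V) = -(rmul p * rmul q) := by
  have := rmul_mul_rmul_add (V := V) p q
  rw [h.pq, h.qp, rmul_neg, add_neg_cancel] at this
  exact (neg_eq_of_add_eq_zero_right this).symm

theorem lmul_lmul_rmul : (lmul p * lmul q * rmul q : V →L[ℝ] V) =
    lmul s * rmul q + rmul s * rmul q - rmul p := by
  linear_combination (norm := noncomm_ring) h.rmul_rmul (V := V) * rmul q -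
    h.rmul_comm (V := V) * rmul q + rmul p * rmul_mul_self (V := V) h.qq

theorem lmul_lmul_rmul' : (lmul p * lmul s * rmul s : V →L[ℝ] V) =
    -(lmul q * rmul s) - rmul q * rmul s - rmul p := by
  linear_combination (norm := noncomm_ring) h.rotate.rotate.rmul_rmul' (V := V) * rmul s -
    h.rotate.rotate.rmul_comm (V := V) * rmul s + rmul p * rmul_mul_self (V := V) h.ss

/-- The contribution of one line through `p` to `(R_p - L_p) ∑ R_i L_i`. The product `L_q L_s` does
not reduce within a single line; it disappears only in the sum over the three lines, by
`IsConfiguration.two_rmul_add_lmul`. -/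
theorem commutator_sum :
    ((rmul p - lmul p) * ((rmul q * lmul q) + (rmul s * lmul s)) : V →L[ℝ] V) =
      -2 * (lmul p - lmul q * lmul s) := by
  have Cq := rmul_mul_lmul_self (V := V) h.qq
  have Cs := rmul_mul_lmul_self (V := V) h.ss
  have Lq := lmul_mul_self (V := V) h.qq
  have Ls := lmul_mul_self (V := V) h.ss
  have Tpq := h.lmul_lmul_rmul (V := V)
  have Tps := h.lmul_lmul_rmul' (V := V)
  have Npq := h.rmul_lmul (V := V)
  have Nps := h.rmul_lmul' (V := V)
  have Mqp := h.rmul_rmul' (V := V)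
  have Msp := h.rotate.rotate.rmul_rmul (V := V)
  have Asq := h.rotate.lmul_comm (V := V)
  have Mqs := h.rotate.rmul_rmul (V := V)
  have Msq := h.rotate.rmul_rmul' (V := V)
  generalize (lmul p : V →L[ℝ] V) = lp at *
  generalize (lmul q : V →L[ℝ] V) = lq at *
  generalize (lmul s : V →L[ℝ] V) = ls at *
  generalize (rmul p : V →L[ℝ] V) = rp at *
  generalize (rmul q : V →L[ℝ] V) = rq at *
  generalize (rmul s : V →L[ℝ] V) = rs at *
  linear_combination (norm := noncomm_ring) -(lp * Cq) - 2 * Tpq - lp * Cs - 2 * Tps + rp * Cq +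
    Npq * rq + lq * Mqp - Lq * lp + rp * Cs + Nps * rs + ls * Msp - Ls * lp - Asq + 2 * Msq - 2 * Mqs

/-- The contribution of one line through `p` to `R_p (∑ R_i L_i) R_p`, with the same irreducible
product `L_q L_s`. -/
theorem conjugate_sum :
    (rmul p * (rmul q * lmul q + rmul s * lmul s) * rmul p : V →L[ℝ] V) =
      rmul q * lmul q + rmul s * lmul s + 2 * (lmul q * lmul s * rmul p) -
        2 * (lmul p * rmul p) := by
  have Rp := rmul_mul_self (V := V) h.pp
  have Rs := rmul_mul_self (V := V) h.ss
  have Cp := rmul_mul_lmul_self (V := V) h.pp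
  have Cq := rmul_mul_lmul_self (V := V) h.qq
  have Cs := rmul_mul_lmul_self (V := V) h.ss
  have Tpq := h.lmul_lmul_rmul (V := V)
  have Tps := h.lmul_lmul_rmul' (V := V)
  have Npq := h.rmul_lmul (V := V)
  have Nps := h.rmul_lmul' (V := V)
  have Yqp := h.rmul_comm (V := V)
  have Ysq := h.rotate.rmul_comm (V := V)
  have Yps := h.rotate.rotate.rmul_comm (V := V)
  have Msq := h.rotate.rmul_rmul (V := V)
  generalize (lmul p : V →L[ℝ] V) = lp at *
  generalize (lmul q : V →L[ℝ] V) = lq at *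
  generalize (lmul s : V →L[ℝ] V) = ls at *
  generalize (rmul p : V →L[ℝ] V) = rp at *
  generalize (rmul q : V →L[ℝ] V) = rq at *
  generalize (rmul s : V →L[ℝ] V) = rs at *
  have Ysp : rs * rp = -(rp * rs) := by rw [Yps, neg_neg]
  have Wqs : lq * ls * rp = lp * rp - 1 - rs * rq * rp := by
    linear_combination (norm := noncomm_ring) Rp + Msq * rp
  linear_combination (norm := noncomm_ring) rp * Cq * rp + Npq * rq * rp - Tpq * rp +
    lq * rp * Yqp - lq * Rp * rq + rp * Cs * rp + Nps * rs * rp - Tps * rp + ls * rp * Ysp -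
    ls * Rp * rs - 2 * Wqs + rq * Ysp - Yqp * rs + rs * Yqp - Ysp * rq + rp * Ysq + 2 * Rp -
    Cq - Cs

end IsLine

/-- Take the commutator of `R_i` with `R_l R_j = R_m + L_m - L_j L_l`, which is the line `m j l`.
The left side commutes with `R_i`, since `R_i` anticommutes with both factors. On the right, `i m =
n` produces `R_n` and `L_n`, while `i j = a` and `i l = -c` turn `L_j L_l` into products over the
lines through `n`. -/
theorem IsConfiguration.two_rmul_add_lmul {n i m j l a c : 𝕆}
    (h : IsConfiguration n i m j l a c) :
    (lmul i * lmul m + lmul l * lmul a + lmul j * lmul c : V →L[ℝ] V) =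
      2 * rmul n + lmul n := by
  have H := h.mjl.rotate.rmul_rmul (V := V)
  have Nij := h.ija.rmul_lmul (V := V)
  have Nil := h.lic.rotate.rmul_lmul' (V := V)
  have Aji := h.ija.lmul_comm (V := V)
  have Yij := h.ija.rmul_comm (V := V)
  have Yil := h.lic.rmul_comm (V := V)
  have Aal := h.nla.rotate.lmul_comm (V := V)
  have Nim := h.nim.rotate.rmul_lmul (V := V)
  have Mim := h.nim.rotate.rmul_rmul' (V := V)
  have Ami := h.nim.rotate.lmul_comm (V := V)
  have Yim := h.nim.rotate.rmul_comm (V := V)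
  generalize (lmul n : V →L[ℝ] V) = ln at *
  generalize (rmul n : V →L[ℝ] V) = rn at *
  generalize (lmul i : V →L[ℝ] V) = li at *
  generalize (rmul i : V →L[ℝ] V) = ri at *
  generalize (lmul m : V →L[ℝ] V) = lm at *
  generalize (rmul m : V →L[ℝ] V) = rm at *
  generalize (lmul j : V →L[ℝ] V) = lj at *
  generalize (rmul j : V →L[ℝ] V) = rj at *
  generalize (lmul l : V →L[ℝ] V) = ll at *
  generalize (rmul l : V →L[ℝ] V) = rl at *
  generalize (lmul a : V →L[ℝ] V) = la at *
  generalize (rmul a : V →L[ℝ] V) = ra at *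
  generalize (lmul c : V →L[ℝ] V) = lc at *
  generalize (rmul c : V →L[ℝ] V) = rc at *
  linear_combination (norm := noncomm_ring) Nij * ll + lj * Nil - Aji * ll + Yil * rj - rl * Yij +
    Aal - Nim - 2 * Mim + 2 * Ami + Yim - ri * H + H * ri

/-- `∑ e_i (·) e_i` over the imaginary units. -/
theorem reOp_eq : (12 : ℝ) • (reOp V) = (5 : ℝ) • 1 - ∑ i : Fin 7, rmul (e i.succ) * lmul (e i.succ) := by
  rw [reOp, smul_sub, smul_smul, smul_smul]
  norm_num
  rfl

/-- The index `n` itself contributes `R_n - L_n`, and the three lines through `n` contribute `2 (2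
R_n + L_n) - 6 L_n = 4 (R_n - L_n)`. Hence `5 - ∑ R_i L_i = 12 Re` is annihilated by `R_n - L_n`. -/
theorem rmul_sub_lmul_mul_sum (n : Fin 7) :
    ((rmul (e n.succ) - lmul (e n.succ)) * ∑ i : Fin 7, rmul (e i.succ) * lmul (e i.succ) : V →L[ℝ] V) =
      5 * (rmul (e n.succ) - lmul (e n.succ)) := by
  obtain ⟨i, m, j, l, a, c, h, hs⟩ := exists_configuration n
  rw [hs]
  have h1 := h.nim.commutator_sum (V := V)
  have h2 := h.nla.commutator_sum (V := V)
  have h3 := h.njc.commutator_sum (V := V)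
  have h4 := h.two_rmul_add_lmul (V := V)
  have h5 := rmul_mul_self (V := V) h.nim.pp
  have h6 := lmul_mul_self (V := V) h.nim.pp
  have h7 := rmul_mul_lmul_self (V := V) h.nim.pp
  linear_combination (norm := noncomm_ring) h1 + h2 + h3 + 2 * h4 + h5 * lmul (e n.succ)
    + h7 * lmul (e n.succ) - rmul (e n.succ) * h6

theorem rmul_mul_sum_mul_rmul (n : Fin 7) :
    (rmul (e n.succ) * (∑ i : Fin 7, rmul (e i.succ) * lmul (e i.succ)) * rmul (e n.succ) :
      V →L[ℝ] V) =
      ∑ i : Fin 7, rmul (e i.succ) * lmul (e i.succ) - (4 : ℕ) • 1 -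
        6 * (rmul (e n.succ) * lmul (e n.succ)) := by
  obtain ⟨i, m, j, l, a, c, h, hs⟩ := exists_configuration n
  rw [hs]
  have h1 := h.nim.conjugate_sum (V := V)
  have h2 := h.nla.conjugate_sum (V := V)
  have h3 := h.njc.conjugate_sum (V := V)
  have h4 := h.two_rmul_add_lmul (V := V)
  have h5 := rmul_mul_self (V := V) h.nim.pp
  have h7 := rmul_mul_lmul_self (V := V) h.nim.pp
  generalize (lmul (e n.succ) : V →L[ℝ] V) = ln at *
  generalize (rmul (e n.succ) : V →L[ℝ] V) = rn at *
  linear_combination (norm := noncomm_ring) h1 + h2 + h3 + 2 * h4 * rn + rn * h7 * rn +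
    4 * h5 + rn * ln * h5 + 4 * h7

theorem lmul_reOp_e (n : Fin 7) (x : V) :
    lmul (e n.succ) (reOp V x) = rmul (e n.succ) (reOp V x) := by
  have h : (rmul (e n.succ) - lmul (e n.succ)) * ((12 : ℝ) • (reOp V)) = 0 := by
    rw [reOp_eq, mul_sub, rmul_sub_lmul_mul_sum, mul_smul_comm, mul_one, ofNat_smul_eq_nsmul]
    noncomm_ring
  rw [mul_smul_comm, smul_eq_zero_iff_right (by norm_num)] at h
  have := congrArg (fun A : V →L[ℝ] V => A x) h
  simp only [mul_apply_eq_comp, sub_apply, zero_apply, sub_eq_zero] at this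
  exact this.symm

/-- With `Σ = ∑ R_i L_i`, the terms with `i ≥ 1`, multiplied by `12`, are `1 + Σ - 6 R_i L_i` and
add up to `7 + Σ`; the term `i = 0` adds `5 - Σ`. -/
theorem sum_rmul_reOp_rmul :
    ∑ i : Fin 8, rmul (e i) * reOp V * rmul (oconj (e i)) = (1 : V →L[ℝ] V) := by
  have h : ∀ i : Fin 7, (12 : ℝ) • (rmul (e i.succ) * reOp V * rmul (oconj (e i.succ))) =
      1 + ∑ i : Fin 7, rmul (e i.succ) * lmul (e i.succ) - (6 : ℝ) • (rmul (e i.succ) * lmul (e i.succ)) := by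
    intro i
    obtain ⟨_, _, _, _, _, _, hc, -⟩ := exists_configuration.{0} i
    have h5 := rmul_mul_self (V := V) hc.nim.pp
    rw [oconj_e_succ, rmul_neg, mul_neg, smul_neg, ← smul_mul_assoc, ← mul_smul_comm, reOp_eq,
      mul_sub, sub_mul, rmul_mul_sum_mul_rmul, mul_smul_comm, smul_mul_assoc, mul_one, h5]
    simp only [ofNat_smul_eq_nsmul]
    noncomm_ring
  have h' : (12 : ℝ) • ∑ i : Fin 8, rmul (e i) * reOp V * rmul (oconj (e i)) =
      (12 : ℝ) • (1 : V →L[ℝ] V) := by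
    rw [Fin.sum_univ_succ, smul_add, oconj_e_zero, ← one_def, rmul_one, one_mul, mul_one,
      Finset.smul_sum, Finset.sum_congr rfl fun i _ => h i, reOp_eq, Finset.sum_sub_distrib,
      ← Finset.smul_sum]
    simp only [Finset.sum_const, Finset.card_univ, Fintype.card_fin]
    module
  exact smul_right_injective _ (by norm_num) h'

theorem sum_rmul_reOp (x : V) : ∑ i : Fin 8, rmul (e i) (reOp V (rmul (oconj (e i)) x)) = x := by
  have := congrArg (fun A : V →L[ℝ] V => A x) (sum_rmul_reOp_rmul (V := V))
  simpa [mul_apply_eq_comp, sum_apply] using this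

end Operators

/-! ### Real elements and para-linear operators -/

section ParaLinear

variable {V : Type*} [NormedAddCommGroup V] [NormedSpace ℝ V] [NormedOctonionBimodule V]

theorem lmul_add (p q : 𝕆) : (lmul (p + q) : V →L[ℝ] V) = lmul p + lmul q := by
  ext x; simp [lmul_apply]

theorem rmul_add (p q : 𝕆) : (rmul (p + q) : V →L[ℝ] V) = rmul p + rmul q := by
  ext x; simp [rmul_apply]

theorem lmul_smul (a : ℝ) (p : 𝕆) : (lmul (a • p) : V →L[ℝ] V) = a • lmul p := by
  ext x; simp [lmul_apply]

theorem rmul_smul (a : ℝ) (p : 𝕆) : (rmul (a • p) : V →L[ℝ] V) = a • rmul p := by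
  ext x; simp [rmul_apply]

variable (V) in
/-- Left multiplication as a linear map into the bounded operators. -/
noncomputable def lmulₗ : 𝕆 →ₗ[ℝ] V →L[ℝ] V := ⟨⟨lmul, lmul_add⟩, lmul_smul⟩

variable (V) in
/-- Right multiplication as a linear map into the bounded operators. -/
noncomputable def rmulₗ : 𝕆 →ₗ[ℝ] V →L[ℝ] V := ⟨⟨rmul, rmul_add⟩, rmul_smul⟩

theorem lmulₗ_apply (p : 𝕆) : lmulₗ V p = lmul p := rfl

theorem rmulₗ_apply (p : 𝕆) : rmulₗ V p = rmul p := rfl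

theorem continuous_lmul : Continuous (lmul : 𝕆 → V →L[ℝ] V) :=
  (lmulₗ V).continuous_of_finiteDimensional

theorem continuous_rmul : Continuous (rmul : 𝕆 → V →L[ℝ] V) :=
  (rmulₗ V).continuous_of_finiteDimensional

theorem sum_smul_lmul (p : 𝕆) : ∑ i, p i • (lmul (e i) : V →L[ℝ] V) = lmul p := by
  conv_rhs => rw [← sum_smul_e p, ← lmulₗ_apply, map_sum]
  simp only [map_smul, lmulₗ_apply]

theorem sum_smul_rmul (p : 𝕆) : ∑ i, p i • (rmul (e i) : V →L[ℝ] V) = rmul p := by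
  conv_rhs => rw [← sum_smul_e p, ← rmulₗ_apply, map_sum]
  simp only [map_smul, rmulₗ_apply]

theorem lmul_reOp (p : 𝕆) (x : V) : lmul p (reOp V x) = rmul p (reOp V x) := by
  have h : ∀ i : Fin 8, lmul (e i) (reOp V x) = rmul (e i) (reOp V x) := by
    refine Fin.cases ?_ fun n => lmul_reOp_e n x
    rw [← one_def, lmul_one, rmul_one]
  rw [← sum_smul_lmul, ← sum_smul_rmul]
  simp only [sum_apply, smul_apply, h]

/-- Commutation alone forces associativity: moving `v` across turns `[q, v, p] = (q v) p - q (v p)`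
into `(v q) p - q (p v) = [v, q, p] + [q, p, v]`. With `a = [p, q, v]` the symmetries of the
associator make this `a = -2 a`. -/
theorem mem_realElements_of_commutes {v : V} (h : ∀ p : 𝕆, lmul p v = rmul p v) :
    v ∈ realElements V := by
  refine ⟨fun p q => ?_, h⟩
  have a1 := OctonionBimodule.assoc_left_mid p q v
  have b1 := OctonionBimodule.assoc_mid_right p q v
  have c1 := OctonionBimodule.assoc_right_left p q v
  have a2 := OctonionBimodule.assoc_left_mid q p v
  have b2 := OctonionBimodule.assoc_mid_right q p v
  have hp := h p
  have hq := h q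
  have hqp := h (q * p)
  simp only [lmul_apply, rmul_apply] at hp hq hqp ⊢
  have hp' := congrArg (OctonionBimodule.lsmul q) hp
  have hq' := congrArg (OctonionBimodule.rsmul p) hq
  set a := OctonionBimodule.lsmul (p * q) v -
    OctonionBimodule.lsmul p (OctonionBimodule.lsmul q v) with ha
  have : (3 : ℝ) • a = 0 := by
    linear_combination (norm := module) a1 + (2 : ℝ) • (b1 + c1 + a1) + hq' + hp' - a2 - b2 - hqp
  simpa using this

theorem reOp_mem (x : V) : reOp V x ∈ realElements V :=
  mem_realElements_of_commutes fun p => lmul_reOp p x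

/-! ### Products of real elements with octonions -/

section Real

variable {v : V} (hv : v ∈ realElements V)
include hv

theorem lmul_real (p : 𝕆) : lmul p v = rmul p v := hv.2 p

theorem lmul_rmul_real (p q : 𝕆) : lmul p (rmul q v) = rmul (p * q) v := by
  rw [← hv.2, ← hv.2, ← sub_eq_zero, ← neg_eq_zero, neg_sub]
  exact hv.1 p q

theorem rmul_rmul_real (p q : 𝕆) : rmul q (rmul p v) = rmul (p * q) v := by
  have h1 := OctonionBimodule.assoc_left_mid p q v
  have h2 := OctonionBimodule.assoc_mid_right p q v
  have h3 := hv.1 p q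
  rw [← sub_eq_zero]
  simp only [lmul_apply, rmul_apply] at h3 ⊢
  rw [← h2, ← h1, h3]

theorem reOp_rmul_real (p : 𝕆) : reOp V (rmul p v) = p 0 • v := by
  have h : ∀ i : Fin 7, rmul (e i.succ) (lmul (e i.succ) (rmul p v)) =
      rmulₗ V ((e i.succ * p) * e i.succ) v := by
    intro i
    rw [lmul_rmul_real hv, rmul_rmul_real hv, rmulₗ_apply]
  calc reOp V (rmul p v) = rmulₗ V ((5 / 12 : ℝ) • p -
        (1 / 12 : ℝ) • ∑ i : Fin 7, (e i.succ * p) * e i.succ) v := by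
        simp only [reOp, sub_apply, smul_apply, sum_apply, ContinuousLinearMap.comp_apply, h,
          map_sub, map_smul, map_sum]
        rfl
    _ = p 0 • v := by
        rw [real_part_formula, map_smul, rmulₗ_apply, rmul_one]; rfl

end Real

/-- By the decomposition `x = ∑ Re (x ē_i) e_i`, the products `v p` with `v` real span `V`. -/
theorem clm_ext_real {F : Type*} [NormedAddCommGroup F] [NormedSpace ℝ F] {A B : V →L[ℝ] F}
    (h : ∀ v ∈ realElements V, ∀ p : 𝕆, A (rmul p v) = B (rmul p v)) : A = B := by
  ext x
  rw [← sum_rmul_reOp x, map_sum, map_sum]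
  exact Finset.sum_congr rfl fun i _ => h _ (reOp_mem _) _

/-- Together with `reOp_rmul_rmul` this says that `Re` behaves as an associative trace. Both reduce,
through `v q` with `v` real, to the trace property of the real part on `𝕆`. -/
theorem reOp_lmul (p : 𝕆) (x : V) : reOp V (lmul p x) = reOp V (rmul p x) := by
  have : (reOp V).comp (lmul p) = (reOp V).comp (rmul p) := clm_ext_real fun v hv q => by
    simp only [ContinuousLinearMap.comp_apply]
    rw [lmul_rmul_real hv, rmul_rmul_real hv, reOp_rmul_real hv, reOp_rmul_real hv,
      mul_comm_apply_zero]
  exact congrArg (fun A : V →L[ℝ] V => A x) this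

theorem reOp_rmul_rmul (p q : 𝕆) (x : V) :
    reOp V (rmul q (rmul p x)) = reOp V (rmul (p * q) x) := by
  have : (reOp V).comp ((rmul q).comp (rmul p)) = (reOp V).comp (rmul (p * q)) :=
    clm_ext_real fun v hv r => by
      simp only [ContinuousLinearMap.comp_apply]
      rw [rmul_rmul_real hv, rmul_rmul_real hv, rmul_rmul_real hv, reOp_rmul_real hv,
        reOp_rmul_real hv, mul_assoc_apply_zero]
  exact congrArg (fun A : V →L[ℝ] V => A x) this

/-- Nondegeneracy of the pairing `(w, q) ↦ Re (w q)`: the elements `Re (w ē_i)` are the coordinates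
of `w`. -/
theorem eq_zero_of_reOp_rmul {w : V} (h : ∀ q : 𝕆, reOp V (rmul q w) = 0) : w = 0 := by
  rw [← sum_rmul_reOp w]
  simp [h]

/-! ### Para-linearity as right linearity on real elements -/

namespace IsParaLinear

variable {A B : V →L[ℝ] V}

theorem reOp_map_rmul (hA : IsParaLinear A) (p : 𝕆) (x : V) :
    reOp V (A (rmul p x)) = reOp V (rmul p (A x)) := by
  have := hA p x
  rw [secondAssoc, sub_apply, map_sub, sub_eq_zero] at this
  exact this.symm

/-- Paired with any `q`, both sides give the same real part, because `Re (A(v p) q) = Re A(v (p q))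
= Re (A(v) (p q)) = Re ((A(v) p) q)`. -/
theorem map_rmul (hA : IsParaLinear A) {v : V} (hv : v ∈ realElements V) (p : 𝕆) :
    A (rmul p v) = rmul p (A v) := by
  rw [← sub_eq_zero]
  refine eq_zero_of_reOp_rmul fun q => ?_
  rw [map_sub, map_sub, reOp_rmul_rmul, ← hA.reOp_map_rmul, ← hA.reOp_map_rmul,
    rmul_rmul_real hv, sub_self]

theorem of_map_rmul (h : ∀ v ∈ realElements V, ∀ p : 𝕆, A (rmul p v) = rmul p (A v)) :
    IsParaLinear A := by
  intro p x
  have : (reOp V).comp (secondAssoc p A) = 0 := clm_ext_real fun v hv q => by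
    simp only [ContinuousLinearMap.comp_apply, secondAssoc, sub_apply, zero_apply]
    rw [h v hv, rmul_rmul_real hv, h v hv, map_sub, reOp_rmul_rmul, sub_self]
  exact congrArg (fun A : V →L[ℝ] V => A x) this

theorem ext_real (hA : IsParaLinear A) (hB : IsParaLinear B)
    (h : ∀ v ∈ realElements V, A v = B v) : A = B :=
  clm_ext_real fun v hv p => by rw [hA.map_rmul hv, hB.map_rmul hv, h v hv]

theorem ext_reOp (hA : IsParaLinear A) (hB : IsParaLinear B)
    (h : ∀ x, reOp V (A x) = reOp V (B x)) : A = B := by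
  ext x
  rw [← sub_eq_zero]
  refine eq_zero_of_reOp_rmul fun q => ?_
  rw [map_sub, map_sub, ← hA.reOp_map_rmul, ← hB.reOp_map_rmul, h, sub_self]

theorem add (hA : IsParaLinear A) (hB : IsParaLinear B) : IsParaLinear (A + B) :=
  of_map_rmul fun v hv p => by
    simp only [add_apply, map_add, hA.map_rmul hv, hB.map_rmul hv]

theorem zero : IsParaLinear (0 : V →L[ℝ] V) := of_map_rmul fun v _ p => by simp

theorem sum {ι : Type*} (s : Finset ι) {A : ι → V →L[ℝ] V} (h : ∀ i ∈ s, IsParaLinear (A i)) :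
    IsParaLinear (∑ i ∈ s, A i) :=
  Finset.sum_induction A IsParaLinear (fun _ _ => add) zero h

theorem smul (a : ℝ) (hA : IsParaLinear A) : IsParaLinear (a • A) :=
  of_map_rmul fun v hv p => by simp only [smul_apply, map_smul, hA.map_rmul hv]

end IsParaLinear

theorem extOp_rmul (f : V →L[ℝ] V) {v : V} (hv : v ∈ realElements V) (p : 𝕆) :
    extOp f (rmul p v) = rmul p (f v) := by
  simp only [extOp, sum_apply, ContinuousLinearMap.comp_apply]
  simp only [rmul_rmul_real hv, reOp_rmul_real hv, mul_oconj_apply_zero, map_smul]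
  rw [← sum_smul_rmul p]
  simp [sum_apply]

theorem extOp_real (f : V →L[ℝ] V) {v : V} (hv : v ∈ realElements V) : extOp f v = f v := by
  simpa [rmul_one] using extOp_rmul f hv 1

theorem isParaLinear_extOp (f : V →L[ℝ] V) : IsParaLinear (extOp f) :=
  .of_map_rmul fun v hv p => by rw [extOp_rmul f hv, extOp_real f hv]

theorem reOp_lifOp (f : V →L[ℝ] V) (x : V) : reOp V (lifOp f x) = reOp V (f x) := by
  simp only [lifOp, sum_apply, ContinuousLinearMap.comp_apply, map_sum]
  simp only [reOp_rmul_real (reOp_mem _)]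
  rw [Finset.sum_eq_single 0 (fun i _ hi => by simp [e_apply, hi.symm]) (by simp), oconj_e_zero,
    rmul_one]
  simp [e_apply]

/-- The real part of `lif(x) p` is `∑ Re (e_i p) Re f(x ē_i)`, and `∑ Re (e_i p) ē_i = p` collapses
this to `Re f(x p)`. -/
theorem isParaLinear_lifOp (f : V →L[ℝ] V) : IsParaLinear (lifOp f) := by
  intro p x
  rw [secondAssoc, sub_apply, map_sub, sub_eq_zero, ContinuousLinearMap.comp_apply,
    ContinuousLinearMap.comp_apply, reOp_lifOp]
  simp only [lifOp, sum_apply, ContinuousLinearMap.comp_apply, map_sum]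
  simp only [rmul_rmul_real (reOp_mem _), reOp_rmul_real (reOp_mem _)]
  conv_rhs => rw [← sum_mul_apply_zero_smul p, ← rmulₗ_apply, map_sum]
  simp [sum_apply, rmulₗ_apply]

namespace IsParaLinear

variable {A : V →L[ℝ] V} (hA : IsParaLinear A)
include hA

theorem odotR_real (p : 𝕆) {v : V} (hv : v ∈ realElements V) : odotR A p v = rmul p (A v) := by
  simp [odotR, secondAssoc, lmul_real hv, hA.map_rmul hv]

theorem odotL_real (p : 𝕆) {v : V} (hv : v ∈ realElements V) : odotL p A v = lmul p (A v) := by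
  simp [odotL, secondAssoc, hA.map_rmul hv]

/-- For real `v` one has `(A ⊙ p)(v q) = A(v)(p q) + A(v)(q p) - (A(v) q) p`, which the linearised
alternative law turns into `(A(v) p) q`. -/
theorem odotR (p : 𝕆) : IsParaLinear (odotR A p) := .of_map_rmul fun v hv q => by
  rw [hA.odotR_real p hv]
  simp only [OctonionCalculus.odotR, secondAssoc, sub_apply, ContinuousLinearMap.comp_apply,
    lmul_rmul_real hv, rmul_rmul_real hv, hA.map_rmul hv]
  have h := congrArg (fun B : V →L[ℝ] V => B (A v)) (rmul_mul_rmul_add (V := V) p q)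
  simp only [add_apply, mul_apply_eq_comp] at h
  linear_combination (norm := module) -h

theorem odotL (p : 𝕆) : IsParaLinear (odotL p A) := .of_map_rmul fun v hv q => by
  rw [hA.odotL_real p hv]
  simp only [OctonionCalculus.odotL, secondAssoc, add_apply, sub_apply,
    ContinuousLinearMap.comp_apply, rmul_rmul_real hv, hA.map_rmul hv]
  have h := OctonionBimodule.assoc_mid_right q p (A v)
  simp only [lmul_apply, rmul_apply]
  linear_combination (norm := module) -h

theorem reOp_odotL (p : 𝕆) (x : V) : reOp V (OctonionCalculus.odotL p A x) = reOp V (A (rmul p x)) := by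
  rw [OctonionCalculus.odotL, add_apply, map_add, hA p x, add_zero, ContinuousLinearMap.comp_apply,
    reOp_lmul, hA.reOp_map_rmul]

/-- Both sides are para-linear, so only the values on `Re V` matter, and there `⊙` is right
multiplication of `A(v)`. The operator associator thus vanishes as soon as right multiplication by
`p`, then `q`, is associative. -/
theorem odotR_odotR {p q : 𝕆} (h : ∀ y : V, rmul q (rmul p y) = rmul (p * q) y) :
    OctonionCalculus.odotR (OctonionCalculus.odotR A p) q = OctonionCalculus.odotR A (p * q) :=
  ((hA.odotR p).odotR q).ext_real (hA.odotR _) fun v hv => by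
    rw [(hA.odotR p).odotR_real q hv, hA.odotR_real p hv, hA.odotR_real _ hv, h]

theorem odotL_odotL {p q : 𝕆} (h : ∀ y : V, lmul p (lmul q y) = lmul (p * q) y) :
    OctonionCalculus.odotL p (OctonionCalculus.odotL q A) = OctonionCalculus.odotL (p * q) A :=
  ((hA.odotL q).odotL p).ext_real (hA.odotL _) fun v hv => by
    rw [(hA.odotL q).odotL_real p hv, hA.odotL_real q hv, hA.odotL_real _ hv, h]

end IsParaLinear

end ParaLinear

/-! ### The Cauchy–Pompeiu formula for curve integrals -/

section Pompeiu

open MeasureTheory Filter Topology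

/-- The Wirtinger derivative `∂f/∂z̄`. -/
noncomputable def dbar (f : ℂ → ℂ) (w : ℂ) : ℂ :=
  (1 / 2 : ℂ) * (fderiv ℝ f w 1 + Complex.I * fderiv ℝ f w Complex.I)

variable {g : ℂ → ℂ}

theorem continuous_dbar (hg : ContDiff ℝ 1 g) : Continuous (dbar g) := by
  have := hg.continuous_fderiv one_ne_zero
  unfold dbar
  fun_prop

theorem hasCompactSupport_dbar (hc : HasCompactSupport g) : HasCompactSupport (dbar g) := by
  refine (hc.fderiv (𝕜 := ℝ)).mono' fun w hw => subset_tsupport _ ?_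
  contrapose! hw
  simp only [Function.mem_support, not_not] at hw ⊢
  simp [dbar, hw]

theorem integral_dbar (hg : ContDiff ℝ 1 g) (hc : HasCompactSupport g) : ∫ w, dbar g w = 0 := by
  have h : ∀ v : ℂ, Integrable (fun w => fderiv ℝ g w v) ∧ ∫ w, fderiv ℝ g w v = 0 := by
    intro v
    have h1 : Integrable (fun w => fderiv ℝ g w v) := by
      refine Continuous.integrable_of_hasCompactSupport ?_ ?_
      · have := hg.continuous_fderiv one_ne_zero
        fun_prop
      · exact (hc.fderiv (𝕜 := ℝ)).comp_left (g := fun A : ℂ →L[ℝ] ℂ => A v) rfl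
    refine ⟨h1, ?_⟩
    -- Integration by parts against the constant function `1`.
    have := integral_mul_fderiv_eq_neg_fderiv_mul_of_integrable (μ := volume)
      (f := fun _ : ℂ => (1 : ℂ)) (g := g) (v := v) (by simp) (by simpa using h1)
      (by simpa using hg.continuous.integrable_of_hasCompactSupport hc)
      (fun _ _ => differentiableAt_const _) (fun _ _ => hg.differentiable one_ne_zero _)
    simpa using this
  unfold dbar
  rw [integral_const_mul, integral_add (h 1).1 ((h Complex.I).1.const_mul _), integral_const_mul,
    (h 1).2, (h Complex.I).2]
  simp

/-- In the rotated frame `u, i u` with `|u| = 1` the Wirtinger operator picks up the factor `ū =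
1/u`. -/
theorem wirtinger_rotate (A : ℂ →L[ℝ] ℂ) (θ : ℝ) :
    A (Complex.exp (θ * Complex.I)) + Complex.I * A (Complex.I * Complex.exp (θ * Complex.I)) =
      (A 1 + Complex.I * A Complex.I) / Complex.exp (θ * Complex.I) := by
  have h : ∀ z : ℂ, A z = z.re * A 1 + z.im * A Complex.I := by
    intro z
    conv_lhs => rw [show z = z.re • (1 : ℂ) + z.im • Complex.I by simp]
    rw [map_add, map_smul, map_smul]
    simp
  rw [h (Complex.exp _), h (Complex.I * _), eq_div_iff (Complex.exp_ne_zero _)]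
  have h1 : (Complex.exp (θ * Complex.I)) = Real.cos θ + Real.sin θ * Complex.I := by
    rw [Complex.exp_mul_I]; simp
  rw [h1]
  have h2 : ((Real.cos θ : ℝ) : ℂ) ^ 2 + ((Real.sin θ : ℝ) : ℂ) ^ 2 = 1 := by
    norm_cast; exact Real.cos_sq_add_sin_sq θ
  have h3 := Complex.I_sq
  simp only [Complex.add_re, Complex.ofReal_re, Complex.mul_re, Complex.I_re, mul_zero,
    Complex.ofReal_im, Complex.I_im, mul_one, sub_self, add_zero, Complex.add_im, Complex.mul_im,
    zero_mul, zero_add, one_mul, zero_sub]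
  push_cast at h2 ⊢
  linear_combination (A 1 + Complex.I * A Complex.I) * h2 +
    (Complex.cos θ * Complex.sin θ * A Complex.I - A 1 * Complex.sin θ ^ 2) * h3

/-- In polar coordinates about `ζ` the Jacobian `r` and the denominator `r u` reduce the integrand
to `½ (∂_r g + (i/r) ∂_θ g)`. The radial part integrates to `-g ζ` along every ray, and the angular
part vanishes by periodicity; `F₁` and `F₂` below are these two derivatives. -/
theorem integral_dbar_div (hg : ContDiff ℝ 1 g) (hc : HasCompactSupport g) (ζ : ℂ) :
    ∫ w, dbar g (ζ + w) / w = -π * g ζ := by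
  have hfd := hg.continuous_fderiv one_ne_zero
  have hdf := hg.differentiable one_ne_zero
  let u : ℝ → ℂ := fun θ => Complex.exp (θ * Complex.I)
  have hu : Continuous u := by fun_prop
  have hun : ∀ θ, ‖u θ‖ = 1 := fun θ => Complex.norm_exp_ofReal_mul_I θ
  let F₁ : ℝ × ℝ → ℂ := fun p => fderiv ℝ g (ζ + p.1 * u p.2) (u p.2)
  let F₂ : ℝ × ℝ → ℂ := fun p => fderiv ℝ g (ζ + p.1 * u p.2) (Complex.I * u p.2)
  have hF₁ : Continuous F₁ := by fun_prop
  have hF₂ : Continuous F₂ := by fun_prop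
  obtain ⟨R, hR⟩ : ∃ R : ℝ, ∀ w, R < ‖w‖ → fderiv ℝ g (ζ + w) = 0 := by
    obtain ⟨R, hR⟩ := (hc.fderiv (𝕜 := ℝ)).isCompact.isBounded.subset_closedBall ζ
    refine ⟨R, fun w hw => image_eq_zero_of_notMem_tsupport fun h => ?_⟩
    have := hR h
    simp at this
    linarith
  have hR' : ∀ p : ℝ × ℝ, 0 < p.1 → R < p.1 → fderiv ℝ g (ζ + p.1 * u p.2) = 0 := by
    intro p hp hRp
    refine hR _ ?_
    rw [norm_mul, hun, Complex.norm_real, mul_one]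
    exact hRp.trans_le (le_abs_self _)
  have hint : ∀ F : ℝ × ℝ → ℂ, Continuous F → (∀ p : ℝ × ℝ, 0 < p.1 → R < p.1 → F p = 0) →
      IntegrableOn F (Ioi 0 ×ˢ Ioo (-π) π) (volume.prod volume) := by
    intro F hF hF0
    have : IntegrableOn F (Icc 0 R ×ˢ Icc (-π) π) (volume.prod volume) :=
      hF.continuousOn.integrableOn_compact (isCompact_Icc.prod isCompact_Icc)
    refine this.of_forall_sdiff_eq_zero (measurableSet_Ioi.prod measurableSet_Ioo) ?_
    rintro ⟨r, θ⟩ ⟨⟨hr, hθ⟩, hn⟩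
    refine hF0 _ hr ?_
    by_contra hh
    exact hn ⟨⟨le_of_lt hr, not_lt.1 hh⟩, Ioo_subset_Icc_self hθ⟩
  have hi₁ := hint F₁ hF₁ fun p h h' => by simp [F₁, hR' p h h']
  have hi₂ := hint F₂ hF₂ fun p h h' => by simp [F₂, hR' p h h']
  have h₁ : ∫ p in Ioi 0 ×ˢ Ioo (-π) π, F₁ p ∂(volume.prod volume) = -(2 * π) * g ζ := by
    rw [← setIntegral_prod_swap, setIntegral_prod (fun p : ℝ × ℝ => F₁ p.swap) hi₁.swap]
    have : ∀ θ, ∫ r in Ioi 0, F₁ (r, θ) = - g ζ := by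
      intro θ
      have hd : ∀ r : ℝ, HasDerivAt (fun r : ℝ => g (ζ + r * u θ)) (F₁ (r, θ)) r := by
        intro r
        have h1 : HasDerivAt (fun r : ℝ => ζ + r * u θ) (u θ) r := by
          simpa using ((Complex.ofRealCLM.hasDerivAt (x := r)).mul_const (u θ)).const_add ζ
        exact (hdf _).hasFDerivAt.comp_hasDerivAt r h1
      rw [integral_Ioi_of_hasDerivAt_of_tendsto' (m := 0) (fun r _ => hd r)]
      · simp
      · have : IntegrableOn (fun r => F₁ (r, θ)) (Icc 0 R) :=
          (by fun_prop : Continuous fun r => F₁ (r, θ)).continuousOn.integrableOn_compact isCompact_Icc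
        refine this.of_forall_sdiff_eq_zero measurableSet_Ioi ?_
        rintro r ⟨hr, hn⟩
        have hr : 0 < r := hr
        have : R < r := by
          by_contra hh
          exact hn ⟨hr.le, not_lt.1 hh⟩
        simp [F₁, hR' (r, θ) hr this]
      · obtain ⟨S, hS⟩ := hc.isCompact.isBounded.subset_closedBall ζ
        refine tendsto_const_nhds.congr' ?_
        filter_upwards [eventually_gt_atTop S, eventually_gt_atTop 0] with r hr hr0
        refine (image_eq_zero_of_notMem_tsupport fun h => ?_).symm
        have := hS h
        rw [mem_closedBall_iff_norm, add_sub_cancel_left, norm_mul, hun, Complex.norm_real, mul_one,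
          Real.norm_eq_abs, abs_of_pos hr0] at this
        linarith
    simp only [Prod.swap_prod_mk, this]
    rw [setIntegral_const, Real.volume_real_Ioo_of_le (by linarith [Real.pi_pos]), Complex.real_smul]
    push_cast
    ring
  have h₂ : ∫ p in Ioi 0 ×ˢ Ioo (-π) π, F₂ p ∂(volume.prod volume) = 0 := by
    rw [setIntegral_prod _ hi₂]
    refine setIntegral_eq_zero_of_forall_eq_zero fun r hr => ?_
    have hd : ∀ θ : ℝ, HasDerivAt (fun θ : ℝ => g (ζ + r * u θ)) ((r : ℂ) * F₂ (r, θ)) θ := by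
      intro θ
      have h1 : HasDerivAt (fun θ : ℝ => ζ + r * u θ) (r • (Complex.I * u θ)) θ := by
        have h2 := ((Complex.ofRealCLM.hasDerivAt (x := θ)).mul_const Complex.I).cexp
        refine ((h2.const_mul (r : ℂ)).const_add ζ).congr_deriv ?_
        simp only [Complex.ofRealCLM_apply, u, Complex.real_smul, Complex.ofReal_one]
        ring
      refine ((hdf _).hasFDerivAt.comp_hasDerivAt θ h1).congr_deriv ?_
      rw [map_smul, Complex.real_smul]
    have := intervalIntegral.integral_eq_sub_of_hasDerivAt (a := -π) (b := π) (fun θ _ => hd θ)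
      (Continuous.intervalIntegrable (by fun_prop) _ _)
    have hπ : u (-π) = u π := by simp [u, Complex.exp_neg]
    rw [hπ, sub_self, intervalIntegral.integral_const_mul, mul_eq_zero,
      or_iff_right (by exact_mod_cast (ne_of_gt hr)), intervalIntegral.integral_of_le
        (by linarith [Real.pi_pos]), integral_Ioc_eq_integral_Ioo] at this
    exact this
  rw [← Complex.integral_comp_polarCoord_symm]
  have : ∀ p ∈ polarCoord.target, p.1 • (dbar g (ζ + Complex.polarCoord.symm p) / Complex.polarCoord.symm p)
      = (1 / 2 : ℂ) * (F₁ p + Complex.I * F₂ p) := by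
    rintro ⟨r, θ⟩ ⟨hr, -⟩
    have hr : 0 < r := hr
    have h1 : Complex.polarCoord.symm (r, θ) = r * u θ := by
      simp [u, Complex.exp_mul_I]
    have h2 := wirtinger_rotate (fderiv ℝ g (ζ + r * u θ)) θ
    simp only [F₁, F₂, h1, dbar]
    change _ = (1 / 2 : ℂ) * (fderiv ℝ g (ζ + r * u θ) (Complex.exp (θ * Complex.I)) + Complex.I * fderiv ℝ g (ζ + r * u θ) (Complex.I * Complex.exp (θ * Complex.I)))
    rw [h2]
    have h3 : u θ ≠ 0 := Complex.exp_ne_zero _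
    have h4 : (r : ℂ) ≠ 0 := by exact_mod_cast hr.ne'
    change _ = (1 / 2 : ℂ) * (_ / u θ)
    rw [Complex.real_smul]
    field_simp
  rw [setIntegral_congr_fun polarCoord.open_target.measurableSet this, integral_const_mul,
    polarCoord_target]
  have h₃ : ∫ p in Ioi 0 ×ˢ Ioo (-π) π, (F₁ p + Complex.I * F₂ p) ∂(volume.prod volume) =
      -(2 * π) * g ζ := by
    rw [integral_add hi₁ (hi₂.const_mul _), integral_const_mul, h₁, h₂]
    ring
  refine (congrArg ((1 / 2 : ℂ) * ·) h₃).trans ?_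
  ring

end Pompeiu

/-! ### Curve integrals as area integrals -/

section CurveIntegrals

open MeasureTheory Filter Topology

variable {g : ℂ → ℂ}

/-- The pole `1/|w|` is integrable in the plane because the polar Jacobian `r` cancels it. -/
theorem integrable_inv_norm_indicator (R : ℝ) :
    Integrable (fun w : ℂ => (Iio R).indicator (fun y : ℝ => y⁻¹) ‖w‖) := by
  rw [integrable_fun_norm_addHaar (f := (Iio R).indicator (fun y : ℝ => y⁻¹)) volume]
  have h1 : IntegrableOn (fun _ : ℝ => (1 : ℝ)) (Ioo 0 R) := by
    simp [integrableOn_const_iff]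
  have h2 : IntegrableOn ((Ioo 0 R).indicator (fun _ : ℝ => (1 : ℝ))) (Ioi 0) :=
    ((integrable_indicator_iff measurableSet_Ioo).2 h1).integrableOn
  refine h2.congr_fun (fun y hy => ?_) measurableSet_Ioi
  have hy : 0 < y := hy
  by_cases hR : y < R
  · simp [indicator, hy, hR, hy.ne']
  · simp [indicator, hR]

theorem integral_dbar_div_sub (hg : ContDiff ℝ 1 g) (hc : HasCompactSupport g) (ζ : ℂ) :
    ∫ w, dbar g w / (ζ - w) = π * g ζ := by
  have h := integral_add_left_eq_self (μ := volume) (fun w => dbar g w / (ζ - w)) ζ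
  rw [← h, ← neg_inj, ← integral_neg, ← neg_mul, ← integral_dbar_div hg hc ζ]
  refine integral_congr_ae (.of_forall fun w => ?_)
  simp only [sub_add_cancel_left, div_neg, neg_neg]

/-- Insert `π g(γ t) = ∫ ∂̄g(w) / (γ t - w) dw` under the curve integral and apply Fubini, the inner
pole being dominated by a translate of `1/|w|`. -/
theorem integral_comp_mul_eq {γ d : ℝ → ℂ} (hγ : Continuous γ)
    (hd : IntervalIntegrable d volume 0 1) (hg : ContDiff ℝ 1 g) (hc : HasCompactSupport g) :
    Integrable (fun w => dbar g w * ∫ t in (0 : ℝ)..1, d t / (γ t - w)) ∧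
    ∫ t in (0 : ℝ)..1, g (γ t) * d t =
      (π : ℂ)⁻¹ * ∫ w, dbar g w * ∫ t in (0 : ℝ)..1, d t / (γ t - w) := by
  have hcd := continuous_dbar hg
  have hdi : Integrable d (volume.restrict (Ioc 0 1)) := by
    rwa [intervalIntegrable_iff_integrableOn_Ioc_of_le zero_le_one] at hd
  obtain ⟨M, hM⟩ := hcd.bounded_above_of_compact_support (hasCompactSupport_dbar hc)
  obtain ⟨ρ, hρ⟩ := (hasCompactSupport_dbar hc).isCompact.isBounded.subset_closedBall 0
  obtain ⟨B, hB⟩ := (isCompact_Icc (a := (0 : ℝ)) (b := 1)).exists_bound_of_continuousOn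
    hγ.continuousOn
  -- The curve stays in the ball of radius `B` and the support of `∂̄g` in that of radius `ρ`, so
  -- the truncation at `B + ρ + 1` never affects a relevant difference `γ t - w`.
  let k : ℂ → ℝ := fun w => (Iio (B + ρ + 1)).indicator (fun y : ℝ => y⁻¹) ‖w‖
  have hk : Integrable k := integrable_inv_norm_indicator _
  have hk0 : ∀ w, 0 ≤ k w := fun w => indicator_apply_nonneg fun _ => inv_nonneg.2 (norm_nonneg w)
  let Φ : ℝ × ℂ → ℂ := fun p => dbar g p.2 * (d p.1 / (γ p.1 - p.2))
  have hbound : ∀ t ∈ Ioc (0 : ℝ) 1, ∀ w, ‖Φ (t, w)‖ ≤ (M * ‖d t‖) * k (γ t - w) := by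
    intro t ht w
    by_cases hw : w ∈ tsupport (dbar g)
    · have h1 := hρ hw
      rw [mem_closedBall_zero_iff] at h1
      have h2 : ‖γ t - w‖ < B + ρ + 1 := by
        have := norm_sub_le (γ t) w
        have := hB t (Ioc_subset_Icc_self ht)
        linarith
      have h3 : k (γ t - w) = ‖γ t - w‖⁻¹ := by simp only [k, indicator, mem_Iio, h2, if_true]
      rw [h3, norm_mul, norm_div, div_eq_mul_inv, ← mul_assoc]
      gcongr
      exact hM w
    · have : Φ (t, w) = 0 := by simp [Φ, image_eq_zero_of_notMem_tsupport hw]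
      rw [this, norm_zero]
      have := (norm_nonneg _).trans (hM 0)
      have := hk0 (γ t - w)
      positivity
  have hmeas : AEStronglyMeasurable Φ ((volume.restrict (Ioc 0 1)).prod volume) := by
    have h1 : AEStronglyMeasurable (fun p : ℝ × ℂ => d p.1)
        ((volume.restrict (Ioc 0 1)).prod volume) := hdi.aestronglyMeasurable.comp_fst
    have h2 : Measurable (fun p : ℝ × ℂ => (γ p.1 - p.2)⁻¹) := by
      have := hγ.measurable
      fun_prop
    have h3 : Measurable (fun p : ℝ × ℂ => dbar g p.2) := hcd.measurable.comp measurable_snd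
    simp only [Φ, div_eq_mul_inv]
    exact h3.aestronglyMeasurable.mul (h1.mul h2.aestronglyMeasurable)
  have hslice : ∀ t ∈ Ioc (0 : ℝ) 1, Integrable (fun w => Φ (t, w)) := by
    intro t ht
    refine ((hk.comp_sub_left (γ t)).const_mul (M * ‖d t‖)).mono' ?_ (.of_forall (hbound t ht))
    have : Measurable (fun w : ℂ => (γ t - w)⁻¹) := by fun_prop
    simp only [Φ, div_eq_mul_inv]
    exact (hcd.measurable.mul (this.const_mul (d t))).aestronglyMeasurable
  have hΦ : Integrable Φ ((volume.restrict (Ioc 0 1)).prod volume) := by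
    rw [integrable_prod_iff hmeas]
    refine ⟨(ae_restrict_iff' measurableSet_Ioc).2 (.of_forall hslice), ?_⟩
    refine ((hdi.norm.const_mul M).mul_const (∫ w, k w)).mono'
      hmeas.norm.integral_prod_right' ((ae_restrict_iff' measurableSet_Ioc).2 (.of_forall fun t ht => ?_))
    rw [Real.norm_of_nonneg (integral_nonneg fun w => norm_nonneg _),
      ← integral_sub_left_eq_self k volume (γ t), ← integral_const_mul]
    exact integral_mono (hslice t ht).norm ((hk.comp_sub_left (γ t)).const_mul _) (hbound t ht)
  have hinner : ∀ w, ∫ t in Ioc (0 : ℝ) 1, Φ (t, w) =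
      dbar g w * ∫ t in (0 : ℝ)..1, d t / (γ t - w) := fun w => by
    rw [intervalIntegral.integral_of_le zero_le_one, ← integral_const_mul]
  refine ⟨?_, ?_⟩
  · have := hΦ.integral_prod_right
    simpa only [hinner] using this
  · have h1 := integral_integral_swap (f := fun t w => Φ (t, w)) hΦ
    simp only [hinner] at h1
    rw [← h1, intervalIntegral.integral_of_le zero_le_one, ← integral_const_mul]
    refine setIntegral_congr_fun measurableSet_Ioc fun t _ => ?_
    have h2 : ∫ w, Φ (t, w) = d t * ∫ w, dbar g w / (γ t - w) := by
      rw [← integral_const_mul]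
      refine integral_congr_ae (.of_forall fun w => ?_)
      simp only [Φ]
      ring
    have h3 : (π : ℂ) ≠ 0 := by exact_mod_cast Real.pi_ne_zero
    simp only [h2, integral_dbar_div_sub hg hc]
    field_simp

theorem deriv_eqOn_Ioo (γ : ℝ → ℂ) : EqOn (deriv γ) (derivWithin γ (Icc 0 1)) (Ioo 0 1) := fun _ ht =>
  (derivWithin_of_mem_nhds (Icc_mem_nhds ht.1 ht.2)).symm

variable {γ : ℝ → ℂ} (hγ : ContDiffOn ℝ 1 γ (Icc 0 1))
include hγ

theorem continuousOn_derivWithin_Icc : ContinuousOn (derivWithin γ (Icc 0 1)) (Icc 0 1) :=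
  hγ.continuousOn_derivWithin (uniqueDiffOn_Icc zero_lt_one) le_rfl

/-- Functions of `γ` and `γ'` that are continuous along the curve are integrable. -/
theorem intervalIntegrable_curve {E : Type*} [NormedAddCommGroup E] [NormedSpace ℝ E]
    {F : ℂ × ℂ → E} (hF : ContinuousOn F ((γ '' Icc 0 1) ×ˢ univ)) :
    IntervalIntegrable (fun t => F (γ t, deriv γ t)) volume 0 1 := by
  have h1 : IntervalIntegrable (fun t => F (γ t, derivWithin γ (Icc 0 1) t)) volume 0 1 := by
    refine ContinuousOn.intervalIntegrable ?_
    rw [uIcc_of_le zero_le_one]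
    exact hF.comp (hγ.continuousOn.prodMk (continuousOn_derivWithin_Icc hγ))
      fun t ht => ⟨mem_image_of_mem _ ht, mem_univ _⟩
  rw [intervalIntegrable_iff_integrableOn_Ioo_of_le zero_le_one] at h1 ⊢
  exact h1.congr_fun (fun t ht => by simp only [deriv_eqOn_Ioo γ ht]) measurableSet_Ioo

theorem integral_curve_eq (hg : ContDiff ℝ 1 g) (hc : HasCompactSupport g) :
    Integrable (fun w => dbar g w * ∫ t in (0 : ℝ)..1, deriv γ t / (γ t - w)) ∧
    ∫ t in (0 : ℝ)..1, g (γ t) * deriv γ t =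
      (π : ℂ)⁻¹ * ∫ w, dbar g w * ∫ t in (0 : ℝ)..1, deriv γ t / (γ t - w) := by
  -- Nothing is known about `γ` off `[0, 1]`; extending it by its end values gives a globally
  -- continuous curve with the same integrals.
  have h := integral_comp_mul_eq (γ := IccExtend zero_le_one ((Icc 0 1).domRestrict γ))
    (continuous_IccExtend_iff.2 hγ.continuousOn.domRestrict)
    (intervalIntegrable_curve hγ (F := Prod.snd) continuous_snd.continuousOn) hg hc
  have h1 : ∀ t ∈ uIcc (0 : ℝ) 1, IccExtend zero_le_one ((Icc 0 1).domRestrict γ) t = γ t := by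
    intro t ht
    rw [uIcc_of_le zero_le_one] at ht
    rw [IccExtend_of_mem _ _ ht, domRestrict_apply]
  have h2 : ∀ w, ∫ t in (0 : ℝ)..1, deriv γ t / (IccExtend zero_le_one ((Icc 0 1).domRestrict γ) t - w)
      = ∫ t in (0 : ℝ)..1, deriv γ t / (γ t - w) := fun w =>
    intervalIntegral.integral_congr fun t ht => by simp only [h1 t ht]
  simp only [h2] at h
  rwa [intervalIntegral.integral_congr (g := fun t => g (γ t) * deriv γ t) fun t ht => by
    simp only [h1 t ht]] at h

end CurveIntegrals

/-! ### Cauchy's theorem for boundary cycles, and the shape of the boundary -/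

namespace OrientedBoundary

open MeasureTheory Filter Topology

variable {D D' : Set ℂ}

theorem sum_integral_eq (Γ : OrientedBoundary D) {g : ℂ → ℂ} (hg : ContDiff ℝ 1 g)
    (hc : HasCompactSupport g) :
    MeasureTheory.Integrable (fun w => dbar g w * ∑ k, ∫ t in (0 : ℝ)..1, deriv (Γ.γ k) t / (Γ.γ k t - w)) ∧
    ∑ k, ∫ t in (0 : ℝ)..1, g (Γ.γ k t) * deriv (Γ.γ k) t =
      (π : ℂ)⁻¹ * ∫ w, dbar g w *
        ∑ k, ∫ t in (0 : ℝ)..1, deriv (Γ.γ k) t / (Γ.γ k t - w) := by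
  have h := fun k => integral_curve_eq (Γ.contDiffOn k) hg hc
  simp only [Finset.mul_sum]
  refine ⟨integrable_finsetSum _ fun k _ => (h k).1, ?_⟩
  rw [integral_finsetSum _ fun k _ => (h k).1, Finset.mul_sum]
  exact Finset.sum_congr rfl fun k _ => (h k).2

theorem image_subset (Γ : OrientedBoundary D) (k : Fin Γ.n) : Γ.γ k '' Icc 0 1 ⊆ frontier D := by
  rw [← Γ.iUnion_image]
  exact subset_iUnion (fun k => Γ.γ k '' Icc 0 1) k

/-- Cauchy's theorem for the difference of two boundary cycles. -/
theorem sum_integral_congr (Γ : OrientedBoundary D) (Γ' : OrientedBoundary D') (hD : IsOpen D)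
    (hD' : IsOpen D') (hb : Bornology.IsBounded D) (hb' : Bornology.IsBounded D') {O : Set ℂ}
    (hO : IsOpen O) {f : ℂ → ℂ} (hf : ContDiffOn ℝ 1 f O)
    (hsub : (closure D ∪ closure D') \ (D ∩ D') ⊆ O)
    (hdbar : ∀ w ∈ (closure D ∪ closure D') \ (D ∩ D'), dbar f w = 0) :
    ∑ k, ∫ t in (0 : ℝ)..1, f (Γ.γ k t) * deriv (Γ.γ k) t =
      ∑ k, ∫ t in (0 : ℝ)..1, f (Γ'.γ k t) * deriv (Γ'.γ k) t := by
  -- Off `K` the two cycles have equal winding sums: both `2πi` on `D ∩ D'`, both `0` off the two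
  -- closures. On `K` the derivative `∂̄f` vanishes. Cutting `f` off to a compactly supported `g`
  -- that equals `f` near `K` makes the two area integrals agree, without any knowledge of winding
  -- numbers or measure on the boundaries.
  set K := (closure D ∪ closure D') \ (D ∩ D') with hK
  have hKc : IsCompact K :=
    (hb.isCompact_closure.union hb'.isCompact_closure).diff (hD.inter hD')
  obtain ⟨K', hK', hKK', hK'O⟩ := exists_compact_between hKc hO hsub
  obtain ⟨χ, hχ1, hχ0, -⟩ := exists_contMDiffMap_one_nhds_of_subset_interior (n := 1)
    (modelWithCornersSelf ℝ ℂ) hKc.isClosed hKK'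
  have hχ : ContDiff ℝ 1 χ := χ.contMDiff.contDiff
  have hχs : tsupport χ ⊆ K' := closure_minimal
    (fun x hx => by by_contra h; exact hx (hχ0 x h)) hK'.isClosed
  let g : ℂ → ℂ := fun w => χ w • f w
  have hg : ContDiff ℝ 1 g := by
    rw [contDiff_iff_contDiffAt]
    intro w
    by_cases hw : w ∈ tsupport χ
    · exact hχ.contDiffAt.smul (hf.contDiffAt (hO.mem_nhds (hK'O (hχs hw))))
    · refine (contDiffAt_const (c := (0 : ℂ))).congr_of_eventuallyEq ?_
      filter_upwards [(isClosed_tsupport χ).isOpen_compl.mem_nhds hw] with x hx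
      simp [g, image_eq_zero_of_notMem_tsupport hx]
  have hgc : HasCompactSupport g := by
    refine HasCompactSupport.intro hK' fun x hx => ?_
    simp [g, hχ0 x hx]
  have hgK : ∀ w ∈ K, g =ᶠ[𝓝 w] f := by
    intro w hw
    filter_upwards [eventually_nhdsSet_iff_forall.1 hχ1 w hw] with x hx
    simp [g, hx]
  have hfr : frontier D ⊆ K := fun w hw =>
    ⟨.inl hw.1, fun h => hw.2 (hD.interior_eq.symm ▸ h.1)⟩
  have hfr' : frontier D' ⊆ K := fun w hw =>
    ⟨.inr hw.1, fun h => hw.2 (hD'.interior_eq.symm ▸ h.2)⟩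
  have h1 : ∑ k, ∫ t in (0 : ℝ)..1, f (Γ.γ k t) * deriv (Γ.γ k) t =
      ∑ k, ∫ t in (0 : ℝ)..1, g (Γ.γ k t) * deriv (Γ.γ k) t := by
    refine Finset.sum_congr rfl fun k _ => intervalIntegral.integral_congr fun t ht => ?_
    rw [uIcc_of_le zero_le_one] at ht
    simp only [(hgK _ (hfr (Γ.image_subset k (mem_image_of_mem _ ht)))).eq_of_nhds]
  have h2 : ∑ k, ∫ t in (0 : ℝ)..1, f (Γ'.γ k t) * deriv (Γ'.γ k) t =
      ∑ k, ∫ t in (0 : ℝ)..1, g (Γ'.γ k t) * deriv (Γ'.γ k) t := by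
    refine Finset.sum_congr rfl fun k _ => intervalIntegral.integral_congr fun t ht => ?_
    rw [uIcc_of_le zero_le_one] at ht
    simp only [(hgK _ (hfr' (Γ'.image_subset k (mem_image_of_mem _ ht)))).eq_of_nhds]
  rw [h1, h2, (Γ.sum_integral_eq hg hgc).2, (Γ'.sum_integral_eq hg hgc).2]
  congr 2
  funext w
  by_cases hw : w ∈ K
  · have : dbar g w = 0 := by
      rw [← hdbar w hw, dbar, dbar, (hgK w hw).fderiv_eq]
    rw [this, zero_mul, zero_mul]
  · congr 1
    by_cases hwD : w ∈ D ∩ D'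
    · rw [Γ.winding_mem w hwD.1, Γ'.winding_mem w hwD.2]
    · have : w ∉ closure D ∪ closure D' := fun h => hw ⟨h, hwD⟩
      rw [Γ.winding_notMem w fun h => this (.inl h), Γ'.winding_notMem w fun h => this (.inr h)]

/-- Near a boundary point `z`, a plane domain does not contain all points off the real axis. -/
theorem exists_im_ne_zero_notMem (Γ : OrientedBoundary D) (hD : IsOpen D) {z : ℂ}
    (hz : z ∈ frontier D) {r : ℝ} (hr : 0 < r) : ∃ w ∈ Metric.ball z r, w.im ≠ 0 ∧ w ∉ D := by
  -- Otherwise the boundary inside the ball is real and `D` has full measure there. A bump function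
  -- in a small disc then has zero integral over the cycle, since its winding sum is `2πi` almost
  -- everywhere. But the cycle meets that disc in one injective real arc, along which the integral
  -- of the bump cannot vanish.
  by_contra! hcon
  have hreal : ∀ w ∈ Metric.ball z r, w ∈ frontier D → w.im = 0 := by
    intro w hw hwf
    by_contra h
    exact hwf.2 (hD.interior_eq.symm ▸ hcon w hw h)
  obtain ⟨k, t₀, ht₀, hzt⟩ : ∃ k, ∃ t ∈ Icc (0 : ℝ) 1, Γ.γ k t = z := by
    rw [← Γ.iUnion_image] at hz
    simpa using hz
  have hγc : ContinuousOn (Γ.γ k) (Icc 0 1) := (Γ.contDiffOn k).continuousOn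
  -- a parameter interval mapped into the ball
  obtain ⟨a₀, b₀, hab₀, ha₀, hb₀, hball⟩ : ∃ a₀ b₀ : ℝ, a₀ < b₀ ∧ 0 ≤ a₀ ∧ b₀ ≤ 1 ∧
      ∀ t ∈ Ioo a₀ b₀, Γ.γ k t ∈ Metric.ball z r := by
    obtain ⟨δ, hδ, hδ'⟩ := Metric.continuousOn_iff.1 hγc t₀ ht₀ r hr
    refine ⟨max 0 (t₀ - δ), min 1 (t₀ + δ), ?_, le_max_left _ _, min_le_left _ _, fun t ht => ?_⟩
    · rw [max_lt_iff, lt_min_iff, lt_min_iff]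
      refine ⟨⟨by norm_num, ?_⟩, ?_, ?_⟩ <;> linarith [ht₀.1, ht₀.2]
    · rw [mem_Ioo, max_lt_iff, lt_min_iff] at ht
      rw [← hzt]
      refine hδ' t ⟨ht.1.1.le, ht.2.1.le⟩ ?_
      rw [Real.dist_eq, abs_lt]
      constructor <;> linarith [ht.1.2, ht.2.2]
  have hsub : Ioo a₀ b₀ ⊆ Ioo 0 1 := Ioo_subset_Ioo ha₀ hb₀
  have hsubI : Ioo (0 : ℝ) 1 ⊆ Ico 0 1 := Ioo_subset_Ico_self
  -- a point of the curve that lies on no other curve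
  obtain ⟨t₁, ht₁, hne⟩ : ∃ t₁ ∈ Ioo a₀ b₀, ∀ l ≠ k, Γ.γ k t₁ ∉ Γ.γ l '' Icc 0 1 := by
    have hfin : (⋃ l ∈ {l | l ≠ k}, Γ.γ k '' Icc 0 1 ∩ Γ.γ l '' Icc 0 1).Finite :=
      (toFinite _).biUnion fun l hl => Γ.finite_inter k l (Ne.symm hl)
    by_contra! h
    refine infinite_of_injOn_mapsTo ((Γ.injOn k).mono (hsub.trans hsubI)) (fun t ht => ?_)
      (Ioo_infinite hab₀) hfin
    obtain ⟨l, hl, hl'⟩ := h t ht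
    exact mem_biUnion hl ⟨mem_image_of_mem _ (Ioo_subset_Icc_self (hsub ht)), hl'⟩
  obtain ⟨a, ha₀a, hat⟩ := exists_between ht₁.1
  obtain ⟨b, htb, hbb₀⟩ := exists_between ht₁.2
  have hab : a < b := hat.trans htb
  have hIcc : Icc a b ⊆ Ioo a₀ b₀ := Icc_subset_Ioo ha₀a hbb₀
  have ha0 : 0 < a := (hsub (hIcc (left_mem_Icc.2 hab.le))).1
  have hb1 : b < 1 := (hsub (hIcc (right_mem_Icc.2 hab.le))).2
  -- a disc around that point which meets the cycle only in a short arc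
  obtain ⟨ε, hε, hεball⟩ : ∃ ε > 0, ∀ w ∈ Metric.ball (Γ.γ k t₁) ε, w ∈ Metric.ball z r ∧
      (∀ l ≠ k, w ∉ Γ.γ l '' Icc 0 1) ∧ w ∉ Γ.γ k '' (Icc 0 a ∪ Icc b 1) := by
    have hc1 : IsClosed (⋃ l ∈ {l | l ≠ k}, Γ.γ l '' Icc 0 1) :=
      (toFinite _).isClosed_biUnion fun l _ =>
        (isCompact_Icc.image_of_continuousOn (Γ.contDiffOn l).continuousOn).isClosed
    have hc2 : IsClosed (Γ.γ k '' (Icc 0 a ∪ Icc b 1)) :=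
      ((isCompact_Icc.union isCompact_Icc).image_of_continuousOn (hγc.mono (union_subset
        (Icc_subset_Icc_right (hab.trans hb1).le) (Icc_subset_Icc_left (ha0.trans hab).le)))).isClosed
    have hmem : Γ.γ k t₁ ∈ Metric.ball z r ∩ ((⋃ l ∈ {l | l ≠ k}, Γ.γ l '' Icc 0 1)ᶜ ∩
        (Γ.γ k '' (Icc 0 a ∪ Icc b 1))ᶜ) := by
      refine ⟨hball _ ht₁, ?_, ?_⟩
      · simpa using hne
      · rintro ⟨t, ht, heq⟩
        have ht1 := hsub ht₁
        rcases ht with ht | ht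
        · have := Γ.injOn k ⟨ht.1, ht.2.trans_lt (hab.trans hb1)⟩ (hsubI ht1) heq
          linarith [ht.2]
        · rcases ht.2.lt_or_eq with h1 | rfl
          · have := Γ.injOn k ⟨(ha0.trans hab).le.trans ht.1, h1⟩ (hsubI ht1) heq
            linarith [ht.1]
          -- Injectivity is only given on `[0, 1)`, so the parameter `1` is replaced by `0`.
          · rw [← Γ.closed k] at heq
            have := Γ.injOn k ⟨le_rfl, zero_lt_one⟩ (hsubI ht1) heq
            linarith [ht1.1]
    obtain ⟨ε, hε, hs⟩ := Metric.isOpen_iff.1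
      (Metric.isOpen_ball.inter (hc1.isOpen_compl.inter hc2.isOpen_compl)) _ hmem
    refine ⟨ε, hε, fun w hw => ⟨(hs hw).1, ?_, (hs hw).2.2⟩⟩
    simpa using (hs hw).2.1
  let χ : ContDiffBump (Γ.γ k t₁) := ⟨ε / 4, ε / 2, by positivity, by linarith⟩
  let g : ℂ → ℂ := fun w => (χ w : ℂ)
  have hg : ContDiff ℝ 1 g := Complex.ofRealCLM.contDiff.comp χ.contDiff
  have hgc : HasCompactSupport g := χ.hasCompactSupport.comp_left (g := Complex.ofReal) rfl
  have hg0 : ∀ w ∉ Metric.ball (Γ.γ k t₁) ε, g w = 0 := by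
    intro w hw
    have : χ w = 0 := χ.zero_of_le_dist (by
      rw [Metric.mem_ball, not_lt] at hw
      change ε / 2 ≤ _
      linarith)
    simp [g, this]
  have hgts : tsupport g ⊆ Metric.ball (Γ.γ k t₁) ε := by
    have h1 : tsupport g ⊆ tsupport χ := by
      refine closure_mono fun w hw => ?_
      simpa [g] using hw
    refine h1.trans ?_
    rw [χ.tsupport_eq]
    exact Metric.closedBall_subset_ball (by change ε / 2 < ε; linarith)
  have hdb0 : ∀ w ∉ Metric.ball (Γ.γ k t₁) ε, dbar g w = 0 := by
    intro w hw
    have : fderiv ℝ g w = 0 := by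
      by_contra h
      exact hw (hgts (support_fderiv_subset ℝ h))
    simp [dbar, this]
  -- The real line is null, so the cycle integral is `2i ∫ ∂̄g`, which vanishes by compact support.
  have hzero : ∑ k, ∫ t in (0 : ℝ)..1, g (Γ.γ k t) * deriv (Γ.γ k) t = 0 := by
    rw [(Γ.sum_integral_eq hg hgc).2]
    have hae : ∀ᵐ w : ℂ, w.im ≠ 0 := by
      have := Measure.addHaar_submodule volume (LinearMap.ker Complex.imLm) (by
        rw [Ne, LinearMap.ker_eq_top]
        intro h
        simpa using congrArg (fun A : ℂ →ₗ[ℝ] ℝ => A Complex.I) h)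
      rw [ae_iff]
      convert this using 2
      ext w
      simp
    rw [integral_congr_ae (g := fun w => dbar g w * (2 * π * Complex.I)), integral_mul_const,
      integral_dbar hg hgc, zero_mul, mul_zero]
    filter_upwards [hae] with w hw
    by_cases hwb : w ∈ Metric.ball (Γ.γ k t₁) ε
    · rw [Γ.winding_mem w (hcon w (hεball w hwb).1 hw)]
    · rw [hdb0 w hwb, zero_mul, zero_mul]
  have hint : ∀ c d : ℝ, 0 ≤ c → c ≤ d → d ≤ 1 →
      IntervalIntegrable (fun t => g (Γ.γ k t) * deriv (Γ.γ k) t) volume c d := by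
    intro c d hc hcd hd
    have := intervalIntegrable_curve (Γ.contDiffOn k) (F := fun p => g p.1 * p.2)
      (by have := hg.continuous; fun_prop)
    refine this.mono_set ?_
    rw [uIcc_of_le hcd, uIcc_of_le zero_le_one]
    exact Icc_subset_Icc hc hd
  have hout : ∀ c d : ℝ, c ≤ d → Icc c d ⊆ Icc 0 a ∪ Icc b 1 →
      ∫ t in c..d, g (Γ.γ k t) * deriv (Γ.γ k) t = 0 := by
    intro c d hcd hs
    refine (intervalIntegral.integral_congr (g := fun _ => 0) fun t ht => ?_).trans (by simp)
    rw [uIcc_of_le hcd] at ht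
    have : g (Γ.γ k t) = 0 := hg0 _ fun h => (hεball _ h).2.2 (mem_image_of_mem _ (hs ht))
    simp only [this, zero_mul]
  have harc : ∫ t in a..b, g (Γ.γ k t) * deriv (Γ.γ k) t = 0 := by
    rw [Finset.sum_eq_single k] at hzero
    · rw [← intervalIntegral.integral_add_adjacent_intervals
        (hint 0 b le_rfl (ha0.trans hab).le hb1.le) (hint b 1 (ha0.trans hab).le hb1.le le_rfl),
        ← intervalIntegral.integral_add_adjacent_intervals
        (hint 0 a le_rfl ha0.le (hab.trans hb1).le) (hint a b ha0.le hab.le hb1.le),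
        hout 0 a ha0.le subset_union_left, hout b 1 hb1.le subset_union_right, zero_add,
        add_zero] at hzero
      exact hzero
    · intro l _ hl
      refine (intervalIntegral.integral_congr (g := fun _ => 0) fun t ht => ?_).trans (by simp)
      rw [uIcc_of_le zero_le_one] at ht
      have : g (Γ.γ l t) = 0 := hg0 _ fun h => (hεball _ h).2.1 l hl (mem_image_of_mem _ ht)
      simp only [this, zero_mul]
    · simp
  -- on the arc the curve is real
  let ρ : ℝ → ℝ := fun t => (Γ.γ k t).re
  have hρ : ∀ t ∈ Icc a b, Γ.γ k t = ρ t := by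
    intro t ht
    refine Complex.ext rfl ?_
    rw [Complex.ofReal_im]
    exact hreal _ (hball t (hIcc ht)) (Γ.image_subset k (mem_image_of_mem _
      (Ioo_subset_Icc_self (hsub (hIcc ht)))))
  have hIcc1 : Icc a b ⊆ Icc 0 1 := Icc_subset_Icc ha0.le hb1.le
  have hρc : ContinuousOn ρ (Icc a b) := Complex.continuous_re.comp_continuousOn (hγc.mono hIcc1)
  have hρi : InjOn ρ (Icc a b) := by
    intro s hs t ht hst
    refine Γ.injOn k (hsubI (hsub (hIcc hs))) (hsubI (hsub (hIcc ht))) ?_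
    rw [hρ s hs, hρ t ht, hst]
  -- Substitution along the real arc. Continuity and injectivity make `ρ` strictly monotone, so `ρ
  -- t₁` lies strictly between the limits, where the bump is positive.
  have hsubst : ∫ x in ρ a..ρ b, χ (x : ℂ) = 0 := by
    rw [← intervalIntegral.integral_comp_mul_deriv'' (f' := fun t => (deriv (Γ.γ k) t).re)]
    · have := congrArg Complex.reCLM harc
      rw [← Complex.reCLM.intervalIntegral_comp_comm (hint a b ha0.le hab.le hb1.le)] at this
      rw [map_zero] at this
      rw [← this]
      refine intervalIntegral.integral_congr fun t ht => ?_
      rw [uIcc_of_le hab.le] at ht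
      simp only [Function.comp_apply, Complex.reCLM_apply, g, Complex.re_ofReal_mul, ← hρ t ht]
    · rwa [uIcc_of_le hab.le]
    · intro t ht
      rw [min_eq_left hab.le, max_eq_right hab.le] at ht
      have ht1 : t ∈ Ioo (0 : ℝ) 1 := hsub (hIcc (Ioo_subset_Icc_self ht))
      have hd : HasDerivAt (Γ.γ k) (deriv (Γ.γ k) t) t :=
        (((Γ.contDiffOn k).differentiableOn one_ne_zero).differentiableAt
          (Icc_mem_nhds ht1.1 ht1.2)).hasDerivAt
      exact (Complex.reCLM.hasFDerivAt.comp_hasDerivAt t hd).hasDerivWithinAt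
    · rw [uIcc_of_le hab.le]
      refine Complex.continuous_re.comp_continuousOn ?_
      refine ((continuousOn_derivWithin_Icc (Γ.contDiffOn k)).mono hIcc1).congr ?_
      exact (deriv_eqOn_Ioo _).mono (hIcc.trans hsub)
    · exact (χ.continuous.comp Complex.continuous_ofReal).continuousOn
  have hpos : ∀ x y : ℝ, x < ρ t₁ → ρ t₁ < y → 0 < ∫ x in x..y, χ (x : ℂ) := by
    intro x y hx hy
    refine intervalIntegral.integral_pos (hx.trans hy)
      (χ.continuous.comp Complex.continuous_ofReal).continuousOn (fun _ _ => χ.nonneg)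
      ⟨ρ t₁, ⟨hx.le, hy.le⟩, ?_⟩
    rw [← hρ t₁ ⟨hat.le, htb.le⟩, χ.one_of_mem_closedBall (Metric.mem_closedBall_self χ.rIn_pos.le)]
    exact zero_lt_one
  have ha' := left_mem_Icc.2 hab.le
  have hb' := right_mem_Icc.2 hab.le
  have ht' : t₁ ∈ Icc a b := ⟨hat.le, htb.le⟩
  rcases hρc.strictMonoOn_of_injOn_Icc' hab.le hρi with hm | hm
  · exact (hpos _ _ (hm ha' ht' hat) (hm ht' hb' htb)).ne' hsubst
  · rw [intervalIntegral.integral_symm, neg_eq_zero] at hsubst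
    exact (hpos _ _ (hm ht' hb' htb) (hm ha' ht' hat)).ne' hsubst

end OrientedBoundary

/-! ### Slices -/

section Slices

variable {J K : 𝕆}

theorem oneg_mul (x y : 𝕆) : (-x) * y = -(x * y) := by
  simpa using osmul_mul (-1) x y

theorem omul_neg (x y : 𝕆) : x * (-y) = -(x * y) := by
  simpa using omul_smul (-1) x y

theorem osum_mul {ι : Type*} (s : Finset ι) (f : ι → 𝕆) (y : 𝕆) :
    (∑ i ∈ s, f i) * y = ∑ i ∈ s, f i * y :=
  map_sum (omulL.flip y) f s

theorem omul_sum {ι : Type*} (s : Finset ι) (f : ι → 𝕆) (x : 𝕆) :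
    x * (∑ i ∈ s, f i) = ∑ i ∈ s, x * f i :=
  map_sum (omulL x) f s

theorem continuous_omul : Continuous fun p : 𝕆 × 𝕆 => p.1 * p.2 := by
  have h : Continuous fun p : 𝕆 × 𝕆 =>
      (LinearMap.toContinuousLinearMap (LinearMap.toContinuousLinearMap.toLinearMap ∘ₗ omulL)) p.1 p.2 := by
    fun_prop
  exact h

theorem neg_mem_imagUnits (hJ : J ∈ imagUnits) : -J ∈ imagUnits := by
  have : J * J = -1 := hJ
  change -J * -J = -1
  rw [oneg_mul, omul_neg, neg_neg, this]

/-- For `i ≥ 1` the `i`-th coordinate of `J * J` is `2 J₀ J_i`. If `J₀ ≠ 0`, then `J` is real and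
its square cannot be `-1`. -/
theorem imagUnits_apply_zero (hJ : J ∈ imagUnits) : J 0 = 0 := by
  have h : J * J = -1 := hJ
  have h' := fun i => congrArg (fun x : 𝕆 => x i) h
  have h0 := h' 0
  have h1 := h' 1
  have h2 := h' 2
  have h3 := h' 3
  have h4 := h' 4
  have h5 := h' 5
  have h6 := h' 6
  have h7 := h' 7
  simp only [mul_apply_zero, mul_apply_one, mul_apply_two, mul_apply_three, mul_apply_four,
    mul_apply_five, mul_apply_six, mul_apply_seven, PiLp.neg_apply, one_def, e_apply, if_true]
    at h0 h1 h2 h3 h4 h5 h6 h7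
  by_contra hne
  have z : ∀ y : ℝ, J 0 * y + y * J 0 = 0 → y = 0 := by
    intro y hy
    have : J 0 * (2 * y) = 0 := by linarith
    have := (mul_eq_zero.1 this).resolve_left hne
    linarith
  have z1 := z (J 1) (by simp at h1; linarith)
  have z2 := z (J 2) (by simp at h2; linarith)
  have z3 := z (J 3) (by simp at h3; linarith)
  have z4 := z (J 4) (by simp at h4; linarith)
  have z5 := z (J 5) (by simp at h5; linarith)
  have z6 := z (J 6) (by simp at h6; linarith)
  have z7 := z (J 7) (by simp at h7; linarith)
  rw [z1, z2, z3, z4, z5, z6, z7] at h0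
  nlinarith [sq_nonneg (J 0)]

theorem norm_imagUnits (hJ : J ∈ imagUnits) : ‖J‖ = 1 := by
  have h : J * J = -1 := hJ
  have h0 := congrArg (fun x : 𝕆 => x 0) h
  simp only [mul_apply_zero, PiLp.neg_apply, one_def, e_apply, if_true,
    imagUnits_apply_zero hJ] at h0
  rw [EuclideanSpace.norm_eq, Real.sqrt_eq_one]
  simp only [Fin.sum_univ_eight, Real.norm_eq_abs, sq_abs, imagUnits_apply_zero hJ]
  linarith

/-- `slice J` as a real-linear map. -/
noncomputable def sliceₗ (J : 𝕆) : ℂ →ₗ[ℝ] 𝕆 where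
  toFun := slice J
  map_add' z w := by simp only [slice, Complex.add_re, Complex.add_im]; module
  map_smul' a z := by simp only [slice, Complex.smul_re, Complex.smul_im, RingHom.id_apply]; module

theorem sliceₗ_apply (J : 𝕆) (z : ℂ) : sliceₗ J z = slice J z := rfl

theorem continuous_slice (J : 𝕆) : Continuous (slice J) :=
  (sliceₗ J).continuous_of_finiteDimensional

theorem slice_I (J : 𝕆) : slice J Complex.I = J := by simp [slice]

theorem slice_mul (hJ : J ∈ imagUnits) (z w : ℂ) :
    slice J z * slice J w = slice J (z * w) := by
  have h : J * J = -1 := hJ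
  simp only [slice, oadd_mul, omul_add, osmul_mul, omul_smul, oone_mul, omul_one, h,
    Complex.mul_re, Complex.mul_im]
  module

theorem slice_mul_self (hJ : J ∈ imagUnits) (z : ℂ) :
    slice J z * J = slice J (z * Complex.I) := by
  conv_lhs => rw [← slice_I J, slice_I J]
  rw [← slice_mul hJ, slice_I]

theorem slice_neg (J : 𝕆) (z : ℂ) : slice (-J) z = slice J (conj z) := by simp [slice]

theorem slice_apply_zero (hJ : J ∈ imagUnits) (z : ℂ) : slice J z 0 = z.re := by
  simp [slice, one_def, e_apply, imagUnits_apply_zero hJ]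

theorem slice_eq_slice (hJ : J ∈ imagUnits) (hK : K ∈ imagUnits) {z w : ℂ}
    (h : slice J z = slice K w) : z = w ∨ z = conj w := by
  have h0 : z.re = w.re := by rw [← slice_apply_zero hJ, h, slice_apply_zero hK]
  have h1 : z.im • J = w.im • K := by
    simp only [slice, h0] at h
    exact add_left_cancel h
  have h2 := congrArg norm h1
  rw [norm_smul, norm_smul, norm_imagUnits hJ, norm_imagUnits hK, mul_one, mul_one,
    Real.norm_eq_abs, Real.norm_eq_abs, abs_eq_abs] at h2
  rcases h2 with h2 | h2
  · exact .inl (Complex.ext h0 h2)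
  · exact .inr (Complex.ext (by simpa using h0) (by simpa using h2))

theorem norm_slice (hJ : J ∈ imagUnits) (z : ℂ) : ‖slice J z‖ = ‖z‖ := by
  have h := imagUnits_apply_zero hJ
  have h1 := norm_imagUnits hJ
  rw [EuclideanSpace.norm_eq, Real.sqrt_eq_one] at h1
  rw [EuclideanSpace.norm_eq, Complex.norm_def, Complex.normSq_apply]
  congr 1
  have h2 : ∀ i : Fin 7, slice J z i.succ = z.im * J i.succ := by
    intro i
    simp [slice, one_def, e_apply]
  rw [Fin.sum_univ_succ] at h1 ⊢
  rw [slice_apply_zero hJ]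
  simp only [h2, h, norm_zero, Real.norm_eq_abs, sq_abs, mul_pow, ← Finset.mul_sum] at h1 ⊢
  have h3 : ∑ i : Fin 7, J i.succ ^ 2 = 1 := by linarith
  rw [h3]
  ring

theorem slice_mem_circularization {D : Set ℂ} (hD : ∀ z ∈ D, conj z ∈ D) (hJ : J ∈ imagUnits)
    {z : ℂ} : slice J z ∈ circularization D ↔ z ∈ D := by
  refine ⟨?_, fun hz => ⟨z, hz, J, hJ, rfl⟩⟩
  rintro ⟨w, hw, K, hK, h⟩
  rcases slice_eq_slice hJ hK h with rfl | rfl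
  exacts [hw, hD w hw]

variable {W : Set 𝕆}

theorem IsAxiallySymmetric.slice_mem_iff (hW : IsAxiallySymmetric W) (hJ : J ∈ imagUnits)
    (hK : K ∈ imagUnits) {z : ℂ} : slice J z ∈ W ↔ slice K z ∈ W := by
  obtain ⟨D, hD, rfl⟩ := hW
  rw [slice_mem_circularization hD hJ, slice_mem_circularization hD hK]

theorem IsAxiallySymmetric.exists_slice (hW : IsAxiallySymmetric W) {q : 𝕆} (hq : q ∈ W) :
    ∃ J ∈ imagUnits, ∃ z, q = slice J z := by
  obtain ⟨D, hD, rfl⟩ := hW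
  obtain ⟨z, -, J, hJ, h⟩ := hq
  exact ⟨J, hJ, z, h⟩

end Slices

/-! ### Slice functions and their expansions -/

section SliceFunctions

variable {J : 𝕆} {W : Set 𝕆} {F G : ℂ → 𝕆 × 𝕆} {f g h : 𝕆 → 𝕆}

theorem IsLeftInduced.apply (hf : IsLeftInduced W F f) (hJ : J ∈ imagUnits) {z : ℂ}
    (hz : slice J z ∈ W) : f (slice J z) = (F z).1 + J * (F z).2 := by
  obtain ⟨D, hD, rfl, -, h⟩ := hf
  exact h z ((slice_mem_circularization hD hJ).1 hz) J hJ

theorem IsRightInduced.apply (hf : IsRightInduced W F f) (hJ : J ∈ imagUnits) {z : ℂ}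
    (hz : slice J z ∈ W) : f (slice J z) = (F z).1 + (F z).2 * J := by
  obtain ⟨D, hD, rfl, -, h⟩ := hf
  exact h z ((slice_mem_circularization hD hJ).1 hz) J hJ

theorem IsLeftInduced.isAxiallySymmetric (hf : IsLeftInduced W F f) : IsAxiallySymmetric W := by
  obtain ⟨D, hD, h, -⟩ := hf
  exact ⟨D, hD, h⟩

theorem imag_mul_imag_mul (hJ : J ∈ imagUnits) (x : 𝕆) : J * (J * x) = -x := by
  have : J * J = -1 := hJ
  rw [self_mul_mul, this, oneg_mul, oone_mul]

theorem mul_imag_mul_imag (hJ : J ∈ imagUnits) (x : 𝕆) : (x * J) * J = -x := by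
  have : J * J = -1 := hJ
  rw [mul_mul_self, this, omul_neg, omul_one]

/-- The values at `J` and `-J` determine the pair by half sum and half difference. This yields
uniqueness of the stem function. -/
theorem eq_and_eq_of_add_mul {x y x' y' : 𝕆} (hJ : J ∈ imagUnits)
    (h : x + J * y = x' + J * y') (h' : x + -J * y = x' + -J * y') : x = x' ∧ y = y' := by
  rw [oneg_mul, oneg_mul] at h'
  have h1 : (2 : ℝ) • x = (2 : ℝ) • x' := by linear_combination (norm := module) h + h'
  have h2 : (2 : ℝ) • (J * y) = (2 : ℝ) • (J * y') := by linear_combination (norm := module) h - h'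
  have h3 := smul_right_injective _ (two_ne_zero (α := ℝ)) h2
  refine ⟨smul_right_injective _ (two_ne_zero (α := ℝ)) h1, ?_⟩
  have := congrArg (fun x => J * x) h3
  simpa only [imag_mul_imag_mul hJ, neg_inj] using this

theorem eq_and_eq_of_add_mul' {x y x' y' : 𝕆} (hJ : J ∈ imagUnits)
    (h : x + y * J = x' + y' * J) (h' : x + y * -J = x' + y' * -J) : x = x' ∧ y = y' := by
  rw [omul_neg, omul_neg] at h'
  have h1 : (2 : ℝ) • x = (2 : ℝ) • x' := by linear_combination (norm := module) h + h'
  have h2 : (2 : ℝ) • (y * J) = (2 : ℝ) • (y' * J) := by linear_combination (norm := module) h - h'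
  have h3 := smul_right_injective _ (two_ne_zero (α := ℝ)) h2
  refine ⟨smul_right_injective _ (two_ne_zero (α := ℝ)) h1, ?_⟩
  have := congrArg (fun x => x * J) h3
  simpa only [mul_imag_mul_imag hJ, neg_inj] using this

theorem IsLeftInduced.stem_eq (hF : IsLeftInduced W F f) (hG : IsLeftInduced W G f)
    (hJ : J ∈ imagUnits) {z : ℂ} (hz : slice J z ∈ W) : F z = G z := by
  have hJ' := neg_mem_imagUnits hJ
  have hz' := (hF.isAxiallySymmetric.slice_mem_iff hJ hJ').1 hz
  have h := eq_and_eq_of_add_mul hJ ((hF.apply hJ hz).symm.trans (hG.apply hJ hz))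
    ((hF.apply hJ' hz').symm.trans (hG.apply hJ' hz'))
  exact Prod.ext h.1 h.2

theorem IsRightInduced.isAxiallySymmetric (hf : IsRightInduced W F f) : IsAxiallySymmetric W := by
  obtain ⟨D, hD, h, -⟩ := hf
  exact ⟨D, hD, h⟩

theorem IsRightInduced.stem_eq (hF : IsRightInduced W F f) (hG : IsRightInduced W G f)
    (hJ : J ∈ imagUnits) {z : ℂ} (hz : slice J z ∈ W) : F z = G z := by
  have hJ' := neg_mem_imagUnits hJ
  have hz' := (hF.isAxiallySymmetric.slice_mem_iff hJ hJ').1 hz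
  have h := eq_and_eq_of_add_mul' hJ ((hF.apply hJ hz).symm.trans (hG.apply hJ hz))
    ((hF.apply hJ' hz').symm.trans (hG.apply hJ' hz'))
  exact Prod.ext h.1 h.2

theorem isLeftInduced_const (hW : IsAxiallySymmetric W) (b : 𝕆) :
    IsLeftInduced W (fun _ => (b, 0)) fun _ => b := by
  obtain ⟨D, hD, h⟩ := hW
  refine ⟨D, hD, h, fun z _ => by simp, fun z _ J _ => ?_⟩
  have : J * (0 : 𝕆) = 0 := by simpa using omul_smul 0 J 0
  simp [this]

theorem isRightInduced_const (hW : IsAxiallySymmetric W) (b : 𝕆) :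
    IsRightInduced W (fun _ => (b, 0)) fun _ => b := by
  obtain ⟨D, hD, h⟩ := hW
  refine ⟨D, hD, h, fun z _ => by simp, fun z _ J _ => ?_⟩
  have : (0 : 𝕆) * J = 0 := by simpa using osmul_mul 0 0 J
  simp [this]

theorem IsSlicePreserving.isRightInduced {a b : ℂ → ℝ}
    (h : IsLeftInduced W (fun z => (a z • (1 : 𝕆), b z • (1 : 𝕆))) f) :
    IsRightInduced W (fun z => (a z • (1 : 𝕆), b z • (1 : 𝕆))) f := by
  obtain ⟨D, hD, hW, hs, h⟩ := h
  refine ⟨D, hD, hW, hs, fun z hz J hJ => ?_⟩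
  rw [h z hz J hJ, omul_smul, osmul_mul, oone_mul, omul_one]

/-- Slice preserving functions map each slice into itself. -/
theorem IsSlicePreserving.exists_complex (hf : IsSlicePreserving W f) : ∃ c : ℂ → ℂ,
    ∀ J ∈ imagUnits, ∀ z, slice J z ∈ W → f (slice J z) = slice J (c z) := by
  obtain ⟨a, b, h⟩ := hf
  refine ⟨fun z => ⟨a z, b z⟩, fun J hJ z hz => ?_⟩
  rw [h.apply hJ hz, omul_smul, omul_one]
  rfl

theorem IsLeftSliceProduct.apply_of_slicePreserving (hf : IsSlicePreserving W f) {b : 𝕆}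
    (hh : IsLeftSliceProduct W f (fun _ => b) h) {q : 𝕆} (hq : q ∈ W) : h q = f q * b := by
  obtain ⟨x, y, hf⟩ := hf
  obtain ⟨F, G, hF, hG, hh⟩ := hh
  have hW := hf.isAxiallySymmetric
  obtain ⟨J, hJ, z, rfl⟩ := hW.exists_slice hq
  rw [hh.apply hJ hq, hf.apply hJ hq, hF.stem_eq hf hJ hq,
    hG.stem_eq (isLeftInduced_const hW b) hJ hq]
  have h0 : ∀ x : 𝕆, x * (0 : 𝕆) = 0 := fun x => by simpa using omul_smul 0 x 0
  simp only [cmul, osmul_mul, oone_mul, h0, sub_zero, zero_add, oadd_mul, omul_smul, omul_one]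

/-- The real components of `f` commute with `b`, so `b •ᴸ f` coincides with `f •ᴸ b`: the constant
ends up on the right of `J`. -/
theorem IsLeftSliceProduct.apply_const_left (hf : IsSlicePreserving W f) {b : 𝕆}
    (hh : IsLeftSliceProduct W (fun _ => b) f h) {q : 𝕆} (hq : q ∈ W) : h q = f q * b := by
  obtain ⟨x, y, hf⟩ := hf
  obtain ⟨F, G, hF, hG, hh⟩ := hh
  have hW := hf.isAxiallySymmetric
  obtain ⟨J, hJ, z, rfl⟩ := hW.exists_slice hq
  rw [hh.apply hJ hq, hf.apply hJ hq, hG.stem_eq hf hJ hq,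
    hF.stem_eq (isLeftInduced_const hW b) hJ hq]
  have h0 : ∀ x : 𝕆, (0 : 𝕆) * x = 0 := fun x => by simpa using osmul_mul 0 0 x
  simp only [cmul, osmul_mul, oone_mul, h0, sub_zero, add_zero, oadd_mul, omul_smul, omul_one]

theorem IsRightSliceProduct.apply_const_left (hf : IsSlicePreserving W f) {b : 𝕆}
    (hh : IsRightSliceProduct W (fun _ => b) f h) {q : 𝕆} (hq : q ∈ W) : h q = b * f q := by
  obtain ⟨x, y, hf⟩ := hf
  have hf' := IsSlicePreserving.isRightInduced hf
  obtain ⟨F, G, hF, hG, hh⟩ := hh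
  have hW := hf.isAxiallySymmetric
  obtain ⟨J, hJ, z, rfl⟩ := hW.exists_slice hq
  rw [hh.apply hJ hq, hf'.apply hJ hq, hG.stem_eq hf' hJ hq,
    hF.stem_eq (isRightInduced_const hW b) hJ hq]
  have h0 : ∀ x : 𝕆, (0 : 𝕆) * x = 0 := fun x => by simpa using osmul_mul 0 0 x
  simp only [cmul, osmul_mul, oone_mul, h0, sub_zero, add_zero, omul_add, omul_smul, omul_one]

theorem isLeftSliceProduct_const (hf : IsSlicePreserving W f) (b : 𝕆) :
    IsLeftSliceProduct W f (fun _ => b) fun q => f q * b := by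
  obtain ⟨x, y, hf⟩ := hf
  refine ⟨_, _, hf, isLeftInduced_const hf.isAxiallySymmetric b, ?_⟩
  obtain ⟨D, hD, hW, hs, h⟩ := hf
  have h0 : ∀ x : 𝕆, x * (0 : 𝕆) = 0 := fun x => by simpa using omul_smul 0 x 0
  refine ⟨D, hD, hW, fun z hz => ?_, fun z hz J hJ => ?_⟩
  · have := hs z hz
    dsimp only at this
    simp only [cmul, this.1, this.2, h0, oneg_mul, sub_zero, zero_add]
    exact ⟨trivial, trivial⟩
  · simp only [h z hz J hJ, cmul, osmul_mul, oone_mul, h0, sub_zero, zero_add, oadd_mul, omul_smul,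
      omul_one]

theorem isRightSliceProduct_const (hf : IsSlicePreserving W f) (b : 𝕆) :
    IsRightSliceProduct W (fun _ => b) f fun q => b * f q := by
  obtain ⟨x, y, hf⟩ := hf
  refine ⟨_, _, isRightInduced_const hf.isAxiallySymmetric b, IsSlicePreserving.isRightInduced hf, ?_⟩
  obtain ⟨D, hD, hW, hs, h⟩ := hf
  have h0 : ∀ x : 𝕆, (0 : 𝕆) * x = 0 := fun x => by simpa using osmul_mul 0 0 x
  refine ⟨D, hD, hW, fun z hz => ?_, fun z hz J hJ => ?_⟩
  · have := hs z hz
    dsimp only at this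
    simp only [cmul, this.1, this.2, h0, omul_neg, sub_zero, add_zero]
    exact ⟨trivial, trivial⟩
  · simp only [h z hz J hJ, cmul, osmul_mul, h0, sub_zero, add_zero, omul_add, omul_smul, omul_one]

/-- Against a constant the slice product is the pointwise product, so slice products can be
discarded from here on. -/
theorem isLeftExpansion_iff {b : Fin 8 → 𝕆} {fc : Fin 8 → 𝕆 → 𝕆} : IsLeftExpansion W b fc f ↔
    (∀ i, IsSlicePreserving W (fc i)) ∧ ∀ q ∈ W, f q = ∑ i, fc i q * b i := by
  refine and_congr_right fun hs => ⟨?_, fun hf => ⟨_, fun i => isLeftSliceProduct_const (hs i) (b i), hf⟩⟩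
  rintro ⟨h, hh, hf⟩ q hq
  rw [hf q hq]
  exact Finset.sum_congr rfl fun i _ => (hh i).apply_of_slicePreserving (hs i) hq

theorem isRightExpansion_iff {b : Fin 8 → 𝕆} {fc : Fin 8 → 𝕆 → 𝕆} : IsRightExpansion W b fc f ↔
    (∀ i, IsSlicePreserving W (fc i)) ∧ ∀ q ∈ W, f q = ∑ i, b i * fc i q := by
  refine and_congr_right fun hs => ⟨?_, fun hf => ⟨_, fun i => isRightSliceProduct_const (hs i) (b i), hf⟩⟩
  rintro ⟨h, hh, hf⟩ q hq
  rw [hf q hq]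
  exact Finset.sum_congr rfl fun i _ => (hh i).apply_const_left (hs i) hq

theorem IsSlicePreserving.add (hf : IsSlicePreserving W f) (hg : IsSlicePreserving W g) :
    IsSlicePreserving W fun q => f q + g q := by
  obtain ⟨x, y, D, hD, hW, hs, hf⟩ := hf
  obtain ⟨x', y', hg⟩ := hg
  obtain ⟨D', hD', hW', hs', hg'⟩ := id hg
  -- The two functions come with their own index sets; both are recovered from `W` by intersecting
  -- with one slice, here that of `e 1`.
  have hDD : ∀ z ∈ D, z ∈ D' := by
    intro z hz
    have h1 : e 1 ∈ imagUnits := (IsLine.of_e (i := 1) (j := 2) (k := 3) (by simp)).pp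
    rw [← slice_mem_circularization hD' h1, ← hW', hW, slice_mem_circularization hD h1]
    exact hz
  refine ⟨fun z => x z + x' z, fun z => y z + y' z, D, hD, hW, fun z hz => ?_, fun z hz J hJ => ?_⟩
  · have h1 := hs z hz
    have h2 := hs' z (hDD z hz)
    dsimp only at h1 h2 ⊢
    rw [add_smul, add_smul, add_smul, add_smul, h1.1, h1.2, h2.1, h2.2, neg_add]
    exact ⟨rfl, rfl⟩
  · simp only [hf z hz J hJ, hg' z (hDD z hz) J hJ, add_smul, omul_add]
    abel

theorem IsSlicePreserving.smul (a : ℝ) (hf : IsSlicePreserving W f) :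
    IsSlicePreserving W fun q => a • f q := by
  obtain ⟨x, y, D, hD, hW, hs, hf⟩ := hf
  refine ⟨fun z => a * x z, fun z => a * y z, D, hD, hW, fun z hz => ?_, fun z hz J hJ => ?_⟩
  · have h1 := hs z hz
    dsimp only at h1 ⊢
    rw [mul_smul, mul_smul, mul_smul, mul_smul, h1.1, h1.2, smul_neg]
    exact ⟨rfl, rfl⟩
  · simp only [hf z hz J hJ, mul_smul, smul_add, omul_smul]

theorem IsSlicePreserving.sum_smul (a : Fin 8 → ℝ) {fc : Fin 8 → 𝕆 → 𝕆}
    (h : ∀ i, IsSlicePreserving W (fc i)) : IsSlicePreserving W fun q => ∑ i, a i • fc i q := by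
  have h' := fun i => (h i).smul (a i)
  simp only [Fin.sum_univ_eight]
  exact (((((((h' 0).add (h' 1)).add (h' 2)).add (h' 3)).add (h' 4)).add (h' 5)).add (h' 6)).add (h' 7)

/-- The calculus is defined through the basis `e`; expanding `b i` in that basis transfers any other
expansion to it. -/
theorem IsLeftExpansion.standard {b : Fin 8 → 𝕆} {fc : Fin 8 → 𝕆 → 𝕆}
    (h : IsLeftExpansion W b fc f) :
    IsLeftExpansion W e (fun j q => ∑ i, b i j • fc i q) f := by
  rw [isLeftExpansion_iff] at h ⊢
  refine ⟨fun j => .sum_smul (fun i => b i j) h.1, fun q hq => ?_⟩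
  rw [h.2 q hq]
  simp only [osum_mul]
  rw [Finset.sum_comm]
  refine Finset.sum_congr rfl fun i _ => ?_
  conv_lhs => rw [← sum_smul_e (b i), omul_sum]
  exact Finset.sum_congr rfl fun j _ => by rw [osmul_mul, omul_smul]

theorem IsRightExpansion.standard {b : Fin 8 → 𝕆} {fc : Fin 8 → 𝕆 → 𝕆}
    (h : IsRightExpansion W b fc f) :
    IsRightExpansion W e (fun j q => ∑ i, b i j • fc i q) f := by
  rw [isRightExpansion_iff] at h ⊢
  refine ⟨fun j => .sum_smul (fun i => b i j) h.1, fun q hq => ?_⟩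
  rw [h.2 q hq]
  simp only [omul_sum]
  rw [Finset.sum_comm]
  refine Finset.sum_congr rfl fun i _ => ?_
  conv_lhs => rw [← sum_smul_e (b i), osum_mul]
  exact Finset.sum_congr rfl fun j _ => by rw [osmul_mul, omul_smul]

theorem IsInLeftSlice.expansion (hf : IsInLeftSlice W J f) : ∃ f₀ f₁ : 𝕆 → 𝕆,
    IsLeftExpansion W e (fun j q => J j • f₁ q + (if j = 0 then (1 : ℝ) else 0) • f₀ q) f ∧
    IsSlicePreserving W f₀ ∧ IsSlicePreserving W f₁ ∧ ∀ q ∈ W, f q = f₀ q + f₁ q * J := by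
  obtain ⟨f₀, f₁, h, h₀, -, h₁, -, hp, hf⟩ := hf
  have hf' : ∀ q ∈ W, f q = f₀ q + f₁ q * J := fun q hq => by
    rw [hf q hq, hp.apply_const_left h₁ hq]
  refine ⟨f₀, f₁, ?_, h₀, h₁, hf'⟩
  rw [isLeftExpansion_iff]
  refine ⟨fun j => (h₁.smul _).add (h₀.smul _), fun q hq => ?_⟩
  rw [hf' q hq]
  simp only [oadd_mul, Finset.sum_add_distrib, osmul_mul]
  simp only [ite_smul, one_smul, zero_smul, Finset.sum_ite_eq', Finset.mem_univ, if_true]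
  rw [← one_def, omul_one, add_comm]
  conv_lhs => rw [← sum_smul_e J, omul_sum]
  simp only [omul_smul]

theorem IsInRightSlice.expansion (hf : IsInRightSlice W J f) : ∃ f₀ f₁ : 𝕆 → 𝕆,
    IsRightExpansion W e (fun j q => J j • f₁ q + (if j = 0 then (1 : ℝ) else 0) • f₀ q) f ∧
    IsSlicePreserving W f₀ ∧ IsSlicePreserving W f₁ ∧ ∀ q ∈ W, f q = f₀ q + J * f₁ q := by
  obtain ⟨f₀, f₁, h, h₀, -, h₁, -, hp, hf⟩ := hf
  have hf' : ∀ q ∈ W, f q = f₀ q + J * f₁ q := fun q hq => by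
    rw [hf q hq, hp.apply_const_left h₁ hq]
  refine ⟨f₀, f₁, ?_, h₀, h₁, hf'⟩
  rw [isRightExpansion_iff]
  refine ⟨fun j => (h₁.smul _).add (h₀.smul _), fun q hq => ?_⟩
  rw [hf' q hq]
  simp only [omul_add, Finset.sum_add_distrib, omul_smul]
  simp only [ite_smul, one_smul, zero_smul, Finset.sum_ite_eq', Finset.mem_univ, if_true]
  rw [← one_def, oone_mul, add_comm]
  conv_lhs => rw [← sum_smul_e J, osum_mul]
  simp only [osmul_mul]

end SliceFunctions

/-! ### Regularity of the components -/

section Components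

variable {J : 𝕆} {W : Set 𝕆} {f : 𝕆 → 𝕆}

/-- The component `λ A + i λ B` of the pair `P = A + K B`, `Q = A - K B`, where `K² = -1`. -/
noncomputable def component (K : 𝕆 →ₗ[ℝ] 𝕆) (l : 𝕆 →ₗ[ℝ] ℝ) (P Q : 𝕆) : ℂ :=
  (1 / 2 : ℂ) * (l (P + Q) : ℂ) - (1 / 2 : ℂ) * Complex.I * (l (K (P - Q)) : ℂ)

theorem component_eq {K : 𝕆 →ₗ[ℝ] 𝕆} (hK : ∀ x, K (K x) = -x) (l : 𝕆 →ₗ[ℝ] ℝ) (A B : 𝕆) :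
    component K l (A + K B) (A - K B) = l A + Complex.I * l B := by
  have h1 : A + K B + (A - K B) = (2 : ℝ) • A := by module
  have h2 : K (A + K B - (A - K B)) = (-2 : ℝ) • B := by
    rw [show A + K B - (A - K B) = (2 : ℝ) • K B by module, map_smul, hK]; module
  rw [component, h1, h2, map_smul, map_smul]
  simp only [smul_eq_mul]
  push_cast
  ring

/-- Writing `P = A + K B` and `Q = A - K B`, the two equations are together the Cauchy–Riemann
equations for the pair `(A, B)`, and they survive applying the real functional `l` to each entry. -/
theorem component_regular {K : 𝕆 →ₗ[ℝ] 𝕆} (hK : ∀ x, K (K x) = -x) (l : 𝕆 →ₗ[ℝ] ℝ) {D : Set ℂ}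
    (hD : IsOpen D) {P Q : ℂ → 𝕆} (hP : ContDiffOn ℝ 1 P D) (hQ : ContDiffOn ℝ 1 Q D)
    (hP' : ∀ z ∈ D, fderiv ℝ P z 1 + K (fderiv ℝ P z Complex.I) = 0)
    (hQ' : ∀ z ∈ D, fderiv ℝ Q z 1 - K (fderiv ℝ Q z Complex.I) = 0) :
    ContDiffOn ℝ 1 (fun z => component K l (P z) (Q z)) D ∧
      ∀ z ∈ D, dbar (fun z => component K l (P z) (Q z)) z = 0 := by
  let l₁ : 𝕆 →L[ℝ] ℂ := Complex.ofRealCLM.comp (LinearMap.toContinuousLinearMap l)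
  let l₂ : 𝕆 →L[ℝ] ℂ := Complex.ofRealCLM.comp (LinearMap.toContinuousLinearMap (l ∘ₗ K))
  have hc : (fun z => component K l (P z) (Q z)) = fun z => (1 / 2 : ℂ) • l₁ (P z + Q z) -
      ((1 / 2 : ℂ) * Complex.I) • l₂ (P z - Q z) := rfl
  refine ⟨?_, fun z hz => ?_⟩
  · rw [hc]
    exact ((l₁.contDiff.comp_contDiffOn (hP.add hQ)).const_smul _).sub
      ((l₂.contDiff.comp_contDiffOn (hP.sub hQ)).const_smul _)
  · have hPz := ((hP.differentiableOn one_ne_zero).differentiableAt (hD.mem_nhds hz)).hasFDerivAt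
    have hQz := ((hQ.differentiableOn one_ne_zero).differentiableAt (hD.mem_nhds hz)).hasFDerivAt
    have hd := ((l₁.hasFDerivAt.comp z (hPz.add hQz)).const_smul (1 / 2 : ℂ)).sub
      ((l₂.hasFDerivAt.comp z (hPz.sub hQz)).const_smul ((1 / 2 : ℂ) * Complex.I))
    have h1 := eq_neg_of_add_eq_zero_left (hP' z hz)
    have h2 := sub_eq_zero.1 (hQ' z hz)
    rw [dbar, hc]
    erw [hd.fderiv]
    simp only [sub_apply, smul_apply, ContinuousLinearMap.comp_apply, add_apply, h1, h2, l₁, l₂,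
      LinearMap.coe_toContinuousLinearMap', LinearMap.comp_apply, map_add, map_sub, map_neg, hK,
      Complex.ofRealCLM_apply, smul_eq_mul]
    linear_combination ((l (K (fderiv ℝ Q z Complex.I)) : ℂ) - l (K (fderiv ℝ P z Complex.I))) / 4 *
      Complex.I_sq

/-- The coordinate functions of the basis `τ ∘ e`. -/
noncomputable def basisCoord (τ : 𝕆 ≃ₗ[ℝ] 𝕆) (i : Fin 8) : 𝕆 →ₗ[ℝ] ℝ :=
  (EuclideanSpace.proj i : 𝕆 →L[ℝ] ℝ).toLinearMap ∘ₗ τ.symm.toLinearMap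

theorem basisCoord_sum (τ : 𝕆 ≃ₗ[ℝ] 𝕆) (a : Fin 8 → ℝ) (i : Fin 8) :
    basisCoord τ i (∑ j, a j • τ (e j)) = a i := by
  simp [basisCoord, e_apply]

/-- The components of `f` along the basis `τ ∘ e` on the slice `ℂ_J`, from left expansions. -/
noncomputable def leftComponent (f : 𝕆 → 𝕆) (J : 𝕆) (τ : 𝕆 ≃ₗ[ℝ] 𝕆) (i : Fin 8) (z : ℂ) : ℂ :=
  component (omulL J) (basisCoord τ i) (f (slice J z)) (f (slice (-J) z))

/-- The components of `f` along the basis `τ ∘ e` on the slice `ℂ_J`, from right expansions. -/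
noncomputable def rightComponent (f : 𝕆 → 𝕆) (J : 𝕆) (τ : 𝕆 ≃ₗ[ℝ] 𝕆) (i : Fin 8) (z : ℂ) : ℂ :=
  component (omulL.flip J) (basisCoord τ i) (f (slice J z)) (f (slice (-J) z))

/-- The right-hand side depends on `f` alone. Hence the choice of an expansion in `leftCalculus` is
harmless, and the coefficients are regular although an expansion only requires them to be slice
preserving. -/
theorem IsLeftExpansion.apply_slice {τ : 𝕆 ≃ₗ[ℝ] 𝕆} {fc : Fin 8 → 𝕆 → 𝕆}
    (h : IsLeftExpansion W (fun i => τ (e i)) fc f) (hW : IsAxiallySymmetric W)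
    (hJ : J ∈ imagUnits) {z : ℂ} (hz : slice J z ∈ W) (i : Fin 8) :
    fc i (slice J z) = slice J (leftComponent f J τ i z) := by
  rw [isLeftExpansion_iff] at h
  have hJ' := neg_mem_imagUnits hJ
  choose c hc using fun i => (h.1 i).exists_complex
  rw [hc i J hJ z hz, leftComponent, h.2 _ hz, h.2 _ ((hW.slice_mem_iff hJ hJ').1 hz)]
  simp only [hc _ J hJ z hz, hc _ (-J) hJ' z ((hW.slice_mem_iff hJ hJ').1 hz)]
  have h1 : ∑ j, slice J (c j z) * τ (e j) =
      ∑ j, (c j z).re • τ (e j) + omulL J (∑ j, (c j z).im • τ (e j)) := by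
    simp only [map_sum, map_smul, omulL_apply, ← Finset.sum_add_distrib, slice, oadd_mul, osmul_mul,
      oone_mul]
  have h2 : ∑ j, slice (-J) (c j z) * τ (e j) =
      ∑ j, (c j z).re • τ (e j) - omulL J (∑ j, (c j z).im • τ (e j)) := by
    simp only [map_sum, map_smul, omulL_apply, ← Finset.sum_neg_distrib, ← Finset.sum_add_distrib, slice, oadd_mul, osmul_mul,
      oone_mul, oneg_mul, smul_neg, sub_eq_add_neg]
  rw [h1, h2, component_eq (imag_mul_imag_mul hJ), basisCoord_sum, basisCoord_sum, mul_comm,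
    Complex.re_add_im]

theorem IsRightExpansion.apply_slice {τ : 𝕆 ≃ₗ[ℝ] 𝕆} {fc : Fin 8 → 𝕆 → 𝕆}
    (h : IsRightExpansion W (fun i => τ (e i)) fc f) (hW : IsAxiallySymmetric W)
    (hJ : J ∈ imagUnits) {z : ℂ} (hz : slice J z ∈ W) (i : Fin 8) :
    fc i (slice J z) = slice J (rightComponent f J τ i z) := by
  rw [isRightExpansion_iff] at h
  have hJ' := neg_mem_imagUnits hJ
  choose c hc using fun i => (h.1 i).exists_complex
  rw [hc i J hJ z hz, rightComponent, h.2 _ hz, h.2 _ ((hW.slice_mem_iff hJ hJ').1 hz)]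
  simp only [hc _ J hJ z hz, hc _ (-J) hJ' z ((hW.slice_mem_iff hJ hJ').1 hz)]
  have h1 : ∑ j, τ (e j) * slice J (c j z) =
      ∑ j, (c j z).re • τ (e j) + omulL.flip J (∑ j, (c j z).im • τ (e j)) := by
    simp only [map_sum, map_smul, LinearMap.flip_apply, omulL_apply, ← Finset.sum_add_distrib, slice,
      omul_add, omul_smul, omul_one]
  have h2 : ∑ j, τ (e j) * slice (-J) (c j z) =
      ∑ j, (c j z).re • τ (e j) - omulL.flip J (∑ j, (c j z).im • τ (e j)) := by
    simp only [map_sum, map_smul, LinearMap.flip_apply, omulL_apply, ← Finset.sum_neg_distrib, ← Finset.sum_add_distrib, slice,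
      omul_add, omul_smul, omul_one, omul_neg, smul_neg, sub_eq_add_neg]
  rw [h1, h2, component_eq (mul_imag_mul_imag hJ), basisCoord_sum, basisCoord_sum, mul_comm,
    Complex.re_add_im]

theorem IsLeftSliceRegular.leftComponent (hf : IsLeftSliceRegular W f) (hW : IsAxiallySymmetric W)
    (hJ : J ∈ imagUnits) (τ : 𝕆 ≃ₗ[ℝ] 𝕆) (i : Fin 8) :
    ContDiffOn ℝ 1 (leftComponent f J τ i) (slice J ⁻¹' W) ∧
      ∀ z ∈ slice J ⁻¹' W, dbar (OctonionCalculus.leftComponent f J τ i) z = 0 := by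
  have hJ' := neg_mem_imagUnits hJ
  have hWJ : slice (-J) ⁻¹' W = slice J ⁻¹' W := by
    ext z; exact (hW.slice_mem_iff hJ hJ').symm
  have hP := hf.2 J hJ
  have hQ := hf.2 (-J) hJ'
  rw [hWJ] at hQ
  refine component_regular (imag_mul_imag_mul hJ) _ (hf.1 J hJ) hP.1 hQ.1 hP.2 fun z hz => ?_
  have := hQ.2 z hz
  rwa [oneg_mul, ← sub_eq_add_neg] at this

theorem IsRightSliceRegular.rightComponent (hf : IsRightSliceRegular W f)
    (hW : IsAxiallySymmetric W) (hJ : J ∈ imagUnits) (τ : 𝕆 ≃ₗ[ℝ] 𝕆) (i : Fin 8) :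
    ContDiffOn ℝ 1 (rightComponent f J τ i) (slice J ⁻¹' W) ∧
      ∀ z ∈ slice J ⁻¹' W, dbar (OctonionCalculus.rightComponent f J τ i) z = 0 := by
  have hJ' := neg_mem_imagUnits hJ
  have hWJ : slice (-J) ⁻¹' W = slice J ⁻¹' W := by
    ext z; exact (hW.slice_mem_iff hJ hJ').symm
  have hP := hf.2 J hJ
  have hQ := hf.2 (-J) hJ'
  rw [hWJ] at hQ
  refine component_regular (mul_imag_mul_imag hJ) _ (hf.1 J hJ) hP.1 hQ.1 hP.2 fun z hz => ?_
  have := hQ.2 z hz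
  rwa [omul_neg, ← sub_eq_add_neg] at this

end Components

/-! ### Resolvents on a slice -/

section Resolvent

open Filter Topology

variable {V : Type*} [NormedAddCommGroup V] [NormedSpace ℝ V] [NormedOctonionBimodule V]
  {J : 𝕆}

theorem rmul_slice (J : 𝕆) (z : ℂ) : (rmul (slice J z) : V →L[ℝ] V) = z.re • 1 + z.im • rmul J := by
  rw [slice, rmul_add, rmul_smul, rmul_smul, rmul_one]

theorem lmul_slice (J : 𝕆) (z : ℂ) : (lmul (slice J z) : V →L[ℝ] V) = z.re • 1 + z.im • lmul J := by
  rw [slice, lmul_add, lmul_smul, lmul_smul, lmul_one]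

/-- The relation `R_J² = -1` makes right multiplication by the slice an action of `ℂ`. -/
theorem rmul_rmul_slice (hJ : J ∈ imagUnits) (z w : ℂ) (x : V) :
    rmul (slice J w) (rmul (slice J z) x) = rmul (slice J z * slice J w) x := by
  have h : (rmul J * rmul J : V →L[ℝ] V) = -1 := rmul_mul_self hJ
  have hx := congrArg (fun A : V →L[ℝ] V => A x) h
  simp only [mul_apply_eq_comp, neg_apply, one_apply_eq_self] at hx
  rw [slice_mul hJ]
  simp only [rmul_slice, add_apply, smul_apply, one_apply_eq_self, map_add, map_smul, hx,
    Complex.mul_re, Complex.mul_im]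
  module

theorem lmul_lmul_slice (hJ : J ∈ imagUnits) (z w : ℂ) (x : V) :
    lmul (slice J z) (lmul (slice J w) x) = lmul (slice J z * slice J w) x := by
  have h : (lmul J * lmul J : V →L[ℝ] V) = -1 := lmul_mul_self hJ
  have hx := congrArg (fun A : V →L[ℝ] V => A x) h
  simp only [mul_apply_eq_comp, neg_apply, one_apply_eq_self] at hx
  rw [slice_mul hJ]
  simp only [lmul_slice, add_apply, smul_apply, one_apply_eq_self, map_add, map_smul, hx,
    Complex.mul_re, Complex.mul_im]
  module

/-- The complex functional on `V`, a complex space through right multiplication by `J`, with real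
part `φ`. -/
noncomputable def complexFunctional (J : 𝕆) (φ : V →L[ℝ] ℝ) : V →L[ℝ] ℂ :=
  Complex.ofRealCLM.comp φ - Complex.I • Complex.ofRealCLM.comp (φ.comp (rmul J))

theorem complexFunctional_apply (J : 𝕆) (φ : V →L[ℝ] ℝ) (x : V) :
    complexFunctional J φ x = φ x - Complex.I * φ (rmul J x) := rfl

theorem complexFunctional_re (J : 𝕆) (φ : V →L[ℝ] ℝ) (x : V) :
    (complexFunctional J φ x).re = φ x := by
  simp [complexFunctional_apply]

theorem complexFunctional_rmul (hJ : J ∈ imagUnits) (φ : V →L[ℝ] ℝ) (z : ℂ) (x : V) :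
    complexFunctional J φ (rmul (slice J z) x) = z * complexFunctional J φ x := by
  have h : (rmul J * rmul J : V →L[ℝ] V) = -1 := rmul_mul_self hJ
  have hx := congrArg (fun A : V →L[ℝ] V => A x) h
  simp only [mul_apply_eq_comp, neg_apply, one_apply_eq_self] at hx
  simp only [complexFunctional_apply, rmul_slice, add_apply, smul_apply, one_apply_eq_self, map_add,
    map_smul, hx, map_neg, Complex.real_smul, Complex.ofReal_neg]
  linear_combination ((z.im : ℂ) * φ (rmul J x)) * Complex.I_sq +
    (φ x - Complex.I * φ (rmul J x)) * Complex.re_add_im z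

theorem dbar_eq_zero_iff {f : ℂ → ℂ} {z : ℂ} :
    dbar f z = 0 ↔ fderiv ℝ f z 1 + Complex.I * fderiv ℝ f z Complex.I = 0 := by
  simp [dbar]

theorem dbar_mul {f g : ℂ → ℂ} {z : ℂ} (hf : DifferentiableAt ℝ f z)
    (hg : DifferentiableAt ℝ g z) :
    dbar (fun w => f w * g w) z = dbar f z * g z + f z * dbar g z := by
  rw [dbar, dbar, dbar, fderiv_fun_mul hf hg]
  simp only [add_apply, smul_apply, smul_eq_mul]
  ring

theorem hasFDerivAt_rmul_slice (T : V →L[ℝ] V) (J : 𝕆) (z : ℂ) : HasFDerivAt (fun z => rmul (slice J z) - T)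
    (LinearMap.toContinuousLinearMap (rmulₗ V ∘ₗ sliceₗ J)) z :=
  (LinearMap.toContinuousLinearMap (rmulₗ V ∘ₗ sliceₗ J)).hasFDerivAt.sub_const T

variable [CompleteSpace V] (T : V →L[ℝ] V)

theorem isOpen_isUnit_slice (J : 𝕆) : IsOpen {z : ℂ | IsUnit (rmul (slice J z) - T)} :=
  Units.isOpen.preimage ((continuous_rmul.comp (continuous_slice J)).sub continuous_const)

theorem contDiffAt_resolventInv {z : ℂ} (hz : IsUnit (rmul (slice J z) - T)) :
    ContDiffAt ℝ 1 (fun z => resolventInv T (slice J z)) z := by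
  obtain ⟨x, hx⟩ := hz
  have h1 : ContDiff ℝ 1 (fun z => rmul (slice J z) - T) :=
    (LinearMap.toContinuousLinearMap (rmulₗ V ∘ₗ sliceₗ J)).contDiff.sub contDiff_const
  have h2 : ContDiffAt ℝ 1 Ring.inverse (rmul (slice J z) - T) := by
    rw [← hx]; exact contDiffAt_ringInverse ℝ x
  exact h2.comp z h1.contDiffAt

theorem fderiv_resolventInv {z : ℂ} (hz : IsUnit (rmul (slice J z) - T)) (h : ℂ) :
    fderiv ℝ (fun z => resolventInv T (slice J z)) z h =
      -(resolventInv T (slice J z) * rmul (slice J h) * resolventInv T (slice J z)) := by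
  obtain ⟨x, hx⟩ := hz
  have h2 : HasFDerivAt Ring.inverse (-ContinuousLinearMap.mulLeftRight ℝ (V →L[ℝ] V) ↑x⁻¹ ↑x⁻¹)
      (rmul (slice J z) - T) := by
    rw [← hx]; exact hasFDerivAt_ringInverse x
  have h3 := h2.comp z (hasFDerivAt_rmul_slice T J z)
  have h4 : resolventInv T (slice J z) = ↑x⁻¹ := by
    rw [resolventInv, ← hx, Ring.inverse_unit]
  have h5 : HasFDerivAt (fun z => resolventInv T (slice J z)) _ z := h3
  rw [h5.fderiv, h4]
  rfl

variable {T} in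
theorem fderiv_functional_resolventInv (Φ : V →L[ℝ] ℂ) (x : V) {z : ℂ}
    (hz : IsUnit (rmul (slice J z) - T)) (h : ℂ) :
    fderiv ℝ (fun z => Φ (resolventInv T (slice J z) x)) z h =
      -Φ (resolventInv T (slice J z) (rmul (slice J h) (resolventInv T (slice J z) x))) := by
  have h1 := ((contDiffAt_resolventInv T hz).differentiableAt one_ne_zero).hasFDerivAt
  let L : (V →L[ℝ] V) →L[ℝ] ℂ := Φ.comp (ContinuousLinearMap.apply ℝ V x)
  have h2 := (L.hasFDerivAt (x := resolventInv T (slice J z))).comp z h1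
  have h3 : HasFDerivAt (fun z => Φ (resolventInv T (slice J z) x)) _ z := h2
  rw [h3.fderiv, ContinuousLinearMap.comp_apply, fderiv_resolventInv T hz]
  simp [L]

variable {T}

/-- The derivative of the resolvent in direction `h` is `-S R_h S`. Once `R_h` can be pulled out to
the left, `Φ` turns directions `1` and `i` into factors `1` and `i`, and `1 + i · i = 0`. -/
theorem dbar_resolventInv_left (hJ : J ∈ imagUnits) (φ : V →L[ℝ] ℝ) {v : V}
    (hv : v ∈ realElements V) {z : ℂ} (hz : slice J z ∈ pullbackSliceResolvent T J) :
    dbar (fun z => complexFunctional J φ (resolventInv T (slice J z) v)) z = 0 := by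
  set S := resolventInv T (slice J z) with hS
  -- Extendability for `n = 1` rewrites `S²(v λ)` as `S(S(v) λ)`; for `n = 2` it then gives
  -- commutation on `S v`, which need not be a real element.
  have h : ∀ w : ℂ, S (rmul (slice J w) (S v)) = rmul (slice J w) (S (S v)) := by
    intro w
    have h1 := hz.2.2 1 le_rfl v hv _ (mem_range_self w)
    have h2 := hz.2.2 2 one_le_two v hv _ (mem_range_self w)
    rw [pow_one] at h1
    rw [pow_two, mul_apply_eq_comp, mul_apply_eq_comp, h1] at h2
    exact h2
  rw [dbar_eq_zero_iff, fderiv_functional_resolventInv _ _ hz.2.1,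
    fderiv_functional_resolventInv _ _ hz.2.1, ← hS, h, h, complexFunctional_rmul hJ,
    complexFunctional_rmul hJ]
  linear_combination (-complexFunctional J φ (S (S v))) * Complex.I_sq

/-- Here `λ` is pulled out only under `Re`, but for every argument `y`. Applying this to `y λ` with
the extra factor `J` shows that `Φ`, built on `φ ∘ Re`, satisfies `Φ(S(y λ)) = λ Φ(S y)`. -/
theorem dbar_resolventInv_right (hJ : J ∈ imagUnits) (φ : V →L[ℝ] ℝ) (x : V)
    {z : ℂ} (hz : slice J z ∈ pushforwardSliceResolvent T J) :
    dbar (fun z => complexFunctional J (φ.comp (reOp V)) (resolventInv T (slice J z) x)) z = 0 := by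
  set S := resolventInv T (slice J z) with hS
  have h : ∀ (w : ℂ) (y : V), reOp V (S (rmul (slice J w) y)) = reOp V (rmul (slice J w) (S y)) := by
    intro w y
    have h1 := hz.2.2 1 le_rfl y _ (mem_range_self w)
    rwa [pow_one] at h1
  have hΦ : ∀ (w : ℂ) (y : V), complexFunctional J (φ.comp (reOp V)) (S (rmul (slice J w) y)) =
      w * complexFunctional J (φ.comp (reOp V)) (S y) := by
    intro w y
    rw [← complexFunctional_rmul hJ, complexFunctional_apply, complexFunctional_apply]
    simp only [ContinuousLinearMap.comp_apply]
    have h2 : reOp V (rmul J (S (rmul (slice J w) y))) =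
        reOp V (rmul J (rmul (slice J w) (S y))) := by
      have h3 := rmul_rmul_slice hJ w Complex.I y
      have h4 := rmul_rmul_slice hJ w Complex.I (S y)
      have h5 := h Complex.I (rmul (slice J w) y)
      rw [h3, slice_mul hJ, h, ← slice_mul hJ, ← h4] at h5
      rw [slice_I] at h5
      exact h5.symm
    rw [h, h2]
  rw [dbar_eq_zero_iff, fderiv_functional_resolventInv _ _ hz.2.1,
    fderiv_functional_resolventInv _ _ hz.2.1, ← hS, hΦ, hΦ]
  linear_combination (-complexFunctional J (φ.comp (reOp V)) (S (S x))) * Complex.I_sq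

end Resolvent

/-! ### Resolvent sets off an admissible domain -/

section ResolventSets

open Filter Topology

variable {V : Type*} [NormedAddCommGroup V] [NormedSpace ℝ V] [NormedOctonionBimodule V]
  {T : V →L[ℝ] V} {J K : 𝕆} {U : Set 𝕆}

theorem sliceC_eq_of_slice_eq (hJ : J ∈ imagUnits) (hK : K ∈ imagUnits) {z w : ℂ} (hz : z.im ≠ 0)
    (h : slice J z = slice K w) : sliceC J = sliceC K := by
  have hc := slice_eq_slice hJ hK h
  have key : J = K ∨ J = -K := by
    rcases hc with rfl | rfl
    · left
      have h1 : z.im • J = z.im • K := add_left_cancel h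
      exact smul_right_injective _ hz h1
    · right
      rw [← slice_neg] at h
      have h1 : w.im • -J = w.im • K := add_left_cancel h
      have hw : w.im ≠ 0 := fun h0 => hz (by simp [h0])
      rw [← smul_right_injective _ hw h1, neg_neg]
  rcases key with rfl | rfl
  · rfl
  · ext x
    constructor
    · rintro ⟨z, rfl⟩
      exact ⟨conj z, (slice_neg _ _).symm⟩
    · rintro ⟨z, rfl⟩
      exact ⟨conj z, by rw [slice_neg, Complex.conj_conj]⟩

/-- A real point belongs to every slice and so carries no information on which slice its resolvent
set came from; it has to be reached from non-real points off `D`. -/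
theorem OrientedBoundary.mem_closure_nonreal {D : Set ℂ} (Γ : OrientedBoundary D) (hD : IsOpen D)
    {z : ℂ} (hz : z ∉ D) : z ∈ closure {w : ℂ | w.im ≠ 0 ∧ w ∉ D} := by
  rw [Metric.mem_closure_iff]
  intro r hr
  by_cases hc : z ∈ closure D
  · obtain ⟨w, hw, hw'⟩ := Γ.exists_im_ne_zero_notMem hD
      (show z ∈ frontier D from ⟨hc, fun h => hz (hD.interior_eq ▸ h)⟩) hr
    exact ⟨w, hw', by rw [dist_comm]; exact hw⟩
  · obtain ⟨δ, hδ, hs⟩ := Metric.isOpen_iff.1 isClosed_closure.isOpen_compl z hc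
    by_cases hz0 : z.im = 0
    · set ε := min δ r / 2 with hε
      have hε0 : 0 < ε := by positivity
      have hd : dist z (z + ε * Complex.I) = ε := by
        rw [dist_eq_norm]
        simp [abs_of_pos hε0]
      refine ⟨z + ε * Complex.I, ⟨by simp [hz0, hε0.ne'], fun h => hs ?_ (subset_closure h)⟩, ?_⟩
      · rw [Metric.mem_ball, dist_comm, hd]
        linarith [min_le_left δ r, lt_min hδ hr]
      · rw [hd]
        linarith [min_le_right δ r, lt_min hδ hr]
    · exact ⟨z, ⟨hz0, hz⟩, by simpa using hr⟩

theorem OrientedBoundary.eq_zero_of_nonreal {E : Type*} [NormedAddCommGroup E] {D : Set ℂ} (Γ : OrientedBoundary D) (hD : IsOpen D)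
    {z : ℂ} (hz : z ∉ D) {g : ℂ → E} (hg : ContinuousAt g z)
    (h : ∀ w : ℂ, w.im ≠ 0 → w ∉ D → g w = 0) : g z = 0 := by
  have h1 := hg.continuousWithinAt.mem_closure_image (Γ.mem_closure_nonreal hD hz)
  have h2 : g '' {w : ℂ | w.im ≠ 0 ∧ w ∉ D} ⊆ {0} := by
    rintro _ ⟨w, hw, rfl⟩
    exact h w hw.1 hw.2
  simpa using closure_mono h2 h1

variable [CompleteSpace V]

theorem continuousAt_resolventInv_pow {z : ℂ} (hz : IsUnit (rmul (slice J z) - T)) (n : ℕ) (x : V) :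
    ContinuousAt (fun z => (resolventInv T (slice J z) ^ n) x) z := by
  have := (contDiffAt_resolventInv T hz).continuousAt
  exact (this.pow n).clm_apply continuousAt_const

/-- For a non-real point the slice `ℂ_K` supplied by the spectrum equals `ℂ_J`. For a real point
invertibility holds anyway, and extendability for `J` is an equation closed under limits of non-real
points off `U`. -/
theorem mem_pullbackSliceResolvent (hJ : J ∈ imagUnits) (hU : IsLeftAdmissible T U)
    (Γ : OrientedBoundary (slice J ⁻¹' U)) {z : ℂ} (hz : slice J z ∉ U) :
    slice J z ∈ pullbackSliceResolvent T J := by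
  have hmem : ∀ w : ℂ, slice J w ∉ U → IsUnit (rmul (slice J w) - T) ∧
      (w.im ≠ 0 → IsExtendable J (resolventInv T (slice J w))) := by
    intro w hw
    have h1 : slice J w ∈ ⋃ K ∈ imagUnits, pullbackSliceResolvent T K := by
      by_contra h
      exact hw (hU.2 h)
    simp only [mem_iUnion] at h1
    obtain ⟨K, hK, ⟨w', hw'⟩, hu, he⟩ := h1
    refine ⟨hu, fun h0 => ?_⟩
    rwa [IsExtendable, sliceC_eq_of_slice_eq hJ hK h0 hw'.symm]
  refine ⟨mem_range_self z, (hmem z hz).1, fun n hn v hv s hs => ?_⟩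
  rw [← sub_eq_zero]
  refine Γ.eq_zero_of_nonreal (hU.1.slice_isOpen J hJ) hz
    (g := fun z => (resolventInv T (slice J z) ^ n) (rmul s v) -
      rmul s ((resolventInv T (slice J z) ^ n) v)) ?_ fun w hw0 hw => ?_
  · exact (continuousAt_resolventInv_pow (hmem z hz).1 n _).sub
      ((rmul s).continuous.continuousAt.comp (continuousAt_resolventInv_pow (hmem z hz).1 n v))
  · simp only [(hmem w hw).2 hw0 n hn v hv s hs, sub_self]

theorem mem_pushforwardSliceResolvent (hJ : J ∈ imagUnits) (hU : IsRightAdmissible T U)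
    (Γ : OrientedBoundary (slice J ⁻¹' U)) {z : ℂ} (hz : slice J z ∉ U) :
    slice J z ∈ pushforwardSliceResolvent T J := by
  have hmem : ∀ w : ℂ, slice J w ∉ U → IsUnit (rmul (slice J w) - T) ∧
      (w.im ≠ 0 → IsLiftable J (resolventInv T (slice J w))) := by
    intro w hw
    have h1 : slice J w ∈ ⋃ K ∈ imagUnits, pushforwardSliceResolvent T K := by
      by_contra h
      exact hw (hU.2 h)
    simp only [mem_iUnion] at h1
    obtain ⟨K, hK, ⟨w', hw'⟩, hu, he⟩ := h1
    refine ⟨hu, fun h0 => ?_⟩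
    rwa [IsLiftable, sliceC_eq_of_slice_eq hJ hK h0 hw'.symm]
  refine ⟨mem_range_self z, (hmem z hz).1, fun n hn v s hs => ?_⟩
  rw [← sub_eq_zero]
  refine Γ.eq_zero_of_nonreal (hU.1.slice_isOpen J hJ) hz
    (g := fun z => reOp V ((resolventInv T (slice J z) ^ n) (rmul s v)) -
      reOp V (rmul s ((resolventInv T (slice J z) ^ n) v))) ?_ fun w hw0 hw => ?_
  · exact ((reOp V).continuous.continuousAt.comp (continuousAt_resolventInv_pow (hmem z hz).1 n _)).sub
      (((reOp V).comp (rmul s)).continuous.continuousAt.comp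
        (continuousAt_resolventInv_pow (hmem z hz).1 n v))
  · simp only [(hmem w hw).2 hw0 n hn v s hs, sub_self]

end ResolventSets

/-! ### Boundary integrals -/

namespace OrientedBoundary

open MeasureTheory

theorem integrand_eq {D : Set ℂ} {E : Type*} (Γ : OrientedBoundary D) {J : 𝕆} (hJ : J ∈ imagUnits)
    (g : 𝕆 → 𝕆 → E) (k : Fin Γ.n) (t : ℝ) :
    Γ.integrand J g k t =
      g (slice J (Γ.γ k t)) (slice J (-(deriv (Γ.γ k) t * Complex.I))) := by
  rw [integrand, slice_mul_self hJ]
  exact congrArg _ (map_neg (sliceₗ J) _).symm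

theorem Integrable.sum {D : Set ℂ} {E ι : Type*} [NormedAddCommGroup E] {Γ : OrientedBoundary D}
    {J : 𝕆} (s : Finset ι) {g : ι → 𝕆 → 𝕆 → E}
    (hg : ∀ i ∈ s, Γ.Integrable J (g i)) : Γ.Integrable J fun q dq => ∑ i ∈ s, g i q dq := fun k =>
  ⟨integrable_finsetSum s fun i hi => (hg i hi k).1,
    integrable_finsetSum s fun i hi => (hg i hi k).2⟩

variable {D : Set ℂ} {E F : Type*} [NormedAddCommGroup E] [NormedSpace ℝ E] [NormedAddCommGroup F]
  [NormedSpace ℝ F] {Γ : OrientedBoundary D} {J : 𝕆} {g g' : 𝕆 → 𝕆 → E}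

theorem Integrable.of_continuousOn (hJ : J ∈ imagUnits)
    (hg : ContinuousOn (fun p : ℂ × ℂ => g (slice J p.1) (slice J p.2)) (frontier D ×ˢ univ)) :
    Γ.Integrable J g := fun k => by
  have h := intervalIntegrable_curve (Γ.contDiffOn k)
    (F := fun p : ℂ × ℂ => g (slice J p.1) (slice J (-(p.2 * Complex.I)))) (hg.comp
      (f := fun p : ℂ × ℂ => (p.1, -(p.2 * Complex.I))) (by fun_prop)
      fun p hp => ⟨Γ.image_subset k hp.1, mem_univ _⟩)
  exact h.congr fun t _ => (integrand_eq Γ hJ g k t).symm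

theorem integral_congr (hJ : J ∈ imagUnits)
    (h : ∀ z ∈ frontier D, ∀ w : ℂ, g (slice J z) (slice J w) = g' (slice J z) (slice J w)) :
    Γ.integral J g = Γ.integral J g' := by
  refine Finset.sum_congr rfl fun k _ => intervalIntegral.integral_congr fun t ht => ?_
  rw [uIcc_of_le zero_le_one] at ht
  simp only [integrand_eq Γ hJ]
  exact h _ (Γ.image_subset k (mem_image_of_mem _ ht)) _

theorem integral_add (hg : Γ.Integrable J g) (hg' : Γ.Integrable J g') :
    Γ.integral J (fun s ds => g s ds + g' s ds) = Γ.integral J g + Γ.integral J g' := by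
  rw [integral, integral, integral, ← Finset.sum_add_distrib]
  exact Finset.sum_congr rfl fun k _ => intervalIntegral.integral_add (hg k) (hg' k)

theorem integral_sub (hg : Γ.Integrable J g) (hg' : Γ.Integrable J g') :
    Γ.integral J (fun s ds => g s ds - g' s ds) = Γ.integral J g - Γ.integral J g' := by
  rw [integral, integral, integral, ← Finset.sum_sub_distrib]
  exact Finset.sum_congr rfl fun k _ => intervalIntegral.integral_sub (hg k) (hg' k)

theorem integral_sum {ι : Type*} (s : Finset ι) {g : ι → 𝕆 → 𝕆 → E}
    (hg : ∀ i ∈ s, Γ.Integrable J (g i)) :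
    Γ.integral J (fun q dq => ∑ i ∈ s, g i q dq) = ∑ i ∈ s, Γ.integral J (g i) := by
  simp only [integral]
  rw [Finset.sum_comm]
  exact Finset.sum_congr rfl fun k _ => intervalIntegral.integral_finsetSum fun i hi => hg i hi k

theorem _root_.ContinuousLinearMap.map_boundaryIntegral [CompleteSpace E] [CompleteSpace F]
    (L : E →L[ℝ] F) (hg : Γ.Integrable J g) :
    L (Γ.integral J g) = Γ.integral J fun s ds => L (g s ds) := by
  rw [integral, map_sum]
  exact Finset.sum_congr rfl fun k _ => (L.intervalIntegral_comp_comm (hg k)).symm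

theorem Integrable.clm_comp (hg : Γ.Integrable J g) (L : E →L[ℝ] F) :
    Γ.Integrable J fun s ds => L (g s ds) := fun k =>
  ⟨L.integrable_comp (hg k).1, L.integrable_comp (hg k).2⟩

theorem Integrable.apply {G : 𝕆 → 𝕆 → E →L[ℝ] F} (hG : Γ.Integrable J G) (x : E) :
    Γ.Integrable J fun s ds => G s ds x :=
  hG.clm_comp (ContinuousLinearMap.apply ℝ F x)

theorem integral_apply [CompleteSpace F] {G : 𝕆 → 𝕆 → E →L[ℝ] F} (hG : Γ.Integrable J G) (x : E) :
    Γ.integral J G x = Γ.integral J fun s ds => G s ds x :=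
  (ContinuousLinearMap.apply ℝ F x).map_boundaryIntegral hG

/-- Integrals of real parts of holomorphic differential forms. -/
theorem integral_eq_re (hJ : J ∈ imagUnits) {g : 𝕆 → 𝕆 → ℝ} {f : ℂ → ℂ}
    (hf : ContinuousOn f (frontier D))
    (h : ∀ z ∈ frontier D, ∀ w : ℂ, g (slice J z) (slice J w) = (f z * w).re) :
    Γ.integral J g =
      (-Complex.I * ∑ k, ∫ t in (0 : ℝ)..1, f (Γ.γ k t) * deriv (Γ.γ k) t).re := by
  rw [Finset.mul_sum, Complex.re_sum]
  refine Finset.sum_congr rfl fun k _ => ?_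
  have hi : IntervalIntegrable (fun t => f (Γ.γ k t) * deriv (Γ.γ k) t) volume 0 1 :=
    intervalIntegrable_curve (Γ.contDiffOn k) (F := fun p : ℂ × ℂ => f p.1 * p.2)
      ((hf.comp continuousOn_fst fun p hp => Γ.image_subset k hp.1).mul continuousOn_snd)
  have h1 := (Complex.reCLM).intervalIntegral_comp_comm (hi.const_mul (-Complex.I))
  rw [intervalIntegral.integral_const_mul] at h1
  rw [← Complex.reCLM_apply, ← h1]
  refine intervalIntegral.integral_congr fun t ht => ?_
  rw [uIcc_of_le zero_le_one] at ht
  simp only [integrand_eq Γ hJ, h _ (Γ.image_subset k (mem_image_of_mem _ ht)), Complex.reCLM_apply]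
  congr 1
  ring

end OrientedBoundary

/-! ### Operator-valued integrals and continuity of the operator products -/

section OperatorIntegrals

variable {V : Type*} [NormedAddCommGroup V] [NormedSpace ℝ V] [NormedOctonionBimodule V]
  {D : Set ℂ} {Γ : OrientedBoundary D} {J : 𝕆} {g : 𝕆 → 𝕆 → V →L[ℝ] V}

theorem IsParaLinear.boundaryIntegral [CompleteSpace V] (hJ : J ∈ imagUnits) (hg : Γ.Integrable J g)
    (h : ∀ z ∈ frontier D, ∀ w : ℂ, IsParaLinear (g (slice J z) (slice J w))) :
    IsParaLinear (Γ.integral J g) := .of_map_rmul fun v hv p => by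
  rw [OrientedBoundary.integral_apply hg, OrientedBoundary.integral_apply hg,
    (rmul p).map_boundaryIntegral (hg.apply v)]
  exact OrientedBoundary.integral_congr hJ fun z hz w => (h z hz w).map_rmul hv p

theorem continuous_extOp : Continuous (extOp : (V →L[ℝ] V) → V →L[ℝ] V) :=
  continuous_finsetSum _ fun _ _ =>
    continuous_const.clm_comp (continuous_id.clm_comp continuous_const)

theorem continuous_lifOp : Continuous (lifOp : (V →L[ℝ] V) → V →L[ℝ] V) :=
  continuous_finsetSum _ fun _ _ =>
    continuous_const.clm_comp (continuous_const.clm_comp (continuous_id.clm_comp continuous_const))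

theorem continuous_secondAssoc :
    Continuous fun a : 𝕆 × (V →L[ℝ] V) => secondAssoc a.1 a.2 :=
  ((continuous_rmul.comp continuous_fst).clm_comp continuous_snd).sub
    (continuous_snd.clm_comp (continuous_rmul.comp continuous_fst))

theorem continuous_odotR : Continuous fun a : 𝕆 × (V →L[ℝ] V) => odotR a.2 a.1 :=
  (continuous_snd.clm_comp (continuous_lmul.comp continuous_fst)).sub continuous_secondAssoc

theorem continuous_odotL : Continuous fun a : 𝕆 × (V →L[ℝ] V) => odotL a.1 a.2 :=
  ((continuous_lmul.comp continuous_fst).clm_comp continuous_snd).add continuous_secondAssoc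

end OperatorIntegrals

/-! ### Independence of the admissible domain -/

section Continuity

variable {V : Type*} [NormedAddCommGroup V] [NormedSpace ℝ V] [NormedOctonionBimodule V]
  {X : Type*} [TopologicalSpace X] {s : Set X} {A : X → V →L[ℝ] V} {p q : X → 𝕆}

theorem _root_.ContinuousOn.omul (hp : ContinuousOn p s) (hq : ContinuousOn q s) :
    ContinuousOn (fun x => p x * q x) s := by
  have h := Continuous.comp_continuousOn continuous_omul (hp.prodMk hq)
  exact h

theorem _root_.ContinuousOn.odotR (hA : ContinuousOn A s) (hp : ContinuousOn p s) :
    ContinuousOn (fun x => odotR (A x) (p x)) s :=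
  continuous_odotR.comp_continuousOn (hp.prodMk hA)

theorem _root_.ContinuousOn.odotL (hp : ContinuousOn p s) (hA : ContinuousOn A s) :
    ContinuousOn (fun x => odotL (p x) (A x)) s := by
  have h := Continuous.comp_continuousOn continuous_odotL (hp.prodMk hA)
  exact h

theorem _root_.ContinuousOn.rmul {v : X → V} (hp : ContinuousOn p s) (hv : ContinuousOn v s) :
    ContinuousOn (fun x => rmul (p x) (v x)) s :=
  (continuous_rmul.comp_continuousOn hp).clm_apply hv

end Continuity

/-! ### Slices and boundaries of admissible domains -/

section AdmissibleDomains

variable {U W : Set 𝕆} {J : 𝕆}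

theorem IsAdmissibleDomain.notMem_of_mem_frontier (hU : IsAdmissibleDomain U) (hJ : J ∈ imagUnits)
    {z : ℂ} (hz : z ∈ frontier (slice J ⁻¹' U)) : slice J z ∉ U := fun h =>
  hz.2 ((hU.slice_isOpen J hJ).interior_eq.symm ▸ h)

theorem closure_slice_preimage_subset (hUW : closure U ⊆ W) (J : 𝕆) :
    closure (slice J ⁻¹' U) ⊆ slice J ⁻¹' W :=
  ((continuous_slice J).closure_preimage_subset U).trans (preimage_mono hUW)

theorem frontier_slice_preimage_subset (hUW : closure U ⊆ W) (J : 𝕆) :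
    frontier (slice J ⁻¹' U) ⊆ slice J ⁻¹' W :=
  frontier_subset_closure.trans (closure_slice_preimage_subset hUW J)

theorem IsAdmissibleDomain.isBounded_slice (hU : IsAdmissibleDomain U) (hJ : J ∈ imagUnits) :
    Bornology.IsBounded (slice J ⁻¹' U) := by
  obtain ⟨R, hR⟩ := isBounded_iff_forall_norm_le.1 hU.bounded
  exact isBounded_iff_forall_norm_le.2 ⟨R, fun z hz => norm_slice hJ z ▸ hR _ hz⟩

theorem continuousOn_comp_slice_fst (hUW : closure U ⊆ W)
    {g : 𝕆 → 𝕆}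
    (hg : ContinuousOn (fun z => g (slice J z)) (slice J ⁻¹' W)) :
    ContinuousOn (fun p : ℂ × ℂ => g (slice J p.1)) (frontier (slice J ⁻¹' U) ×ˢ univ) :=
  hg.comp continuousOn_fst fun _ hp => frontier_slice_preimage_subset hUW J hp.1

theorem continuousOn_slice_snd {s : Set (ℂ × ℂ)} :
    ContinuousOn (fun p : ℂ × ℂ => slice J p.2) s :=
  ((continuous_slice J).comp continuous_snd).continuousOn

end AdmissibleDomains

/-! ### Reduction to scalar contour integrals and Cauchy's theorem -/

section Independence

variable {V : Type*} [NormedAddCommGroup V] [NormedSpace ℝ V] [NormedOctonionBimodule V]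
  {T : V →L[ℝ] V} {J : 𝕆} {U U' W : Set 𝕆} {g : 𝕆 → 𝕆} {c : ℂ → ℂ}

theorem isParaLinear_leftResolvent (T : V →L[ℝ] V) (s : 𝕆) : IsParaLinear (leftResolvent T s) :=
  isParaLinear_extOp _

theorem isParaLinear_rightResolvent (T : V →L[ℝ] V) (s : 𝕆) : IsParaLinear (rightResolvent T s) :=
  isParaLinear_lifOp _

theorem isParaLinear_leftForm (T : V →L[ℝ] V) (g : 𝕆 → 𝕆) (s ds : 𝕆) :
    IsParaLinear (leftForm T g s ds) := (isParaLinear_leftResolvent T s).odotR _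

theorem leftForm_real (T : V →L[ℝ] V) (g : 𝕆 → 𝕆) (s ds : 𝕆) {v : V} (hv : v ∈ realElements V) :
    leftForm T g s ds v = rmul (ds * g s) (resolventInv T s v) := by
  rw [leftForm, (isParaLinear_leftResolvent T s).odotR_real _ hv, leftResolvent, extOp_real _ hv]

theorem isParaLinear_rightForm (T : V →L[ℝ] V) (g : 𝕆 → 𝕆) (s ds : 𝕆) :
    IsParaLinear (rightForm T g s ds) := (isParaLinear_rightResolvent T s).odotL _

/-- For `p` in `ℂ_J`, the real part of `(p ⊙ (R_s - T)^{-⊚})(x)` is that of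
`(R_s - T)⁻¹(x) p`. -/
theorem reOp_rightForm {z : ℂ} (hz : slice J z ∈ pushforwardSliceResolvent T J) {ds : 𝕆}
    (h : g (slice J z) * ds ∈ sliceC J) (x : V) :
    reOp V (rightForm T g (slice J z) ds x) =
      reOp V (rmul (g (slice J z) * ds) (resolventInv T (slice J z) x)) := by
  have h1 := hz.2.2 1 le_rfl x _ h
  rw [pow_one] at h1
  rw [rightForm, (isParaLinear_rightResolvent T _).reOp_odotL, rightResolvent, reOp_lifOp, h1]

variable [CompleteSpace V]

theorem continuousOn_resolventInv {B : Set ℂ} (hB : ∀ z ∈ B, IsUnit (rmul (slice J z) - T)) :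
    ContinuousOn (fun z => resolventInv T (slice J z)) B := fun z hz =>
  (contDiffAt_resolventInv T (hB z hz)).continuousAt.continuousWithinAt

theorem OrientedBoundary.resolvent_integral_congr (Γ : OrientedBoundary (slice J ⁻¹' U))
    (Γ' : OrientedBoundary (slice J ⁻¹' U')) (hJ : J ∈ imagUnits) (hU : IsAdmissibleDomain U)
    (hU' : IsAdmissibleDomain U') (hUW : closure U ⊆ W) (hUW' : closure U' ⊆ W)
    (hW : IsOpen (slice J ⁻¹' W)) (hc : ContDiffOn ℝ 1 c (slice J ⁻¹' W))
    (hc' : ∀ z ∈ slice J ⁻¹' W, dbar c z = 0) (Φ : V →L[ℝ] ℂ) (x : V)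
    (hu : ∀ z : ℂ, slice J z ∉ U ∨ slice J z ∉ U' → IsUnit (rmul (slice J z) - T))
    (hd : ∀ z : ℂ, slice J z ∉ U ∨ slice J z ∉ U' →
      dbar (fun z => Φ (resolventInv T (slice J z) x)) z = 0) :
    ∑ k, ∫ t in (0 : ℝ)..1, (Φ (resolventInv T (slice J (Γ.γ k t)) x) * c (Γ.γ k t)) *
        deriv (Γ.γ k) t =
      ∑ k, ∫ t in (0 : ℝ)..1, (Φ (resolventInv T (slice J (Γ'.γ k t)) x) * c (Γ'.γ k t)) *
        deriv (Γ'.γ k) t := by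
  have hΦ : ∀ z : ℂ, IsUnit (rmul (slice J z) - T) →
      ContDiffAt ℝ 1 (fun z => Φ (resolventInv T (slice J z) x)) z := fun z hz =>
    (Φ.comp (ContinuousLinearMap.apply ℝ V x)).contDiff.contDiffAt.comp z
      (contDiffAt_resolventInv T hz)
  have hK : ∀ z ∈ (closure (slice J ⁻¹' U) ∪ closure (slice J ⁻¹' U')) \
      (slice J ⁻¹' U ∩ slice J ⁻¹' U'), (slice J z ∉ U ∨ slice J z ∉ U') ∧ slice J z ∈ W := by
    intro z hz
    refine ⟨not_and_or.1 hz.2, ?_⟩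
    exact hz.1.elim (closure_slice_preimage_subset hUW J ·)
      (closure_slice_preimage_subset hUW' J ·)
  -- The integrand is smooth on the open set where the resolvent exists inside `W`; this contains
  -- every point of the two closures that lies off one of the domains.
  refine Γ.sum_integral_congr Γ' (hU.slice_isOpen J hJ) (hU'.slice_isOpen J hJ)
    (hU.isBounded_slice hJ) (hU'.isBounded_slice hJ) ((isOpen_isUnit_slice T J).inter hW)
    (f := fun z => Φ (resolventInv T (slice J z) x) * c z) ?_
    (fun z hz => ⟨hu z (hK z hz).1, (hK z hz).2⟩) fun z hz => ?_
  · exact fun z hz => (hΦ z hz.1).contDiffWithinAt.mul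
      ((hc z hz.2).mono inter_subset_right)
  · rw [dbar_mul ((hΦ z (hu z (hK z hz).1)).differentiableAt one_ne_zero)
      ((hc.contDiffAt (hW.mem_nhds (hK z hz).2)).differentiableAt one_ne_zero), hd z (hK z hz).1,
      hc' z (hK z hz).2, zero_mul, mul_zero, add_zero]

/-! The left calculus -/

theorem IsLeftAdmissible.continuousOn_resolventInv (hU : IsLeftAdmissible T U) (hJ : J ∈ imagUnits)
    (Γ : OrientedBoundary (slice J ⁻¹' U)) :
    ContinuousOn (fun z => resolventInv T (slice J z)) (frontier (slice J ⁻¹' U)) :=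
  OctonionCalculus.continuousOn_resolventInv fun _ hz =>
    (mem_pullbackSliceResolvent hJ hU Γ (hU.1.notMem_of_mem_frontier hJ hz)).2.1

theorem IsLeftAdmissible.continuousOn_leftResolvent (hU : IsLeftAdmissible T U)
    (hJ : J ∈ imagUnits) (Γ : OrientedBoundary (slice J ⁻¹' U)) :
    ContinuousOn (fun p : ℂ × ℂ => leftResolvent T (slice J p.1))
      (frontier (slice J ⁻¹' U) ×ˢ univ) :=
  continuous_extOp.comp_continuousOn
    ((hU.continuousOn_resolventInv hJ Γ).comp continuousOn_fst fun _ hp => hp.1)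

theorem IsLeftAdmissible.integrable_leftForm (hU : IsLeftAdmissible T U) (hJ : J ∈ imagUnits)
    (hUW : closure U ⊆ W) (Γ : OrientedBoundary (slice J ⁻¹' U))
    (hg : ContinuousOn (fun z => g (slice J z)) (slice J ⁻¹' W)) :
    Γ.Integrable J (leftForm T g) :=
  .of_continuousOn hJ ((hU.continuousOn_leftResolvent hJ Γ).odotR
    (continuousOn_slice_snd.omul (continuousOn_comp_slice_fst hUW hg)))

/-- On a real `v` the form is `S(v) (ds g(s))`. Since `Φ` is linear over the slice and `φ = Re Φ`,
the integral becomes the real part of a contour integral, with `ds_J = -i dz`. -/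
theorem IsLeftAdmissible.functional_integral_leftForm (hU : IsLeftAdmissible T U)
    (hJ : J ∈ imagUnits) (hUW : closure U ⊆ W) (Γ : OrientedBoundary (slice J ⁻¹' U))
    (hc : ContinuousOn c (slice J ⁻¹' W)) (hg : ∀ z : ℂ, slice J z ∈ W → g (slice J z) = slice J (c z))
    (φ : V →L[ℝ] ℝ) {v : V} (hv : v ∈ realElements V) :
    φ (Γ.integral J (leftForm T g) v) = (-Complex.I * ∑ k, ∫ t in (0 : ℝ)..1,
      (complexFunctional J φ (resolventInv T (slice J (Γ.γ k t)) v) * c (Γ.γ k t)) *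
        deriv (Γ.γ k) t).re := by
  have hi : Γ.Integrable J (leftForm T g) := hU.integrable_leftForm hJ hUW Γ
    (((continuous_slice J).comp_continuousOn hc).congr fun z hz => hg z hz)
  rw [OrientedBoundary.integral_apply hi, φ.map_boundaryIntegral (hi.apply v)]
  refine OrientedBoundary.integral_eq_re hJ
    (f := fun z => complexFunctional J φ (resolventInv T (slice J z) v) * c z)
    (((complexFunctional J φ).continuous.comp_continuousOn
      ((hU.continuousOn_resolventInv hJ Γ).clm_apply continuousOn_const)).mul
      (hc.mono (frontier_slice_preimage_subset hUW J))) fun z hz w => ?_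
  rw [leftForm_real T g _ _ hv, hg z (frontier_slice_preimage_subset hUW J hz),
    ← complexFunctional_re J φ, slice_mul hJ, complexFunctional_rmul hJ]
  congr 1
  ring

/-- Para-linear operators are compared on `Re V`, and vectors by continuous functionals; what
remains is Cauchy's theorem for scalar integrals. -/
theorem IsLeftAdmissible.integral_leftForm_congr (hU : IsLeftAdmissible T U)
    (hU' : IsLeftAdmissible T U') (hJ : J ∈ imagUnits) (hUW : closure U ⊆ W)
    (hUW' : closure U' ⊆ W) (Γ : OrientedBoundary (slice J ⁻¹' U))
    (Γ' : OrientedBoundary (slice J ⁻¹' U')) (hW : IsOpen (slice J ⁻¹' W))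
    (hc : ContDiffOn ℝ 1 c (slice J ⁻¹' W)) (hc' : ∀ z ∈ slice J ⁻¹' W, dbar c z = 0)
    (hg : ∀ z : ℂ, slice J z ∈ W → g (slice J z) = slice J (c z)) :
    Γ.integral J (leftForm T g) = Γ'.integral J (leftForm T g) := by
  have hgc : ContinuousOn (fun z => g (slice J z)) (slice J ⁻¹' W) :=
    ((continuous_slice J).comp_continuousOn hc.continuousOn).congr fun z hz => hg z hz
  have hmem : ∀ z : ℂ, slice J z ∉ U ∨ slice J z ∉ U' → slice J z ∈ pullbackSliceResolvent T J :=
    fun z hz => hz.elim (mem_pullbackSliceResolvent hJ hU Γ) (mem_pullbackSliceResolvent hJ hU' Γ')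
  refine (IsParaLinear.boundaryIntegral hJ (hU.integrable_leftForm hJ hUW Γ hgc)
    fun _ _ _ => isParaLinear_leftForm T g _ _).ext_real (IsParaLinear.boundaryIntegral hJ
    (hU'.integrable_leftForm hJ hUW' Γ' hgc) fun _ _ _ => isParaLinear_leftForm T g _ _)
    fun v hv => (SeparatingDual.eq_iff_forall_dual_eq (R := ℝ)).2 fun φ => ?_
  rw [hU.functional_integral_leftForm hJ hUW Γ hc.continuousOn hg φ hv,
    hU'.functional_integral_leftForm hJ hUW' Γ' hc.continuousOn hg φ hv,
    Γ.resolvent_integral_congr Γ' hJ hU.1 hU'.1 hUW hUW' hW hc hc' _ v (fun z hz => (hmem z hz).2.1)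
      fun z hz => dbar_resolventInv_left hJ φ hv (hmem z hz)]

theorem IsLeftAdmissible.leftCalculus₀_eq (hU : IsLeftAdmissible T U) (hJ : J ∈ imagUnits)
    (hUW : closure U ⊆ W) (Γ : OrientedBoundary (slice J ⁻¹' U)) (hW : IsOpen (slice J ⁻¹' W))
    (hc : ContDiffOn ℝ 1 c (slice J ⁻¹' W)) (hc' : ∀ z ∈ slice J ⁻¹' W, dbar c z = 0)
    (hg : ∀ z : ℂ, slice J z ∈ W → g (slice J z) = slice J (c z)) :
    leftCalculus₀ T W g J = (2 * π)⁻¹ • Γ.integral J (leftForm T g) := by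
  have h : ∃ U : Set 𝕆, IsLeftAdmissible T U ∧ closure U ⊆ W ∧
      Nonempty (OrientedBoundary (slice J ⁻¹' U)) := ⟨U, hU, hUW, ⟨Γ⟩⟩
  rw [leftCalculus₀, dif_pos h, h.choose_spec.1.integral_leftForm_congr hU hJ h.choose_spec.2.1 hUW
    _ Γ hW hc hc' hg]

/-! The right calculus -/

theorem IsRightAdmissible.continuousOn_resolventInv (hU : IsRightAdmissible T U)
    (hJ : J ∈ imagUnits) (Γ : OrientedBoundary (slice J ⁻¹' U)) :
    ContinuousOn (fun z => resolventInv T (slice J z)) (frontier (slice J ⁻¹' U)) :=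
  OctonionCalculus.continuousOn_resolventInv fun _ hz =>
    (mem_pushforwardSliceResolvent hJ hU Γ (hU.1.notMem_of_mem_frontier hJ hz)).2.1

theorem IsRightAdmissible.continuousOn_rightResolvent (hU : IsRightAdmissible T U)
    (hJ : J ∈ imagUnits) (Γ : OrientedBoundary (slice J ⁻¹' U)) :
    ContinuousOn (fun p : ℂ × ℂ => rightResolvent T (slice J p.1))
      (frontier (slice J ⁻¹' U) ×ˢ univ) :=
  continuous_lifOp.comp_continuousOn
    ((hU.continuousOn_resolventInv hJ Γ).comp continuousOn_fst fun _ hp => hp.1)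

theorem IsRightAdmissible.integrable_rightForm (hU : IsRightAdmissible T U) (hJ : J ∈ imagUnits)
    (hUW : closure U ⊆ W) (Γ : OrientedBoundary (slice J ⁻¹' U))
    (hg : ContinuousOn (fun z => g (slice J z)) (slice J ⁻¹' W)) :
    Γ.Integrable J (rightForm T g) :=
  .of_continuousOn hJ (((continuousOn_comp_slice_fst hUW hg).omul continuousOn_slice_snd).odotL
    (hU.continuousOn_rightResolvent hJ Γ))

theorem IsRightAdmissible.functional_integral_rightForm (hU : IsRightAdmissible T U)
    (hJ : J ∈ imagUnits) (hUW : closure U ⊆ W) (Γ : OrientedBoundary (slice J ⁻¹' U))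
    (hc : ContinuousOn c (slice J ⁻¹' W)) (hg : ∀ z : ℂ, slice J z ∈ W → g (slice J z) = slice J (c z))
    (φ : V →L[ℝ] ℝ) (x : V) :
    φ (reOp V (Γ.integral J (rightForm T g) x)) = (-Complex.I * ∑ k, ∫ t in (0 : ℝ)..1,
      (complexFunctional J (φ.comp (reOp V)) (resolventInv T (slice J (Γ.γ k t)) x) *
        c (Γ.γ k t)) * deriv (Γ.γ k) t).re := by
  have hi : Γ.Integrable J (rightForm T g) := hU.integrable_rightForm hJ hUW Γ
    (((continuous_slice J).comp_continuousOn hc).congr fun z hz => hg z hz)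
  rw [OrientedBoundary.integral_apply hi, ← ContinuousLinearMap.comp_apply,
    (φ.comp (reOp V)).map_boundaryIntegral (hi.apply x)]
  refine OrientedBoundary.integral_eq_re hJ (f := fun z =>
    complexFunctional J (φ.comp (reOp V)) (resolventInv T (slice J z) x) * c z)
    (((complexFunctional J (φ.comp (reOp V))).continuous.comp_continuousOn
      ((hU.continuousOn_resolventInv hJ Γ).clm_apply continuousOn_const)).mul
      (hc.mono (frontier_slice_preimage_subset hUW J))) fun z hz w => ?_
  have h1 := hg z (frontier_slice_preimage_subset hUW J hz)
  rw [ContinuousLinearMap.comp_apply, reOp_rightForm (mem_pushforwardSliceResolvent hJ hU Γ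
      (hU.1.notMem_of_mem_frontier hJ hz)) (by rw [h1, slice_mul hJ]; exact mem_range_self _),
    ← ContinuousLinearMap.comp_apply, ← complexFunctional_re J (φ.comp (reOp V)), h1, slice_mul hJ,
    complexFunctional_rmul hJ]
  congr 1
  ring

/-- The right-hand counterpart: para-linear operators are now compared through their real parts at
all `x`, which is where liftability gives holomorphy. -/
theorem IsRightAdmissible.integral_rightForm_congr (hU : IsRightAdmissible T U)
    (hU' : IsRightAdmissible T U') (hJ : J ∈ imagUnits) (hUW : closure U ⊆ W)
    (hUW' : closure U' ⊆ W) (Γ : OrientedBoundary (slice J ⁻¹' U))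
    (Γ' : OrientedBoundary (slice J ⁻¹' U')) (hW : IsOpen (slice J ⁻¹' W))
    (hc : ContDiffOn ℝ 1 c (slice J ⁻¹' W)) (hc' : ∀ z ∈ slice J ⁻¹' W, dbar c z = 0)
    (hg : ∀ z : ℂ, slice J z ∈ W → g (slice J z) = slice J (c z)) :
    Γ.integral J (rightForm T g) = Γ'.integral J (rightForm T g) := by
  have hgc : ContinuousOn (fun z => g (slice J z)) (slice J ⁻¹' W) :=
    ((continuous_slice J).comp_continuousOn hc.continuousOn).congr fun z hz => hg z hz
  have hmem : ∀ z : ℂ, slice J z ∉ U ∨ slice J z ∉ U' →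
      slice J z ∈ pushforwardSliceResolvent T J := fun z hz =>
    hz.elim (mem_pushforwardSliceResolvent hJ hU Γ) (mem_pushforwardSliceResolvent hJ hU' Γ')
  refine (IsParaLinear.boundaryIntegral hJ (hU.integrable_rightForm hJ hUW Γ hgc)
    fun _ _ _ => isParaLinear_rightForm T g _ _).ext_reOp (IsParaLinear.boundaryIntegral hJ
    (hU'.integrable_rightForm hJ hUW' Γ' hgc) fun _ _ _ => isParaLinear_rightForm T g _ _)
    fun x => (SeparatingDual.eq_iff_forall_dual_eq (R := ℝ)).2 fun φ => ?_
  rw [hU.functional_integral_rightForm hJ hUW Γ hc.continuousOn hg φ x,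
    hU'.functional_integral_rightForm hJ hUW' Γ' hc.continuousOn hg φ x,
    Γ.resolvent_integral_congr Γ' hJ hU.1 hU'.1 hUW hUW' hW hc hc' _ x (fun z hz => (hmem z hz).2.1)
      fun z hz => dbar_resolventInv_right hJ φ x (hmem z hz)]

theorem IsRightAdmissible.rightCalculus₀_eq (hU : IsRightAdmissible T U) (hJ : J ∈ imagUnits)
    (hUW : closure U ⊆ W) (Γ : OrientedBoundary (slice J ⁻¹' U)) (hW : IsOpen (slice J ⁻¹' W))
    (hc : ContDiffOn ℝ 1 c (slice J ⁻¹' W)) (hc' : ∀ z ∈ slice J ⁻¹' W, dbar c z = 0)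
    (hg : ∀ z : ℂ, slice J z ∈ W → g (slice J z) = slice J (c z)) :
    rightCalculus₀ T W g J = (2 * π)⁻¹ • Γ.integral J (rightForm T g) := by
  have h : ∃ U : Set 𝕆, IsRightAdmissible T U ∧ closure U ⊆ W ∧
      Nonempty (OrientedBoundary (slice J ⁻¹' U)) := ⟨U, hU, hUW, ⟨Γ⟩⟩
  rw [rightCalculus₀, dif_pos h, h.choose_spec.1.integral_rightForm_congr hU hJ h.choose_spec.2.1
    hUW _ Γ hW hc hc' hg]

end Independence

/-! ### The calculi -/

section Products

variable {J : 𝕆}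

theorem slice_mul_assoc (hJ : J ∈ imagUnits) (z w : ℂ) (x : 𝕆) :
    (slice J z * slice J w) * x = slice J z * (slice J w * x) := by
  rw [slice_mul hJ]
  simp only [slice, oadd_mul, osmul_mul, oone_mul, omul_add, omul_smul, imag_mul_imag_mul hJ,
    Complex.mul_re, Complex.mul_im]
  module

theorem mul_slice_assoc (hJ : J ∈ imagUnits) (z w : ℂ) (x : 𝕆) :
    (x * slice J z) * slice J w = x * (slice J z * slice J w) := by
  rw [slice_mul hJ]
  simp only [slice, oadd_mul, osmul_mul, omul_one, omul_add, omul_smul, mul_imag_mul_imag hJ,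
    Complex.mul_re, Complex.mul_im]
  module

theorem map_one_of_map_mul {τ : 𝕆 ≃ₗ[ℝ] 𝕆} (hτ : ∀ x y, τ (x * y) = τ x * τ y) : τ 1 = 1 := by
  have h := hτ 1 (τ.symm 1)
  rw [oone_mul, τ.apply_symm_apply, omul_one] at h
  exact h.symm

end Products

/-! ### Bilinearity of the operator products and finite sums of forms -/

section Bilinear

variable (V : Type*) [NormedAddCommGroup V] [NormedSpace ℝ V] [NormedOctonionBimodule V]

/-- `f ⊙ p` as a bilinear function of `p` and `f`. -/
noncomputable def odotRₗ : 𝕆 →ₗ[ℝ] (V →L[ℝ] V) →ₗ[ℝ] (V →L[ℝ] V) :=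
  LinearMap.mk₂ ℝ (fun p A => odotR A p)
    (fun p q A => by ext x; simp [odotR, secondAssoc, lmul_add, rmul_add]; module)
    (fun c p A => by ext x; simp [odotR, secondAssoc, lmul_smul, rmul_smul]; module)
    (fun p A B => by ext x; simp [odotR, secondAssoc]; module)
    (fun c p A => by ext x; simp [odotR, secondAssoc]; module)

/-- `p ⊙ f` as a bilinear function of `p` and `f`. -/
noncomputable def odotLₗ : 𝕆 →ₗ[ℝ] (V →L[ℝ] V) →ₗ[ℝ] (V →L[ℝ] V) :=
  LinearMap.mk₂ ℝ (fun p A => odotL p A)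
    (fun p q A => by ext x; simp [odotL, secondAssoc, lmul_add, rmul_add]; module)
    (fun c p A => by ext x; simp [odotL, secondAssoc, lmul_smul, rmul_smul]; module)
    (fun p A B => by ext x; simp [odotL, secondAssoc]; module)
    (fun c p A => by ext x; simp [odotL, secondAssoc]; module)

variable {V}

theorem odotRₗ_apply (p : 𝕆) (A : V →L[ℝ] V) : odotRₗ V p A = odotR A p := rfl

theorem odotLₗ_apply (p : 𝕆) (A : V →L[ℝ] V) : odotLₗ V p A = odotL p A := rfl

theorem odotR_one (A : V →L[ℝ] V) : odotR A 1 = A := by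
  ext x; simp [odotR, secondAssoc, lmul_one, rmul_one]

theorem one_odotL (A : V →L[ℝ] V) : odotL 1 A = A := by
  ext x; simp [odotL, secondAssoc, lmul_one, rmul_one]

theorem sum_smul_odotR (A : V →L[ℝ] V) (p : 𝕆) : ∑ j, p j • odotR A (e j) = odotR A p := by
  conv_rhs => rw [← sum_smul_e p, ← odotRₗ_apply, map_sum]
  simp [LinearMap.sum_apply, odotRₗ_apply]

theorem sum_smul_odotL (A : V →L[ℝ] V) (p : 𝕆) : ∑ j, p j • odotL (e j) A = odotL p A := by
  conv_rhs => rw [← sum_smul_e p, ← odotLₗ_apply, map_sum]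
  simp [LinearMap.sum_apply, odotLₗ_apply]

theorem leftForm_add (T : V →L[ℝ] V) (f g : 𝕆 → 𝕆) (s ds : 𝕆) :
    leftForm T (fun q => f q + g q) s ds = leftForm T f s ds + leftForm T g s ds := by
  simp only [leftForm, omul_add, ← odotRₗ_apply, map_add, LinearMap.add_apply]

theorem leftForm_smul (T : V →L[ℝ] V) (a : ℝ) (f : 𝕆 → 𝕆) (s ds : 𝕆) :
    leftForm T (fun q => a • f q) s ds = a • leftForm T f s ds := by
  simp only [leftForm, omul_smul, ← odotRₗ_apply, map_smul, LinearMap.smul_apply]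

theorem leftForm_sum {ι : Type*} (t : Finset ι) (T : V →L[ℝ] V) (f : ι → 𝕆 → 𝕆) (s ds : 𝕆) :
    leftForm T (fun q => ∑ i ∈ t, f i q) s ds = ∑ i ∈ t, leftForm T (f i) s ds := by
  simp only [leftForm, omul_sum, ← odotRₗ_apply, map_sum, LinearMap.sum_apply]

theorem rightForm_add (T : V →L[ℝ] V) (f g : 𝕆 → 𝕆) (s ds : 𝕆) :
    rightForm T (fun q => f q + g q) s ds = rightForm T f s ds + rightForm T g s ds := by
  simp only [rightForm, oadd_mul, ← odotLₗ_apply, map_add, LinearMap.add_apply]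

theorem rightForm_smul (T : V →L[ℝ] V) (a : ℝ) (f : 𝕆 → 𝕆) (s ds : 𝕆) :
    rightForm T (fun q => a • f q) s ds = a • rightForm T f s ds := by
  simp only [rightForm, osmul_mul, ← odotLₗ_apply, map_smul, LinearMap.smul_apply]

theorem rightForm_sum {ι : Type*} (t : Finset ι) (T : V →L[ℝ] V) (f : ι → 𝕆 → 𝕆) (s ds : 𝕆) :
    rightForm T (fun q => ∑ i ∈ t, f i q) s ds = ∑ i ∈ t, rightForm T (f i) s ds := by
  simp only [rightForm, osum_mul, ← odotLₗ_apply, map_sum, LinearMap.sum_apply]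

/-- Expanding `b i` in the basis `e` gives the same double sum on both sides: the integrand does not
depend on the basis used for the expansion. -/
theorem sum_odotR_leftForm (T : V →L[ℝ] V) (b : Fin 8 → 𝕆) (fc : Fin 8 → 𝕆 → 𝕆) (s ds : 𝕆) :
    ∑ j, odotR (leftForm T (fun q => ∑ i, b i j • fc i q) s ds) (e j) =
      ∑ i, odotR (leftForm T (fc i) s ds) (b i) := by
  simp only [leftForm_sum, leftForm_smul, ← sum_smul_odotR _ (b _)]
  simp only [← odotRₗ_apply, map_sum, map_smul]
  exact Finset.sum_comm

theorem sum_odotL_rightForm (T : V →L[ℝ] V) (b : Fin 8 → 𝕆) (fc : Fin 8 → 𝕆 → 𝕆) (s ds : 𝕆) :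
    ∑ j, odotL (e j) (rightForm T (fun q => ∑ i, b i j • fc i q) s ds) =
      ∑ i, odotL (b i) (rightForm T (fc i) s ds) := by
  simp only [rightForm_sum, rightForm_smul, ← sum_smul_odotL _ (b _)]
  simp only [← odotLₗ_apply, map_sum, map_smul]
  exact Finset.sum_comm

theorem sum_odotR_leftForm_slice (T : V →L[ℝ] V) (J : 𝕆) (f₀ f₁ : 𝕆 → 𝕆) (s ds : 𝕆) :
    ∑ j, odotR (leftForm T (fun q => J j • f₁ q + (if j = 0 then (1 : ℝ) else 0) • f₀ q) s ds)
      (e j) = odotR (leftForm T f₁ s ds) J + leftForm T f₀ s ds := by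
  simp only [leftForm_add, leftForm_smul, ← sum_smul_odotR _ J]
  simp only [← odotRₗ_apply, map_add, map_smul, Finset.sum_add_distrib]
  congr 1
  simp [odotRₗ_apply, ← one_def, odotR_one]

theorem sum_odotL_rightForm_slice (T : V →L[ℝ] V) (J : 𝕆) (f₀ f₁ : 𝕆 → 𝕆) (s ds : 𝕆) :
    ∑ j, odotL (e j) (rightForm T (fun q => J j • f₁ q + (if j = 0 then (1 : ℝ) else 0) • f₀ q)
      s ds) = odotL J (rightForm T f₁ s ds) + rightForm T f₀ s ds := by
  simp only [rightForm_add, rightForm_smul, ← sum_smul_odotL _ J]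
  simp only [← odotLₗ_apply, map_add, map_smul, Finset.sum_add_distrib]
  congr 1
  simp [odotLₗ_apply, ← one_def, one_odotL]

end Bilinear

/-! ### The integral formulas for the two calculi -/

section Calculus

variable {V : Type*} [NormedAddCommGroup V] [NormedSpace ℝ V] [NormedOctonionBimodule V]
  [CompleteSpace V] {T : V →L[ℝ] V} {J : 𝕆} {U W : Set 𝕆} {f : 𝕆 → 𝕆} {fc : Fin 8 → 𝕆 → 𝕆}
  {b : Fin 8 → 𝕆}

theorem OrientedBoundary.odotR_integral {D : Set ℂ} {Γ : OrientedBoundary D}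
    {g : 𝕆 → 𝕆 → V →L[ℝ] V} (hg : Γ.Integrable J g) (p : 𝕆) :
    Γ.Integrable J (fun s ds => odotR (g s ds) p) ∧
      odotR (Γ.integral J g) p = Γ.integral J fun s ds => odotR (g s ds) p :=
  let L : (V →L[ℝ] V) →L[ℝ] (V →L[ℝ] V) :=
    ⟨odotRₗ V p, continuous_odotR.comp (continuous_const.prodMk continuous_id)⟩
  ⟨hg.clm_comp L, L.map_boundaryIntegral hg⟩

theorem OrientedBoundary.odotL_integral {D : Set ℂ} {Γ : OrientedBoundary D}
    {g : 𝕆 → 𝕆 → V →L[ℝ] V} (hg : Γ.Integrable J g) (p : 𝕆) :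
    Γ.Integrable J (fun s ds => odotL p (g s ds)) ∧
      odotL p (Γ.integral J g) = Γ.integral J fun s ds => odotL p (g s ds) :=
  let L : (V →L[ℝ] V) →L[ℝ] (V →L[ℝ] V) :=
    ⟨odotLₗ V p, continuous_odotL.comp (continuous_const.prodMk continuous_id)⟩
  ⟨hg.clm_comp L, L.map_boundaryIntegral hg⟩

/-! The left calculus -/

theorem IsLeftExpansion.continuousOn {τ : 𝕆 ≃ₗ[ℝ] 𝕆}
    (h : IsLeftExpansion W (fun i => τ (e i)) fc f) (hW : IsAxiallySymmetric W)
    (hf : IsLeftSliceRegular W f) (hJ : J ∈ imagUnits) (i : Fin 8) :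
    ContinuousOn (fun z => fc i (slice J z)) (slice J ⁻¹' W) :=
  ((continuous_slice J).comp_continuousOn (hf.leftComponent hW hJ τ i).1.continuousOn).congr
    fun _ hz => h.apply_slice hW hJ hz i

theorem IsLeftAdmissible.leftCalculus_eq (hU : IsLeftAdmissible T U) (hJ : J ∈ imagUnits)
    (hUW : closure U ⊆ W) (Γ : OrientedBoundary (slice J ⁻¹' U)) (hW : IsAxiallySymmetric W)
    (hf : IsLeftSliceRegular W f) (h : IsLeftExpansion W e fc f) :
    leftCalculus T W f J =
      (2 * π)⁻¹ • Γ.integral J fun s ds => ∑ j, odotR (leftForm T (fc j) s ds) (e j) := by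
  have hex : ∃ fc, IsLeftExpansion W e fc f := ⟨fc, h⟩
  -- The coefficient chosen in the definition and `fc j` agree on the slice, both being the
  -- component of `f`; this permits passing to any `U`, `Γ` and expansion.
  have key : ∀ j, odotR (leftCalculus₀ T W (hex.choose j) J) (e j) =
      (2 * π)⁻¹ • Γ.integral J fun s ds => odotR (leftForm T (fc j) s ds) (e j) := by
    intro j
    have hr := hf.leftComponent hW hJ (LinearEquiv.refl ℝ 𝕆) j
    have h1 : ∀ z : ℂ, slice J z ∈ W → hex.choose j (slice J z) = _ := fun z hz =>
      IsLeftExpansion.apply_slice (τ := LinearEquiv.refl ℝ 𝕆) hex.choose_spec hW hJ hz j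
    have h2 : ∀ z : ℂ, slice J z ∈ W → fc j (slice J z) = _ := fun z hz =>
      IsLeftExpansion.apply_slice (τ := LinearEquiv.refl ℝ 𝕆) h hW hJ hz j
    have hi := hU.integrable_leftForm hJ hUW Γ
      (IsLeftExpansion.continuousOn (τ := LinearEquiv.refl ℝ 𝕆) h hW hf hJ j)
    rw [hU.leftCalculus₀_eq hJ hUW Γ (hf.1 J hJ) hr.1 hr.2 h1, ← odotRₗ_apply, map_smul,
      odotRₗ_apply, ← (OrientedBoundary.odotR_integral hi _).2]
    congr 2
    refine OrientedBoundary.integral_congr hJ fun z hz w => ?_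
    have hz' := frontier_slice_preimage_subset hUW J hz
    rw [leftForm, leftForm, h1 z hz', h2 z hz']
  rw [leftCalculus, dif_pos hex, Finset.sum_congr rfl fun j _ => key j, ← Finset.smul_sum,
    OrientedBoundary.integral_sum]
  exact fun j _ => (OrientedBoundary.odotR_integral (hU.integrable_leftForm hJ hUW Γ
      (IsLeftExpansion.continuousOn (τ := LinearEquiv.refl ℝ 𝕆) h hW hf hJ j)) _).1

theorem IsLeftAdmissible.integrable_opAssocR (hU : IsLeftAdmissible T U) (hJ : J ∈ imagUnits)
    (hUW : closure U ⊆ W) (Γ : OrientedBoundary (slice J ⁻¹' U)) {g : 𝕆 → 𝕆}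
    (hg : ContinuousOn (fun z => g (slice J z)) (slice J ⁻¹' W)) (q : 𝕆) :
    Γ.Integrable J fun s ds => opAssocR (leftResolvent T s) (ds * g s) q :=
  have hA := hU.continuousOn_leftResolvent hJ Γ
  have hp := continuousOn_slice_snd.omul (continuousOn_comp_slice_fst hUW hg)
  .of_continuousOn hJ (((hA.odotR hp).odotR continuousOn_const).sub
    (hA.odotR (hp.omul continuousOn_const)))

theorem IsLeftAdmissible.leftCalculus_expansion (hU : IsLeftAdmissible T U) (hJ : J ∈ imagUnits)
    (hUW : closure U ⊆ W) (Γ : OrientedBoundary (slice J ⁻¹' U)) (hW : IsAxiallySymmetric W)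
    (hf : IsLeftSliceRegular W f) (hb : IsStandardBasis b) (h : IsLeftExpansion W b fc f) :
    IsParaLinear (leftCalculus T W f J) ∧
    Γ.Integrable J (leftForm T f) ∧
    (∀ i : Fin 7, Γ.Integrable J fun s ds =>
      opAssocR (leftResolvent T s) (ds * fc i.succ s) (b i.succ)) ∧
    leftCalculus T W f J =
      (2 * π)⁻¹ • Γ.integral J (leftForm T f) +
      (2 * π)⁻¹ • ∑ i : Fin 7, Γ.integral J fun s ds =>
        opAssocR (leftResolvent T s) (ds * fc i.succ s) (b i.succ) := by
  obtain ⟨τ, hτ, hbτ⟩ := hb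
  obtain rfl : b = fun i => τ (e i) := funext hbτ
  have hc := h.continuousOn hW hf hJ
  have hi := hU.integrable_leftForm hJ hUW Γ (hf.2 J hJ).1.continuousOn
  have ha := fun i : Fin 7 => hU.integrable_opAssocR hJ hUW Γ (hc i.succ) (τ (e i.succ))
  have hsum := hU.leftCalculus_eq hJ hUW Γ hW hf h.standard
  simp only [sum_odotR_leftForm] at hsum
  refine ⟨?_, hi, ha, ?_⟩
  · rw [hsum, OrientedBoundary.integral_sum _ fun i _ =>
      (OrientedBoundary.odotR_integral (hU.integrable_leftForm hJ hUW Γ (hc i)) _).1]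
    refine IsParaLinear.smul _ (IsParaLinear.sum _ fun i _ => IsParaLinear.boundaryIntegral hJ
      (OrientedBoundary.odotR_integral (hU.integrable_leftForm hJ hUW Γ (hc i)) _).1
      fun z _ w => (isParaLinear_leftForm T _ _ _).odotR _)
  · rw [hsum, ← smul_add, ← OrientedBoundary.integral_sum _ fun i _ => ha i,
      ← OrientedBoundary.integral_add hi]
    · congr 1
      refine OrientedBoundary.integral_congr hJ fun z hz w => ?_
      have hz' := frontier_slice_preimage_subset hUW J hz
      -- The definition of the associator, combined with `(ds f_(i)) b_i = ds (f_(i) b_i)`, which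
      -- holds because `ds` and `f_(i)(s)` lie in `ℂ_J`.
      have h1 : ∀ i, odotR (leftForm T (fc i) (slice J z) (slice J w)) (τ (e i)) =
          odotR (leftResolvent T (slice J z)) (slice J w * (fc i (slice J z) * τ (e i))) +
          opAssocR (leftResolvent T (slice J z)) (slice J w * fc i (slice J z)) (τ (e i)) := by
        intro i
        rw [opAssocR, leftForm, h.apply_slice hW hJ hz' i, slice_mul_assoc hJ, add_sub_cancel]
      -- An automorphism fixes `1`, so `b_0 = 1` has no associator and the correction starts at `i =
      -- 1`.
      have h2 : opAssocR (leftResolvent T (slice J z)) (slice J w * fc 0 (slice J z)) (τ (e 0)) =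
          0 := by
        rw [← one_def, map_one_of_map_mul hτ, opAssocR, odotR_one, omul_one, sub_self]
      rw [Finset.sum_congr rfl fun i _ => h1 i, Finset.sum_add_distrib,
        Fin.sum_univ_succ fun i => opAssocR _ _ _, h2, zero_add, leftForm,
        (isLeftExpansion_iff.1 h).2 _ hz', omul_sum, ← odotRₗ_apply, map_sum, LinearMap.sum_apply]
      rfl
    · exact .sum _ fun i _ => ha i

/-- With `f = f₀ + f₁ J`, the only possible associator is `[R, ds f₁, J]`. It vanishes because `ds
f₁` and `J` both lie in `ℂ_J`, which acts associatively from the right. -/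
theorem IsLeftAdmissible.leftCalculus_inSlice (hU : IsLeftAdmissible T U) (hJ : J ∈ imagUnits)
    (hUW : closure U ⊆ W) (Γ : OrientedBoundary (slice J ⁻¹' U)) (hW : IsAxiallySymmetric W)
    (hf : IsLeftSliceRegular W f) (h : IsInLeftSlice W J f) :
    Γ.Integrable J (leftForm T f) ∧
    leftCalculus T W f J = (2 * π)⁻¹ • Γ.integral J (leftForm T f) ∧
    ∀ v ∈ realElements V,
      Γ.Integrable J (fun s ds => rmul (ds * f s) (resolventInv T s v)) ∧
      leftCalculus T W f J v =
        (2 * π)⁻¹ • Γ.integral J fun s ds => rmul (ds * f s) (resolventInv T s v) := by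
  have hi := hU.integrable_leftForm hJ hUW Γ (hf.2 J hJ).1.continuousOn
  obtain ⟨f₀, f₁, hex, -, h₁, hff⟩ := h.expansion
  obtain ⟨c, hc⟩ := h₁.exists_complex
  have heq : leftCalculus T W f J = (2 * π)⁻¹ • Γ.integral J (leftForm T f) := by
    rw [hU.leftCalculus_eq hJ hUW Γ hW hf hex]
    congr 1
    refine OrientedBoundary.integral_congr hJ fun z hz w => ?_
    have hz' := frontier_slice_preimage_subset hUW J hz
    have h1 := hc J hJ z hz'
    rw [sum_odotR_leftForm_slice, leftForm, leftForm, leftForm, hff _ hz', omul_add,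
      ← odotRₗ_apply (_ + _), map_add, LinearMap.add_apply, odotRₗ_apply, odotRₗ_apply, h1,
      ← slice_mul_assoc hJ, add_comm, (isParaLinear_leftResolvent T _).odotR_odotR]
    intro y
    have h2 := rmul_rmul_slice hJ (w * c z) Complex.I y
    rwa [slice_I, ← slice_mul hJ] at h2
  refine ⟨hi, heq, fun v hv => ?_⟩
  have hv' : (fun s ds => rmul (ds * f s) (resolventInv T s v)) =
      fun s ds => leftForm T f s ds v := by
    funext s ds
    rw [leftForm_real T f s ds hv]
  rw [hv', heq, smul_apply, OrientedBoundary.integral_apply hi]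
  exact ⟨hi.apply v, rfl⟩

/-! The right calculus -/

theorem IsRightExpansion.continuousOn {τ : 𝕆 ≃ₗ[ℝ] 𝕆}
    (h : IsRightExpansion W (fun i => τ (e i)) fc f) (hW : IsAxiallySymmetric W)
    (hf : IsRightSliceRegular W f) (hJ : J ∈ imagUnits) (i : Fin 8) :
    ContinuousOn (fun z => fc i (slice J z)) (slice J ⁻¹' W) :=
  ((continuous_slice J).comp_continuousOn (hf.rightComponent hW hJ τ i).1.continuousOn).congr
    fun _ hz => h.apply_slice hW hJ hz i

theorem IsRightAdmissible.rightCalculus_eq (hU : IsRightAdmissible T U) (hJ : J ∈ imagUnits)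
    (hUW : closure U ⊆ W) (Γ : OrientedBoundary (slice J ⁻¹' U)) (hW : IsAxiallySymmetric W)
    (hf : IsRightSliceRegular W f) (h : IsRightExpansion W e fc f) :
    rightCalculus T W f J =
      (2 * π)⁻¹ • Γ.integral J fun s ds => ∑ j, odotL (e j) (rightForm T (fc j) s ds) := by
  have hex : ∃ fc, IsRightExpansion W e fc f := ⟨fc, h⟩
  have key : ∀ j, odotL (e j) (rightCalculus₀ T W (hex.choose j) J) =
      (2 * π)⁻¹ • Γ.integral J fun s ds => odotL (e j) (rightForm T (fc j) s ds) := by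
    intro j
    have hr := hf.rightComponent hW hJ (LinearEquiv.refl ℝ 𝕆) j
    have h1 : ∀ z : ℂ, slice J z ∈ W → hex.choose j (slice J z) = _ := fun z hz =>
      IsRightExpansion.apply_slice (τ := LinearEquiv.refl ℝ 𝕆) hex.choose_spec hW hJ hz j
    have h2 : ∀ z : ℂ, slice J z ∈ W → fc j (slice J z) = _ := fun z hz =>
      IsRightExpansion.apply_slice (τ := LinearEquiv.refl ℝ 𝕆) h hW hJ hz j
    have hi := hU.integrable_rightForm hJ hUW Γ
      (IsRightExpansion.continuousOn (τ := LinearEquiv.refl ℝ 𝕆) h hW hf hJ j)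
    rw [hU.rightCalculus₀_eq hJ hUW Γ (hf.1 J hJ) hr.1 hr.2 h1, ← odotLₗ_apply, map_smul,
      odotLₗ_apply, ← (OrientedBoundary.odotL_integral hi _).2]
    congr 2
    refine OrientedBoundary.integral_congr hJ fun z hz w => ?_
    have hz' := frontier_slice_preimage_subset hUW J hz
    rw [rightForm, rightForm, h1 z hz', h2 z hz']
  rw [rightCalculus, dif_pos hex, Finset.sum_congr rfl fun j _ => key j, ← Finset.smul_sum,
    OrientedBoundary.integral_sum]
  exact fun j _ => (OrientedBoundary.odotL_integral (hU.integrable_rightForm hJ hUW Γ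
      (IsRightExpansion.continuousOn (τ := LinearEquiv.refl ℝ 𝕆) h hW hf hJ j)) _).1

theorem IsRightAdmissible.integrable_opAssocL (hU : IsRightAdmissible T U) (hJ : J ∈ imagUnits)
    (hUW : closure U ⊆ W) (Γ : OrientedBoundary (slice J ⁻¹' U)) {g : 𝕆 → 𝕆}
    (hg : ContinuousOn (fun z => g (slice J z)) (slice J ⁻¹' W)) (p : 𝕆) :
    Γ.Integrable J fun s ds => opAssocL p (g s * ds) (rightResolvent T s) :=
  have hA := hU.continuousOn_rightResolvent hJ Γ
  have hp := (continuousOn_comp_slice_fst hUW hg).omul continuousOn_slice_snd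
  .of_continuousOn hJ (((continuousOn_const.omul hp).odotL hA).sub
    (continuousOn_const.odotL (hp.odotL hA)))

theorem IsRightAdmissible.rightCalculus_expansion (hU : IsRightAdmissible T U) (hJ : J ∈ imagUnits)
    (hUW : closure U ⊆ W) (Γ : OrientedBoundary (slice J ⁻¹' U)) (hW : IsAxiallySymmetric W)
    (hf : IsRightSliceRegular W f) (hb : IsStandardBasis b) (h : IsRightExpansion W b fc f) :
    IsParaLinear (rightCalculus T W f J) ∧
    Γ.Integrable J (rightForm T f) ∧
    (∀ i : Fin 7, Γ.Integrable J fun s ds =>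
      opAssocL (b i.succ) (fc i.succ s * ds) (rightResolvent T s)) ∧
    rightCalculus T W f J =
      (2 * π)⁻¹ • Γ.integral J (rightForm T f) -
      (2 * π)⁻¹ • ∑ i : Fin 7, Γ.integral J fun s ds =>
        opAssocL (b i.succ) (fc i.succ s * ds) (rightResolvent T s) := by
  obtain ⟨τ, hτ, hbτ⟩ := hb
  obtain rfl : b = fun i => τ (e i) := funext hbτ
  have hc := h.continuousOn hW hf hJ
  have hi := hU.integrable_rightForm hJ hUW Γ (hf.2 J hJ).1.continuousOn
  have ha := fun i : Fin 7 => hU.integrable_opAssocL hJ hUW Γ (hc i.succ) (τ (e i.succ))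
  have hsum := hU.rightCalculus_eq hJ hUW Γ hW hf h.standard
  simp only [sum_odotL_rightForm] at hsum
  refine ⟨?_, hi, ha, ?_⟩
  · rw [hsum, OrientedBoundary.integral_sum _ fun i _ =>
      (OrientedBoundary.odotL_integral (hU.integrable_rightForm hJ hUW Γ (hc i)) _).1]
    refine IsParaLinear.smul _ (IsParaLinear.sum _ fun i _ => IsParaLinear.boundaryIntegral hJ
      (OrientedBoundary.odotL_integral (hU.integrable_rightForm hJ hUW Γ (hc i)) _).1
      fun z _ w => (isParaLinear_rightForm T _ _ _).odotL _)
  · rw [hsum, ← smul_sub, ← OrientedBoundary.integral_sum _ fun i _ => ha i,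
      ← OrientedBoundary.integral_sub hi]
    · congr 1
      refine OrientedBoundary.integral_congr hJ fun z hz w => ?_
      have hz' := frontier_slice_preimage_subset hUW J hz
      -- The left associator has the product `(p q) ⊙ f` first, which is why the correction enters
      -- with a minus sign here.
      have h1 : ∀ i, odotL (τ (e i)) (rightForm T (fc i) (slice J z) (slice J w)) =
          odotL ((τ (e i) * fc i (slice J z)) * slice J w) (rightResolvent T (slice J z)) -
          opAssocL (τ (e i)) (fc i (slice J z) * slice J w) (rightResolvent T (slice J z)) := by
        intro i
        rw [opAssocL, rightForm, h.apply_slice hW hJ hz' i, mul_slice_assoc hJ, sub_sub_cancel]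
      have h2 : opAssocL (τ (e 0)) (fc 0 (slice J z) * slice J w) (rightResolvent T (slice J z)) =
          0 := by
        rw [← one_def, map_one_of_map_mul hτ, opAssocL, one_odotL, oone_mul, sub_self]
      rw [Finset.sum_congr rfl fun i _ => h1 i, Finset.sum_sub_distrib,
        Fin.sum_univ_succ fun i => opAssocL _ _ _, h2, zero_add, rightForm,
        (isRightExpansion_iff.1 h).2 _ hz', osum_mul, ← odotLₗ_apply, map_sum, LinearMap.sum_apply]
      rfl
    · exact .sum _ fun i _ => ha i

/-- The associator vanishes as on the left, now by associativity of left multiplication by `ℂ_J`.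
The last formula needs `f(s) ds ∈ ℂ_J`, so that liftability moves this factor outside the resolvent
under `Re`. -/
theorem IsRightAdmissible.rightCalculus_inSlice (hU : IsRightAdmissible T U) (hJ : J ∈ imagUnits)
    (hUW : closure U ⊆ W) (Γ : OrientedBoundary (slice J ⁻¹' U)) (hW : IsAxiallySymmetric W)
    (hf : IsRightSliceRegular W f) (h : IsInRightSlice W J f) :
    Γ.Integrable J (rightForm T f) ∧
    rightCalculus T W f J = (2 * π)⁻¹ • Γ.integral J (rightForm T f) ∧
    ∀ v : V,
      Γ.Integrable J (fun s ds => rmul (f s * ds) (resolventInv T s v)) ∧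
      reOp V (rightCalculus T W f J v) = reOp V
        ((2 * π)⁻¹ • Γ.integral J fun s ds => rmul (f s * ds) (resolventInv T s v)) := by
  have hi := hU.integrable_rightForm hJ hUW Γ (hf.2 J hJ).1.continuousOn
  obtain ⟨f₀, f₁, hex, h₀, h₁, hff⟩ := h.expansion
  obtain ⟨c, hc⟩ := h₁.exists_complex
  obtain ⟨c₀, hc₀⟩ := h₀.exists_complex
  have heq : rightCalculus T W f J = (2 * π)⁻¹ • Γ.integral J (rightForm T f) := by
    rw [hU.rightCalculus_eq hJ hUW Γ hW hf hex]
    congr 1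
    refine OrientedBoundary.integral_congr hJ fun z hz w => ?_
    have hz' := frontier_slice_preimage_subset hUW J hz
    have h1 := hc J hJ z hz'
    rw [sum_odotL_rightForm_slice, rightForm, rightForm, rightForm, hff _ hz', oadd_mul,
      ← odotLₗ_apply (_ + _), map_add, LinearMap.add_apply, odotLₗ_apply, odotLₗ_apply, h1,
      mul_slice_assoc hJ, add_comm, (isParaLinear_rightResolvent T _).odotL_odotL]
    intro y
    have h2 := lmul_lmul_slice hJ Complex.I (c z * w) y
    rwa [slice_I, ← slice_mul hJ] at h2
  refine ⟨hi, heq, fun v => ?_⟩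
  have hi' : Γ.Integrable J (fun s ds => rmul (f s * ds) (resolventInv T s v)) :=
    .of_continuousOn hJ (((continuousOn_comp_slice_fst hUW (hf.2 J hJ).1.continuousOn).omul
      continuousOn_slice_snd).rmul (((hU.continuousOn_resolventInv hJ Γ).comp continuousOn_fst
        fun _ hp => hp.1).clm_apply continuousOn_const))
  refine ⟨hi', ?_⟩
  rw [heq, smul_apply, OrientedBoundary.integral_apply hi, map_smul, map_smul,
    (reOp V).map_boundaryIntegral hi', (reOp V).map_boundaryIntegral (hi.apply v)]
  congr 1
  refine OrientedBoundary.integral_congr hJ fun z hz w => ?_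
  have hz' := frontier_slice_preimage_subset hUW J hz
  refine reOp_rightForm (mem_pushforwardSliceResolvent hJ hU Γ
    (hU.1.notMem_of_mem_frontier hJ hz)) ?_ v
  -- On the slice `f₀`, `f₁` are given by `c₀`, `c`, and the factor `J` by `i`; the witness is the
  -- complex number representing `f(s) ds`.
  refine ⟨(c₀ z + Complex.I * c z) * w, ?_⟩
  rw [hff _ hz', hc J hJ z hz', hc₀ J hJ z hz', ← slice_mul hJ, ← sliceₗ_apply J (_ + _), map_add,
    sliceₗ_apply, sliceₗ_apply, ← slice_mul hJ Complex.I, slice_I]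

end Calculus

end OctonionCalculus

/-! ### The theorem -/

theorem mainTheorem9 {V : Type*} [NormedAddCommGroup V] [NormedSpace ℝ V] [CompleteSpace V]
    [NormedOctonionBimodule V] (T : V →L[ℝ] V) (hT : IsPowerAssociative T)
    (W : Set 𝕆) (hW : IsAxiallySymmetric W) (f : 𝕆 → 𝕆) (J : 𝕆) (hJ : J ∈ imagUnits)
    (U : Set 𝕆) (hUW : closure U ⊆ W) (Γ : OrientedBoundary (slice J ⁻¹' U)) :
    -- the left calculus
    (IsLeftSliceRegular W f → IsLeftAdmissible T U →
      (∀ (b : Fin 8 → 𝕆) (fc : Fin 8 → 𝕆 → 𝕆), IsStandardBasis b → IsLeftExpansion W b fc f →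
        IsParaLinear (leftCalculus T W f J) ∧
        Γ.Integrable J (leftForm T f) ∧
        (∀ i : Fin 7, Γ.Integrable J fun s ds =>
          opAssocR (leftResolvent T s) (ds * fc i.succ s) (b i.succ)) ∧
        leftCalculus T W f J =
          (2 * π)⁻¹ • Γ.integral J (leftForm T f) +
          (2 * π)⁻¹ • ∑ i : Fin 7, Γ.integral J fun s ds =>
            opAssocR (leftResolvent T s) (ds * fc i.succ s) (b i.succ)) ∧
      (IsInLeftSlice W J f →
        Γ.Integrable J (leftForm T f) ∧
        leftCalculus T W f J = (2 * π)⁻¹ • Γ.integral J (leftForm T f) ∧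
        ∀ v ∈ realElements V,
          Γ.Integrable J (fun s ds => rmul (ds * f s) (resolventInv T s v)) ∧
          leftCalculus T W f J v =
            (2 * π)⁻¹ • Γ.integral J fun s ds => rmul (ds * f s) (resolventInv T s v))) ∧
    -- the right calculus
    (IsRightSliceRegular W f → IsRightAdmissible T U →
      (∀ (b : Fin 8 → 𝕆) (fc : Fin 8 → 𝕆 → 𝕆), IsStandardBasis b → IsRightExpansion W b fc f →
        IsParaLinear (rightCalculus T W f J) ∧
        Γ.Integrable J (rightForm T f) ∧
        (∀ i : Fin 7, Γ.Integrable J fun s ds =>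
          opAssocL (b i.succ) (fc i.succ s * ds) (rightResolvent T s)) ∧
        rightCalculus T W f J =
          (2 * π)⁻¹ • Γ.integral J (rightForm T f) -
          (2 * π)⁻¹ • ∑ i : Fin 7, Γ.integral J fun s ds =>
            opAssocL (b i.succ) (fc i.succ s * ds) (rightResolvent T s)) ∧
      (IsInRightSlice W J f →
        Γ.Integrable J (rightForm T f) ∧
        rightCalculus T W f J = (2 * π)⁻¹ • Γ.integral J (rightForm T f) ∧
        ∀ v : V,
          Γ.Integrable J (fun s ds => rmul (f s * ds) (resolventInv T s v)) ∧
          reOp V (rightCalculus T W f J v) = reOp V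
            ((2 * π)⁻¹ • Γ.integral J fun s ds => rmul (f s * ds) (resolventInv T s v)))) :=
  ⟨fun hf hU => ⟨fun _ _ hb h => hU.leftCalculus_expansion hJ hUW Γ hW hf hb h,
      fun h => hU.leftCalculus_inSlice hJ hUW Γ hW hf h⟩,
    fun hf hU => ⟨fun _ _ hb h => hU.rightCalculus_expansion hJ hUW Γ hW hf hb h,
      fun h => hU.rightCalculus_inSlice hJ hUW Γ hW hf h⟩⟩
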